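/- Let $\mathcal B$ be a unital $\mathrm C^*$-algebra and $N\in\mathbb N$. Let $\mathcal T_{N,\mathrm{free}}$ be the $N$-regular tree whose vertices are the alternating strings on $\{1,\dots,N\}$ (finite strings, including the empty string $\emptyset$, without two equal consecutive letters), with edges $s\sim js$ for each letter $j$ and each string $s$ not beginning with $j$. Let $\mathcal T$ be a rooted subtree, that is, a connected subgraph containing $\emptyset$; we identify $\mathcal T$ with its set of vertices. For $j=1,\dots,N$ let $\mathcal H_j$ be a $\mathcal B$-$\mathcal B$-correspondence (a right Hilbert $\mathcal B$-module with a unital left action of $\mathcal B$ by adjointable operators) and let $\xi_j\in\mathcal H_j$ be a $\mathcal B$-central unit vector, i.e. $\langle\xi_j,\xi_j\rangle=1$ and $b\xi_j=\xi_jb$ for all $b\in\mathcal B$. Write $\mathcal L(\cdot)$ for the algebra of adjointable operators and $\mathcal H_j^\circ=\{h\in\mathcal H_j:\langle h,\xi_j\rangle=0\}$. **The product.** Put $\mathcal H_\emptyset^\circ=\mathcal B$ and $\mathcal H_{j_1\cdots j_m}^\circ=\mathcal H_{j_1}^\circ\otimes_{\mathcal B}\cdots\otimes_{\mathcal B}\mathcal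 H_{j_m}^\circ$. The $\mathcal T$-free product is $\mathcal H=\bigoplus_{s\in\mathcal T}\mathcal H_s^\circ$ with $\xi=1\in\mathcal B=\mathcal H_\emptyset^\circ$. For a letter $j$ let $S_j$ (respectively $S_j'$) be the set of those $s\in\mathcal T$ not beginning with $j$ for which $js\in\mathcal T$ (respectively $js\notin\mathcal T$). The identifications $\mathcal H_s^\circ\oplus\mathcal H_{js}^\circ\cong(\mathcal B\xi_j\oplus\mathcal H_j^\circ)\otimes_{\mathcal B}\mathcal H_s^\circ=\mathcal H_j\otimes_{\mathcal B}\mathcal H_s^\circ$, $s\in S_j$, give a unitary $$U_j:\mathcal H\to\Big[\mathcal H_j\otimes_{\mathcal B}\bigoplus_{s\in S_j}\mathcal H_s^\circ\Big]\oplus\bigoplus_{s\in S_j'}\mathcal H_s^\circ,$$ and $\lambda_j:\mathcal L(\mathcal H_j)\to\mathcal L(\mathcal H)$ is $\lambda_j(x)=U_j^*\big([x\otimes\mathrm{id}]\oplus0\big)U_j$. **Boolean cumulants.** For $a_1,\dots,a_n\in\mathcal L(\mathcal H_j)$ the Boolean cumulants $K[a_1,\dots,a_n]\in\mathcal B$ are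 defined implicitly by $$\langle\xi_j,a_1\cdots a_n\xi_j\rangle=\sum_{\pi}K_\pi[a_1,\dots,a_n]\qquad(n\ge1),$$ where $\pi$ runs over the partitions of $\{1,\dots,n\}$ into intervals and $K_\pi[a_1,\dots,a_n]$ is the product, from left to right, of the cumulants $K[a_{j+1},\dots,a_k]$ of the blocks $\{j+1,\dots,k\}$ of $\pi$. **Partitions.** Let $\chi:\{1,\dots,\ell\}\to\{1,\dots,N\}$. A partition of a finite totally ordered set is non-crossing if there are no $i_1<j_1<i_2<j_2$ with $i_1,i_2$ in one block and $j_1,j_2$ in a different block. A block $V$ is nested inside a block $W$ if there are $j,k\in W$ with $j<i<k$ for all $i\in V$. The chain of $V$ is $(V,V_2,\dots,V_d)$, where $V_2,\dots,V_d$ are all the blocks inside which $V$ is nested, ordered from the innermost to the outermost. Let $\mathcal{NC}(\chi,\mathcal T)$ be the set of non-crossing partitions $\pi$ of $\{1,\dots,\ell\}$ such that $\chi$ is constant on each block (with value $\chi(V)$ on the block $V$) and such that $\chi(V)\chi(V_2)\cdots\chi(V_d)\in\mathcal T$ for every block $V$ with chain $(V,V_2,\dots,V_d)$. **The terms.** For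 $S\subseteq\{1,\dots,\ell\}$, a non-crossing partition $\pi$ of $S$ on whose blocks $\chi$ is constant, and $a_i\in\mathcal L(\mathcal H_{\chi(i)})$ for $i\in S$, there is a well-defined $\Lambda_{\chi,\pi}[(a_i)_{i\in S}]\in\mathcal B$ determined by the following recursion. For the empty partition the value is $1$. If $V$ is any block of $\pi$ that is an interval of $S$, with elements $v_1<\dots<v_m$, then: if $S$ has elements greater than those of $V$, and $n$ is the least of them, $\Lambda_{\chi,\pi}[(a_i)_{i\in S}]$ equals $\Lambda_{\chi,\pi\setminus V}$ evaluated at the family $(a_i)_{i\in S\setminus V}$ in which $a_n$ is replaced by $K[a_{v_1},\dots,a_{v_m}]\,a_n$ (left action of $\mathcal B$ composed with $a_n$); otherwise $$\Lambda_{\chi,\pi}[(a_i)_{i\in S}]=\Lambda_{\chi,\pi\setminus V}[(a_i)_{i\in S\setminus V}]\;K[a_{v_1},\dots,a_{v_m}].$$ Here $K$ is the Boolean cumulant of $\mathcal L(\mathcal H_{\chi(V)})$ with respect to $\xi_{\chi(V)}$; the result does not depend on which interval blocks are removed. **Theorem.** For all $a_i\in\mathcal L(\mathcal H_{\chi(i)})$,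 $i=1,\dots,\ell$, $$\big\langle\xi,\lambda_{\chi(1)}(a_1)\cdots\lambda_{\chi(\ell)}(a_\ell)\,\xi\big\rangle=\sum_{\pi\in\mathcal{NC}(\chi,\mathcal T)}\Lambda_{\chi,\pi}[a_1,\dots,a_\ell].$$ -/

import Mathlib

universe u

namespace TFree

open scoped TensorProduct
open MulOpposite

/-- A semi-inner-product `B`-`B`-correspondence over a unital C*-algebra `B`: a complex vector space
with commuting unital left and right actions of `B` (the right action is given as an action of
`Bᵐᵒᵖ`) and a positive semidefinite `B`-valued form, conjugate linear in the first and `B`-linear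
in the second variable, for which `b` and `star b` act from the left as mutually adjoint operators. -/
structure PreCorr (B : Type u) [CStarAlgebra B] [PartialOrder B] [StarOrderedRing B] where
  carrier : Type u
  [addCommGroup : AddCommGroup carrier]
  [module : Module ℂ carrier]
  ip : carrier →ₗ⋆[ℂ] carrier →ₗ[ℂ] B
  lact : B →ₐ[ℂ] Module.End ℂ carrier
  ract : Bᵐᵒᵖ →ₐ[ℂ] Module.End ℂ carrier
  lact_ract : ∀ b c x, lact b (ract c x) = ract c (lact b x)
  ip_ract : ∀ x y b, ip x (ract (op b) y) = ip x y * b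
  star_ip : ∀ x y, star (ip x y) = ip y x
  ip_nonneg : ∀ x, 0 ≤ ip x x
  ip_lact : ∀ b x y, ip x (lact b y) = ip (lact (star b) x) y

attribute [instance] PreCorr.addCommGroup PreCorr.module

variable {B : Type u} [CStarAlgebra B] [PartialOrder B] [StarOrderedRing B]

namespace PreCorr

instance : CoeSort (PreCorr B) (Type u) := ⟨PreCorr.carrier⟩

variable (P Q : PreCorr B)

theorem ip_ract_left (x y : P) (b : B) : P.ip (P.ract (op b) x) y = star b * P.ip x y := by
  rw [← P.star_ip, P.ip_ract, star_mul, P.star_ip]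

theorem ip_lact_left (x y : P) (b : B) : P.ip (P.lact b x) y = P.ip x (P.lact (star b) y) := by
  rw [P.ip_lact, star_star]

theorem norm_ip_sq_le (x y : P) : ‖P.ip x y‖ ^ 2 ≤ ‖P.ip x x‖ * ‖P.ip y y‖ := by
  have key : ∀ m : ℝ, 0 < m → ‖P.ip x x‖ ≤ m → ‖P.ip x y‖ ^ 2 ≤ m * ‖P.ip y y‖ := by
    intro m hm hx
    set a := P.ip x y with ha
    have h1 : 0 ≤ P.ip (P.ract (op a) x - (m : ℂ) • y) (P.ract (op a) x - (m : ℂ) • y) :=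
      P.ip_nonneg _
    have h2 : P.ip (P.ract (op a) x - (m : ℂ) • y) (P.ract (op a) x - (m : ℂ) • y)
        = star a * P.ip x x * a - (2 * m) • (star a * a) + (m * m) • P.ip y y := by
      have hyx : P.ip y x = star a := (P.star_ip x y).symm
      simp only [map_sub, map_smul, LinearMap.sub_apply, P.ip_ract, P.ip_ract_left,
        LinearMap.map_smulₛₗ, LinearMap.smul_apply, ← ha, hyx, Complex.conj_ofReal]
      simp only [Complex.coe_smul]
      module
    have h3 : star a * P.ip x x * a ≤ m • (star a * a) := by
      refine (CStarAlgebra.star_left_conjugate_le_norm_smul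
        (hb := IsSelfAdjoint.of_nonneg (P.ip_nonneg x))).trans ?_
      exact smul_le_smul_of_nonneg_right hx (star_mul_self_nonneg a)
    have h4 : m • (star a * a) ≤ (m * m) • P.ip y y := by
      rw [h2] at h1
      have h5 : 0 ≤ m • (star a * a) - (2 * m) • (star a * a) + (m * m) • P.ip y y :=
        h1.trans (by gcongr)
      have h6 : m • (star a * a) - (2 * m) • (star a * a) + (m * m) • P.ip y y
        = (m * m) • P.ip y y - m • (star a * a) := by module
      rw [h6] at h5
      exact sub_nonneg.1 h5
    have h7 : star a * a ≤ m • P.ip y y := by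
      rw [mul_smul] at h4
      exact (smul_le_smul_iff_of_pos_left hm).1 h4
    have h8 := CStarAlgebra.norm_le_norm_of_nonneg_of_le (star_mul_self_nonneg a) h7
    rw [CStarRing.norm_star_mul_self, norm_smul, Real.norm_of_nonneg hm.le] at h8
    nlinarith
  refine le_of_forall_pos_le_add fun ε hε => ?_
  have hd : 0 < ε / (‖P.ip y y‖ + 1) := by positivity
  have h := key (‖P.ip x x‖ + ε / (‖P.ip y y‖ + 1)) (by positivity) (by linarith)
  refine h.trans ?_
  rw [add_mul]
  gcongr
  rw [div_mul_eq_mul_div, div_le_iff₀ (by positivity)]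
  nlinarith [norm_nonneg (P.ip y y)]

/-- The (semi)norm `‖x‖ = ‖⟨x, x⟩‖ ^ (1 / 2)`. -/
noncomputable instance instNorm : Norm P := ⟨fun x => √‖P.ip x x‖⟩

theorem norm_def (x : P) : ‖x‖ = √‖P.ip x x‖ := rfl

theorem norm_sq (x : P) : ‖x‖ ^ 2 = ‖P.ip x x‖ := Real.sq_sqrt (norm_nonneg _)

theorem norm_ip_le (x y : P) : ‖P.ip x y‖ ≤ ‖x‖ * ‖y‖ := by
  rw [norm_def, norm_def, ← Real.sqrt_mul (norm_nonneg _)]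
  exact Real.le_sqrt_of_sq_le (P.norm_ip_sq_le x y)

theorem seminormCore : SeminormedSpace.Core ℂ P where
  norm_nonneg x := Real.sqrt_nonneg _
  norm_smul c x := by
    rw [norm_def, norm_def]
    simp only [map_smul, LinearMap.map_smulₛₗ, LinearMap.smul_apply, norm_smul, ← mul_assoc,
      RCLike.norm_conj]
    rw [Real.sqrt_mul (by positivity), Real.sqrt_mul_self (norm_nonneg _)]
  norm_triangle x y := by
    have hx : 0 ≤ ‖x‖ := Real.sqrt_nonneg _
    have hy : 0 ≤ ‖y‖ := Real.sqrt_nonneg _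
    refine abs_le_of_sq_le_sq' ?_ (by positivity) |>.2
    rw [P.norm_sq]
    simp only [map_add, LinearMap.add_apply]
    calc _ ≤ ‖P.ip x x‖ + ‖P.ip y x‖ + (‖P.ip x y‖ + ‖P.ip y y‖) :=
          (norm_add_le _ _).trans (add_le_add (norm_add_le _ _) (norm_add_le _ _))
      _ ≤ ‖x‖ ^ 2 + ‖y‖ * ‖x‖ + (‖x‖ * ‖y‖ + ‖y‖ ^ 2) := by
          rw [P.norm_sq, P.norm_sq]
          gcongr <;> exact P.norm_ip_le _ _
      _ = _ := by ring

noncomputable instance : SeminormedAddCommGroup P := SeminormedAddCommGroup.ofCore P.seminormCore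

noncomputable instance : NormedSpace ℂ P where
  norm_smul_le c x := (P.seminormCore.norm_smul c x).le

theorem norm_eq_of_ip {P Q : PreCorr B} {x : P} {y : Q} (h : P.ip x x = Q.ip y y) :
    ‖x‖ = ‖y‖ := by rw [norm_def, norm_def, h]

theorem norm_ract_le (b : B) (x : P) : ‖P.ract (op b) x‖ ≤ ‖b‖ * ‖x‖ := by
  refine abs_le_of_sq_le_sq' ?_ (by positivity) |>.2
  rw [P.norm_sq, P.ip_ract, P.ip_ract_left, mul_pow, P.norm_sq]
  calc _ ≤ ‖star b‖ * ‖P.ip x x‖ * ‖b‖ :=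
        (norm_mul_le _ _).trans (mul_le_mul_of_nonneg_right (norm_mul_le _ _) (norm_nonneg _))
    _ = _ := by rw [norm_star]; ring

theorem norm_lact_le (b : B) (x : P) : ‖P.lact b x‖ ≤ ‖b‖ * ‖x‖ := by
  refine abs_le_of_sq_le_sq' ?_ (by positivity) |>.2
  rw [P.norm_sq, mul_pow, P.norm_sq]
  have h1 : star b * b ≤ algebraMap ℝ B (‖b‖ ^ 2) := by
    refine (IsSelfAdjoint.le_algebraMap_norm_self
      (a := star b * b) (IsSelfAdjoint.star_mul_self b)).trans_eq ?_
    rw [CStarRing.norm_star_mul_self, sq]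
  obtain ⟨c, hc⟩ := CStarAlgebra.nonneg_iff_eq_star_mul_self.1 (sub_nonneg.2 h1)
  have h2 : P.ip (P.lact c x) (P.lact c x)
      = ((‖b‖ ^ 2 : ℝ) : ℂ) • P.ip x x - P.ip (P.lact b x) (P.lact b x) := by
    rw [P.ip_lact_left, P.ip_lact_left, ← Module.End.mul_apply, ← Module.End.mul_apply,
      ← map_mul, ← map_mul, ← hc, map_sub, LinearMap.sub_apply, map_sub,
      IsScalarTower.algebraMap_apply ℝ ℂ B, AlgHom.commutes, Module.algebraMap_end_apply, map_smul]
    rfl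
  have h3 : P.ip (P.lact b x) (P.lact b x) ≤ ((‖b‖ ^ 2 : ℝ) : ℂ) • P.ip x x := by
    rw [← sub_nonneg, ← h2]; exact P.ip_nonneg _
  refine (CStarAlgebra.norm_le_norm_of_nonneg_of_le (P.ip_nonneg _) h3).trans_eq ?_
  rw [norm_smul, Complex.norm_real, Real.norm_of_nonneg (by positivity)]

theorem continuous_ip : Continuous fun p : P × P => P.ip p.1 p.2 := by
  let F : P →L⋆[ℂ] P →L[ℂ] B := LinearMap.mkContinuous₂ P.ip 1 fun x y => by
    rw [one_mul]; exact P.norm_ip_le x y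
  change Continuous fun p : P × P => F p.1 p.2
  fun_prop

end PreCorr

/-- Completeness for the norm `‖⟨x, x⟩‖ ^ (1 / 2)`. -/
def PreCorr.IsComplete (P : PreCorr B) : Prop := CompleteSpace P

/-- A `B`-`B`-correspondence: a right Hilbert `B`-module (definite inner product, complete norm) with
a left action of `B` by adjointable operators. -/
structure Corr (B : Type u) [CStarAlgebra B] [PartialOrder B] [StarOrderedRing B]
    extends PreCorr B where
  definite : ∀ x, ip x x = 0 → x = 0
  complete : toPreCorr.IsComplete

instance : CoeSort (Corr B) (Type u) := ⟨fun E => E.toPreCorr⟩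

namespace Corr

instance (E : Corr B) : CompleteSpace E := E.complete

noncomputable instance (E : Corr B) : NormedAddCommGroup E :=
  { (inferInstance : SeminormedAddCommGroup E.toPreCorr) with
    eq_of_dist_eq_zero := fun {x y} h => by
      rw [dist_eq_norm, PreCorr.norm_def, Real.sqrt_eq_zero (norm_nonneg _), norm_eq_zero] at h
      exact sub_eq_zero.1 (E.definite _ h) }

theorem ext_ip (E : Corr B) {x y : E} (h : ∀ z, E.ip x z = E.ip y z) : x = y := by
  refine sub_eq_zero.1 (E.definite _ ?_)
  have h1 : E.ip (x - y) = 0 := by rw [map_sub]; exact sub_eq_zero.2 (LinearMap.ext h)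
  rw [h1, LinearMap.zero_apply]

theorem ext_ip' (E : Corr B) {x y : E} (h : ∀ z, E.ip z x = E.ip z y) : x = y := by
  refine sub_eq_zero.1 (E.definite _ ?_)
  rw [map_sub, h, sub_self]

end Corr

namespace PreCorr

variable (P : PreCorr B)

open UniformSpace

noncomputable def cmap : P →ₗ[ℂ] Completion P := (Completion.toComplₗᵢ (𝕜 := ℂ) (E := P)).toLinearMap

theorem norm_cmap (x : P) : ‖P.cmap x‖ = ‖x‖ := Completion.norm_coe x

theorem dense_cmap : DenseRange P.cmap := Completion.denseRange_coe

noncomputable def cip₁ : P →ₗ⋆[ℂ] (Completion P →L[ℂ] B) where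
  toFun x := (P.ip x).extendOfNorm P.cmap
  map_add' x y := by
    refine ContinuousLinearMap.ext fun z => ?_
    refine P.dense_cmap.induction_on z (isClosed_eq (by fun_prop) (by fun_prop)) fun z => ?_
    rw [_root_.add_apply]
    rw [LinearMap.extendOfNorm_eq P.dense_cmap ⟨‖x + y‖, fun z => by
        rw [norm_cmap]; exact P.norm_ip_le _ _⟩,
      LinearMap.extendOfNorm_eq P.dense_cmap ⟨‖x‖, fun z => by
        rw [norm_cmap]; exact P.norm_ip_le _ _⟩,
      LinearMap.extendOfNorm_eq P.dense_cmap ⟨‖y‖, fun z => by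
        rw [norm_cmap]; exact P.norm_ip_le _ _⟩, map_add, LinearMap.add_apply]
  map_smul' c x := by
    refine ContinuousLinearMap.ext fun z => ?_
    refine P.dense_cmap.induction_on z (isClosed_eq (by fun_prop) (by fun_prop)) fun z => ?_
    rw [_root_.smul_apply]
    rw [LinearMap.extendOfNorm_eq P.dense_cmap ⟨‖c • x‖, fun z => by
        rw [norm_cmap]; exact P.norm_ip_le _ _⟩,
      LinearMap.extendOfNorm_eq P.dense_cmap ⟨‖x‖, fun z => by
        rw [norm_cmap]; exact P.norm_ip_le _ _⟩, LinearMap.map_smulₛₗ, LinearMap.smul_apply]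

theorem cip₁_apply (x y : P) : P.cip₁ x (P.cmap y) = P.ip x y :=
  LinearMap.extendOfNorm_eq P.dense_cmap ⟨‖x‖, fun z => by
        rw [norm_cmap]; exact P.norm_ip_le _ _⟩ y

theorem norm_cip₁_le (x : P) : ‖P.cip₁ x‖ ≤ 1 * ‖P.cmap x‖ := by
  rw [one_mul, norm_cmap]
  exact LinearMap.opNorm_extendOfNorm_le P.dense_cmap (norm_nonneg _) fun z => by
        rw [norm_cmap]; exact P.norm_ip_le _ _

/-- The inner product on the completion. -/
noncomputable def cip : Completion P →L⋆[ℂ] (Completion P →L[ℂ] B) := P.cip₁.extendOfNorm P.cmap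

theorem cip_apply (x y : P) : P.cip (P.cmap x) (P.cmap y) = P.ip x y := by
  rw [cip, LinearMap.extendOfNorm_eq P.dense_cmap ⟨1, P.norm_cip₁_le⟩, cip₁_apply]

noncomputable def cop (f : Module.End ℂ P) : Completion P →L[ℂ] Completion P :=
  (P.cmap ∘ₗ f).extendOfNorm P.cmap

theorem cop_apply {f : Module.End ℂ P} (hf : ∃ C, ∀ x, ‖f x‖ ≤ C * ‖x‖) (x : P) :
    P.cop f (P.cmap x) = P.cmap (f x) :=
  LinearMap.extendOfNorm_eq P.dense_cmap
    (hf.imp fun C hC x => by simpa only [norm_cmap, LinearMap.comp_apply] using hC x) x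

theorem clm_ext {f g : Completion P →L[ℂ] Completion P}
    (h : ∀ x, f (P.cmap x) = g (P.cmap x)) : f = g :=
  ContinuousLinearMap.ext fun z => P.dense_cmap.induction_on (p := fun z => f z = g z) z
    (isClosed_eq f.continuous g.continuous) h

noncomputable def copHom {R : Type u} [Semiring R] [Algebra ℂ R] (φ : R →ₐ[ℂ] Module.End ℂ P)
    (hφ : ∀ r, ∃ C, ∀ x, ‖φ r x‖ ≤ C * ‖x‖) : R →ₐ[ℂ] (Completion P →L[ℂ] Completion P) :=
  AlgHom.ofLinearMap
    { toFun := fun r => P.cop (φ r)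
      map_add' := fun r s => P.clm_ext fun z => by
        rw [_root_.add_apply, P.cop_apply (hφ _), P.cop_apply (hφ _), P.cop_apply (hφ _), map_add,
          LinearMap.add_apply, map_add]
      map_smul' := fun c r => P.clm_ext fun z => by
        rw [_root_.smul_apply, P.cop_apply (hφ _), P.cop_apply (hφ _), map_smul,
          LinearMap.smul_apply, map_smul, RingHom.id_apply] }
    (P.clm_ext fun z => by
        rw [LinearMap.coe_mk, AddHom.coe_mk, P.cop_apply (hφ _), map_one]; rfl)
    fun r s => P.clm_ext fun z => by
        rw [LinearMap.coe_mk, AddHom.coe_mk, P.cop_apply (hφ _), mul_apply_eq_comp,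
          P.cop_apply (hφ _), P.cop_apply (hφ _), map_mul, Module.End.mul_apply]

noncomputable def endHom : (Completion P →L[ℂ] Completion P) →ₐ[ℂ] Module.End ℂ (Completion P) :=
  { ContinuousLinearMap.toLinearMapRingHom with commutes' := fun _ => rfl }

/-- The structure of a correspondence carried over to the (separated) completion. -/
noncomputable def completionPre : PreCorr B where
  carrier := Completion P
  ip :=
    { toFun := fun x => (P.cip x).toLinearMap
      map_add' := fun x y => by ext; simp
      map_smul' := fun c x => by ext; simp }
  lact := P.endHom.comp <| P.copHom P.lact fun b => ⟨_, P.norm_lact_le b⟩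
  ract := P.endHom.comp <| P.copHom P.ract fun b => ⟨_, P.norm_ract_le b.unop⟩
  lact_ract b c x := by
    refine P.dense_cmap.induction_on (p := fun z => P.cop (P.lact b) (P.cop (P.ract c) z)
      = P.cop (P.ract c) (P.cop (P.lact b) z)) x (isClosed_eq (by fun_prop) (by fun_prop)) fun z => ?_
    rw [← op_unop c, P.cop_apply ⟨_, P.norm_lact_le b⟩, P.cop_apply ⟨_, P.norm_ract_le c.unop⟩, P.cop_apply ⟨_, P.norm_lact_le b⟩,
      P.cop_apply ⟨_, P.norm_ract_le c.unop⟩, P.lact_ract]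
  ip_ract x y b := by
    refine P.dense_cmap.induction_on₂ (p := fun x y => P.cip x (P.cop (P.ract (op b)) y)
      = P.cip x y * b) (isClosed_eq (by fun_prop) (by fun_prop)) (fun x y => ?_) x y
    simp only [P.cop_apply ⟨_, P.norm_ract_le b⟩, P.cip_apply, P.ip_ract]
  star_ip x y := by
    refine P.dense_cmap.induction_on₂ (p := fun x y => star (P.cip x y) = P.cip y x)
      (isClosed_eq (by fun_prop) (by fun_prop)) (fun x y => ?_) x y
    simp only [P.cip_apply, P.star_ip]
  ip_nonneg x := by
    refine P.dense_cmap.induction_on (p := fun x => 0 ≤ P.cip x x) x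
      (isClosed_le (by fun_prop) (by fun_prop)) (fun x => ?_)
    simp only [P.cip_apply, P.ip_nonneg]
  ip_lact b x y := by
    refine P.dense_cmap.induction_on₂ (p := fun x y => P.cip x (P.cop (P.lact b) y)
      = P.cip (P.cop (P.lact (star b)) x) y) (isClosed_eq (by fun_prop) (by fun_prop))
        (fun x y => ?_) x y
    simp only [P.cop_apply ⟨_, P.norm_lact_le _⟩, P.cip_apply, P.ip_lact]

theorem norm_completionPre (x : Completion P) : P.completionPre.instNorm.norm x = ‖x‖ := by
  change √‖P.cip x x‖ = _
  refine P.dense_cmap.induction_on (p := fun x => √‖P.cip x x‖ = ‖x‖) x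
      (isClosed_eq (by fun_prop) (by fun_prop)) (fun x => ?_)
  rw [P.norm_cmap, P.cip_apply, P.norm_def]

noncomputable def idEquiv : P.completionPre ≃+ Completion P := AddEquiv.refl (Completion P)

theorem isometry_idEquiv : Isometry P.idEquiv :=
  AddMonoidHomClass.isometry_of_norm P.idEquiv fun x => (P.norm_completionPre x).symm

/-- The separation-completion of a semi-inner-product correspondence. -/
noncomputable def completion : Corr B where
  toPreCorr := P.completionPre
  definite x h := by
    have h1 : ‖P.idEquiv x‖ = 0 := by
      refine (P.norm_completionPre x).symm.trans ?_
      change √‖P.completionPre.ip x x‖ = 0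
      rw [h]; simp
    exact norm_eq_zero.1 h1
  complete := (P.isometry_idEquiv.isUniformInducing.completeSpace_congr P.idEquiv.surjective).2
    inferInstance

/-- The canonical map of a semi-inner-product correspondence to its separation-completion. -/
noncomputable def toCompletion : P →ₗ[ℂ] P.completion := P.cmap

theorem ip_toCompletion (x y : P) :
    P.completion.ip (P.toCompletion x) (P.toCompletion y) = P.ip x y := P.cip_apply x y

theorem lact_toCompletion (b : B) (x : P) :
    P.completion.lact b (P.toCompletion x) = P.toCompletion (P.lact b x) :=
  P.cop_apply (f := P.lact b) ⟨_, P.norm_lact_le _⟩ x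

theorem ract_toCompletion (b : B) (x : P) :
    P.completion.ract (op b) (P.toCompletion x) = P.toCompletion (P.ract (op b) x) :=
  P.cop_apply (f := P.ract (op b)) ⟨_, P.norm_ract_le _⟩ x

theorem norm_toCompletion (x : P) : ‖P.toCompletion x‖ = ‖x‖ :=
  norm_eq_of_ip (P.ip_toCompletion x x)

theorem dense_toCompletion : DenseRange P.toCompletion := by
  rw [Metric.denseRange_iff]
  intro x r hr
  obtain ⟨y, hy⟩ := Metric.denseRange_iff.1 P.dense_cmap (P.idEquiv x) r hr
  refine ⟨y, ?_⟩
  exact (P.isometry_idEquiv.dist_eq x (P.toCompletion y)).symm.trans_lt hy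

end PreCorr

namespace PreCorr

variable (P : PreCorr B) (Q : Corr B)

/-- The continuous extension of a bounded linear map to the separation-completion. -/
noncomputable def extend {P : PreCorr B} {Q : Corr B} (f : P →ₗ[ℂ] Q) : P.completion →L[ℂ] Q :=
  f.extendOfNorm P.toCompletion

theorem extend_apply {P : PreCorr B} {Q : Corr B} (f : P →ₗ[ℂ] Q) (hf : ∃ C, ∀ x, ‖f x‖ ≤ C * ‖x‖)
    (x : P) : extend f (P.toCompletion x) = f x :=
  LinearMap.extendOfNorm_eq P.dense_toCompletion
    (hf.imp fun C h x => by rw [norm_toCompletion]; exact h x) x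

theorem bound_of_ip {P : PreCorr B} {Q : Corr B} {f : P →ₗ[ℂ] Q}
    (hf : ∀ x y, Q.ip (f x) (f y) = P.ip x y) : ∃ C, ∀ x, ‖f x‖ ≤ C * ‖x‖ :=
  ⟨1, fun x => by rw [one_mul]; exact (norm_eq_of_ip (hf x x)).le⟩

theorem extend_ip {P : PreCorr B} {Q : Corr B} {f : P →ₗ[ℂ] Q}
    (hf : ∀ x y, Q.ip (f x) (f y) = P.ip x y) (x y : P.completion) :
    Q.ip (extend f x) (extend f y) = P.completion.ip x y := by
  have h1 : Continuous fun p : P.completion × P.completion =>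
      Q.ip (extend f p.1) (extend f p.2) :=
    Q.continuous_ip.comp (((extend f).continuous.comp continuous_fst).prodMk
      ((extend f).continuous.comp continuous_snd))
  refine P.dense_toCompletion.induction_on₂
    (p := fun x y => Q.ip (extend f x) (extend f y) = P.completion.ip x y)
    (isClosed_eq h1 P.completion.continuous_ip) (fun x y => ?_) x y
  rw [extend_apply f (bound_of_ip hf), extend_apply f (bound_of_ip hf), hf, ip_toCompletion]

end PreCorr

namespace Corr

/-- The algebra `L(E)` of adjointable (in particular right `B`-linear and bounded) operators. -/
def adj (E : Corr B) : Subalgebra ℂ (E →L[ℂ] E) where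
  carrier := {T | (∀ x b, T (E.ract b x) = E.ract b (T x)) ∧
    ∃ S : E → E, ∀ x y, E.ip (T x) y = E.ip x (S y)}
  mul_mem' := by
    rintro T T' ⟨h, S, hS⟩ ⟨h', S', hS'⟩
    exact ⟨fun x b => by simp [h, h'], S' ∘ S, fun x y => by simp [hS, hS']⟩
  add_mem' := by
    rintro T T' ⟨h, S, hS⟩ ⟨h', S', hS'⟩
    exact ⟨fun x b => by simp [h, h'], S + S', fun x y => by simp [hS, hS']⟩
  algebraMap_mem' c := by
    refine ⟨fun x b => by simp [Algebra.algebraMap_eq_smul_one], fun x => star c • x, fun x y => ?_⟩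
    simp [Algebra.algebraMap_eq_smul_one]

theorem mem_adj_of {E : Corr B} {T : E →L[ℂ] E} {S : E → E}
    (h : ∀ x y, E.ip (T x) y = E.ip x (S y)) : T ∈ E.adj := by
  refine ⟨fun x b => ?_, S, h⟩
  refine E.ext_ip fun z => ?_
  rw [← op_unop b, h, E.ip_ract_left, E.ip_ract_left, h]

/-- The left action of `b : B`, as an element of `L(E)`. -/
noncomputable def leftOp (E : Corr B) (b : B) : E.adj :=
  ⟨LinearMap.mkContinuous (E.lact b) ‖b‖ (E.norm_lact_le b),
    mem_adj_of (S := E.lact (star b)) fun x y => E.ip_lact_left x y b⟩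

end Corr

/-- A `B`-`B`-correspondence with a `B`-central unit vector `ξ`: `⟨ξ, ξ⟩ = 1` and `b ξ = ξ b`. -/
structure PointedCorr (B : Type u) [CStarAlgebra B] [PartialOrder B] [StarOrderedRing B]
    extends Corr B where
  vec : toPreCorr.carrier
  ip_vec : ip vec vec = 1
  central : ∀ b, lact b vec = ract (op b) vec

instance : CoeSort (PointedCorr B) (Type u) := ⟨fun E => E.toCorr.toPreCorr.carrier⟩

theorem PreCorr.isComplete_of_equiv (P : PreCorr B) {X : Type*} [SeminormedAddCommGroup X]
    [CompleteSpace X] (e : P ≃+ X) (he : ∀ x, ‖e x‖ = ‖x‖) : P.IsComplete :=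
  ((AddMonoidHomClass.isometry_of_norm e he).isUniformInducing.completeSpace_congr
    e.surjective).2 inferInstance

/-- `B` as a correspondence over itself, with `⟨x, y⟩ = star x * y`. -/
noncomputable def selfPre (B : Type u) [CStarAlgebra B] [PartialOrder B] [StarOrderedRing B] :
    PreCorr B where
  carrier := B
  ip :=
    { toFun := fun x => LinearMap.mulLeft ℂ (star x)
      map_add' := fun x y => by ext; simp [add_mul]
      map_smul' := fun c x => by ext; simp }
  lact := Algebra.lmul ℂ B
  ract :=
    { toFun := fun b => LinearMap.mulRight ℂ b.unop
      map_one' := by ext; simp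
      map_mul' := fun x y => by ext; simp [mul_assoc]
      map_zero' := by ext; simp
      map_add' := fun x y => by ext; simp [mul_add]
      commutes' := fun c => by ext; simp [Algebra.algebraMap_eq_smul_one] }
  lact_ract b c x := by simp [mul_assoc]
  ip_ract x y b := by simp [mul_assoc]
  star_ip x y := by simp
  ip_nonneg x := star_mul_self_nonneg (x : B)
  ip_lact b x y := by simp

/-- `B` as a correspondence over itself, with `⟨x, y⟩ = star x * y`. -/
noncomputable def selfCorr (B : Type u) [CStarAlgebra B] [PartialOrder B] [StarOrderedRing B] :
    Corr B where
  toPreCorr := selfPre B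
  definite := fun (x : B) h => (CStarRing.star_mul_self_eq_zero_iff x).1 h
  complete := by
    refine PreCorr.isComplete_of_equiv (selfPre B) (X := B) (AddEquiv.refl B) fun (x : B) => ?_
    change ‖x‖ = √‖star x * x‖
    rw [CStarRing.norm_star_mul_self, Real.sqrt_mul_self (norm_nonneg _)]

namespace PointedCorr
variable (E : PointedCorr B)

/-- `{h | ⟨h, ξ⟩ = 0}`. -/
def complSubmodule : Submodule ℂ E where
  carrier := {h | E.ip h E.vec = 0}
  add_mem' {x y} hx hy := by
    simp only [Set.mem_ofPred_eq, map_add, LinearMap.add_apply] at *; rw [hx, hy, add_zero]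
  zero_mem' := by simp
  smul_mem' c x hx := by
    simp only [Set.mem_ofPred_eq, LinearMap.map_smulₛₗ, LinearMap.smul_apply] at *; rw [hx, smul_zero]

theorem mem_complSubmodule {x : E} : x ∈ E.complSubmodule ↔ E.ip x E.vec = 0 := Iff.rfl

theorem mem_complSubmodule' {x : E} : x ∈ E.complSubmodule ↔ E.ip E.vec x = 0 := by
  rw [mem_complSubmodule, ← E.star_ip, star_eq_zero]

theorem lact_mem (b : B) {x : E} (hx : x ∈ E.complSubmodule) : E.lact b x ∈ E.complSubmodule := by
  rw [mem_complSubmodule] at *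
  rw [E.ip_lact_left, E.central, E.ip_ract, hx, zero_mul]

theorem ract_mem (b : Bᵐᵒᵖ) {x : E} (hx : x ∈ E.complSubmodule) :
    E.ract b x ∈ E.complSubmodule := by
  rw [mem_complSubmodule] at *
  rw [← op_unop b, E.ip_ract_left, hx, mul_zero]

noncomputable def complPre : PreCorr B where
  carrier := E.complSubmodule
  ip :=
    { toFun := fun x => (E.ip x).comp E.complSubmodule.subtype
      map_add' := fun x y => by ext; simp
      map_smul' := fun c x => by ext; simp }
  lact :=
    { toFun := fun b => (E.lact b).restrict fun _ h => E.lact_mem b h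
      map_one' := by ext; simp
      map_mul' := fun x y => by ext; simp
      map_zero' := by ext; simp
      map_add' := fun x y => by ext; simp
      commutes' := fun c => by ext; simp }
  ract :=
    { toFun := fun b => (E.ract b).restrict fun _ h => E.ract_mem b h
      map_one' := by ext; simp
      map_mul' := fun x y => by ext; simp
      map_zero' := by ext; simp
      map_add' := fun x y => by ext; simp
      commutes' := fun c => LinearMap.ext fun x =>
        Subtype.ext (LinearMap.congr_fun (E.ract.commutes c) x.1) }
  lact_ract b c x := Subtype.ext (E.lact_ract b c x)
  ip_ract x y b := E.ip_ract x y b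
  star_ip x y := E.star_ip x y
  ip_nonneg x := E.ip_nonneg x
  ip_lact b x y := E.ip_lact b x y

theorem isClosed_complSubmodule : IsClosed (E.complSubmodule : Set E) := by
  have : Continuous fun x : E => E.ip x E.vec :=
    E.continuous_ip.comp (continuous_id.prodMk continuous_const)
  exact isClosed_eq this continuous_const

/-- The correspondence `H° = {h | ⟨h, ξ⟩ = 0}`. -/
noncomputable def compl : Corr B where
  toPreCorr := E.complPre
  definite := fun (x : E.complSubmodule) h => Subtype.ext (E.definite x h)
  complete := by
    have := E.isClosed_complSubmodule.completeSpace_coe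
    exact PreCorr.isComplete_of_equiv E.complPre (X := E.complSubmodule) (AddEquiv.refl _) fun x => rfl

/-- The inclusion of `H°` in `H`. -/
def complIncl : E.compl →ₗ[ℂ] E := E.complSubmodule.subtype

theorem ip_complIncl (x y : E.compl) : E.ip (E.complIncl x) (E.complIncl y) = E.compl.ip x y := rfl

/-- The projection `h ↦ h - ξ ⟨ξ, h⟩` of `H` onto `H°`. -/
noncomputable def complProj : E →ₗ[ℂ] E.compl :=
  LinearMap.codRestrict E.complSubmodule
    { toFun := fun x => x - E.ract (op (E.ip E.vec x)) E.vec
      map_add' := fun x y => by simp; abel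
      map_smul' := fun c x => by simp [smul_sub] }
    fun x => by
      rw [mem_complSubmodule']
      simp [E.ip_ract, E.ip_vec]

theorem decomp (x : E) :
    x = E.ract (op (E.ip E.vec x)) E.vec + E.complIncl (E.complProj x) := by
  change x = _ + (x - _)
  abel

end PointedCorr

section sums
open Classical

variable {I : Type} (E : I → PreCorr B)

/-- `⟨x, y⟩ = ∑ i, ⟨x i, y i⟩`. -/
noncomputable def dsumIp : (Π₀ i, E i) →ₗ⋆[ℂ] (Π₀ i, E i) →ₗ[ℂ] B where
  toFun x := DFinsupp.lsum ℂ fun i => (E i).ip (x i)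
  map_add' x y := by
    refine DFinsupp.lhom_ext fun i z => ?_
    simp
  map_smul' c x := by
    refine DFinsupp.lhom_ext fun i z => ?_
    simp

theorem dsumIp_single (x : Π₀ i, E i) (i : I) (y : E i) :
    dsumIp E x (DFinsupp.single i y) = (E i).ip (x i) y := by
  simp [dsumIp]

theorem dsumIp_eq (x y : Π₀ i, E i) (s : Finset I) (hs : y.support ⊆ s) :
    dsumIp E x y = ∑ i ∈ s, (E i).ip (x i) (y i) := by
  have : y = ∑ i ∈ s, DFinsupp.single i (y i) := by
    ext j
    rw [DFinsupp.finsetSum_apply, Finset.sum_eq_single j]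
    · simp
    · intro i _ hij; rw [DFinsupp.single_eq_of_ne hij.symm]
    · intro hj
      have : y j = 0 := by simpa using fun h => hj (hs h)
      simp [this]
  conv_lhs => rw [this]
  rw [map_sum]
  exact Finset.sum_congr rfl fun i _ => dsumIp_single E x i _

noncomputable def dsumMap {R : Type u} [Semiring R] [Algebra ℂ R]
    (φ : ∀ i, R →ₐ[ℂ] Module.End ℂ (E i)) : R →ₐ[ℂ] Module.End ℂ (Π₀ i, E i) where
  toFun b := DFinsupp.mapRange.linearMap fun i => φ i b
  map_one' := by ext x i : 2; simp
  map_mul' b c := by ext x i : 2; simp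
  map_zero' := by ext x i : 2; simp
  map_add' b c := by ext x i : 2; simp
  commutes' c := by ext x i : 2; simp

theorem dsumMap_apply {R : Type u} [Semiring R] [Algebra ℂ R]
    (φ : ∀ i, R →ₐ[ℂ] Module.End ℂ (E i)) (r : R) (x : Π₀ i, E i) (i : I) :
    dsumMap E φ r x i = φ i r (x i) := by simp [dsumMap]

/-- The algebraic direct sum of a family, with `⟨x, y⟩ = ∑ i, ⟨x i, y i⟩`. -/
noncomputable def dsumPre : PreCorr B where
  carrier := Π₀ i, E i
  ip := dsumIp E
  lact := dsumMap E fun i => (E i).lact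
  ract := dsumMap E fun i => (E i).ract
  lact_ract b c x := by
    refine DFinsupp.ext fun i => ?_
    simp only [dsumMap_apply, (E i).lact_ract]
  ip_ract x y b := by
    rw [dsumIp_eq E x _ (y.support ∪ (dsumMap E (fun i => (E i).ract) (op b) y).support)
      Finset.subset_union_right,
      dsumIp_eq E x y (y.support ∪ (dsumMap E (fun i => (E i).ract) (op b) y).support)
      Finset.subset_union_left, Finset.sum_mul]
    simp only [dsumMap_apply, PreCorr.ip_ract]
  star_ip x y := by
    rw [dsumIp_eq E x y (x.support ∪ y.support) Finset.subset_union_right,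
      dsumIp_eq E y x (x.support ∪ y.support) Finset.subset_union_left, star_sum]
    simp only [PreCorr.star_ip]
  ip_nonneg x := by
    rw [dsumIp_eq E x x _ le_rfl]
    exact Finset.sum_nonneg fun i _ => (E i).ip_nonneg _
  ip_lact b x y := by
    rw [dsumIp_eq E x _ (y.support ∪ (dsumMap E (fun i => (E i).lact) b y).support)
      Finset.subset_union_right,
      dsumIp_eq E _ y (y.support ∪ (dsumMap E (fun i => (E i).lact) b y).support)
      Finset.subset_union_left]
    simp only [dsumMap_apply, PreCorr.ip_lact]

noncomputable def dsumSingle (i : I) : E i →ₗ[ℂ] dsumPre E :=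
  DFinsupp.lsingle (R := ℂ) (M := fun i => E i) i

end sums

/-- The direct sum of two semi-inner-product correspondences. -/
noncomputable def prodPre (P Q : PreCorr B) : PreCorr B where
  carrier := P × Q
  ip :=
    { toFun := fun x => (P.ip x.1).coprod (Q.ip x.2)
      map_add' := fun x y => by ext <;> simp
      map_smul' := fun c x => by ext <;> simp }
  lact :=
    { toFun := fun b => (P.lact b).prodMap (Q.lact b)
      map_one' := by ext <;> simp
      map_mul' := fun x y => by ext <;> simp
      map_zero' := by ext <;> simp
      map_add' := fun x y => by ext <;> simp
      commutes' := fun c => by ext <;> simp }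
  ract :=
    { toFun := fun b => (P.ract b).prodMap (Q.ract b)
      map_one' := by ext <;> simp
      map_mul' := fun x y => by ext <;> simp
      map_zero' := by ext <;> simp
      map_add' := fun x y => by ext <;> simp
      commutes' := fun c => LinearMap.ext fun x =>
        Prod.ext (DFunLike.congr_fun (P.ract.commutes c) x.1)
          (DFunLike.congr_fun (Q.ract.commutes c) x.2) }
  lact_ract b c x := by ext <;> simp [P.lact_ract, Q.lact_ract]
  ip_ract x y b := by simp [P.ip_ract, Q.ip_ract, add_mul]
  star_ip x y := by simp [P.star_ip, Q.star_ip]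
  ip_nonneg x := by simpa using add_nonneg (P.ip_nonneg _) (Q.ip_nonneg _)
  ip_lact b x y := by simp [P.ip_lact, Q.ip_lact]

theorem exists_posNeg {A : Type*} [CStarAlgebra A] [PartialOrder A] [StarOrderedRing A] (G : A)
    (hG : IsSelfAdjoint G) : ∃ p N D : A, 0 ≤ p ∧ G = p - N ∧ p * N = 0 ∧ star N = N ∧
      N = star D * D := by
  obtain ⟨D, hD⟩ := CStarAlgebra.nonneg_iff_eq_star_mul_self.1 (CFC.negPart_nonneg G)
  exact ⟨G⁺, G⁻, D, CFC.posPart_nonneg G, (CFC.posPart_sub_negPart G hG).symm,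
    CFC.posPart_mul_negPart G, (IsSelfAdjoint.of_nonneg (CFC.negPart_nonneg G)).star_eq, hD⟩

theorem exists_factor {A : Type*} [CStarAlgebra A] [PartialOrder A] [StarOrderedRing A] {G : A}
    (hG : 0 ≤ G) : ∃ D : A, G = star D * D := CStarAlgebra.nonneg_iff_eq_star_mul_self.1 hG

theorem matrix_nonneg {n : Type*} [Fintype n] [DecidableEq n] (G : CStarMatrix n n B)
    (hG : IsSelfAdjoint G)
    (h : ∀ v : n → B, 0 ≤ ∑ i, ∑ j, star (v i) * G i j * v j) : 0 ≤ G := by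
  obtain ⟨p, N, D, hp, h2, h3, hNsa, hD⟩ := exists_posNeg G hG
  have h1 : star N * G * N = -(star (D * N) * (D * N)) := by
    rw [h2, hNsa, mul_assoc, sub_mul, h3, zero_sub, star_mul, hNsa, mul_neg]
    congr 1
    conv_lhs => rw [show N * (N * N) = N * (star D * D * N) by rw [← hD]]
    simp only [mul_assoc]
  have h4 : ∀ k m, (D * N) m k = 0 := by
    intro k m
    have h5 : 0 ≤ (star N * G * N) k k := by
      have := h (fun i => N i k)
      refine this.trans_eq ?_
      rw [CStarMatrix.mul_apply, Finset.sum_comm]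
      refine Finset.sum_congr rfl fun j _ => ?_
      rw [CStarMatrix.mul_apply, Finset.sum_mul]
      exact Finset.sum_congr rfl fun i _ => by rw [CStarMatrix.star_apply]
    have h6 : (star N * G * N) k k = - ∑ m, star ((D * N) m k) * (D * N) m k := by
      rw [h1]
      change - ((star (D * N) * (D * N)) k k) = _
      rw [CStarMatrix.mul_apply]
      exact congrArg _ (Finset.sum_congr rfl fun i _ => by rw [CStarMatrix.star_apply])
    rw [h6, Left.nonneg_neg_iff] at h5
    have h7 := le_antisymm h5 (Finset.sum_nonneg fun m _ => star_mul_self_nonneg _)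
    rw [Finset.sum_eq_zero_iff_of_nonneg fun m _ => star_mul_self_nonneg _] at h7
    exact (CStarRing.star_mul_self_eq_zero_iff _).1 (h7 m (Finset.mem_univ m))
  have h8 : D * N = 0 := CStarMatrix.ext fun m k => h4 k m
  have h9 : star N * N = 0 := by
    rw [hNsa]
    conv_lhs => rw [show N * N = star D * D * N by rw [← hD]]
    rw [mul_assoc, h8, mul_zero]
  have h10 : N = 0 := (CStarRing.star_mul_self_eq_zero_iff _).1 h9
  rwa [h2, h10, sub_zero]

theorem PreCorr.gram_factor (P : PreCorr B) {n : Type*} [Fintype n] [DecidableEq n] (e : n → P) :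
    ∃ c : n → n → B, ∀ i j, P.ip (e i) (e j) = ∑ k, star (c k i) * c k j := by
  let G : CStarMatrix n n B := CStarMatrix.ofMatrix fun i j => P.ip (e i) (e j)
  have hG : IsSelfAdjoint G := CStarMatrix.ext fun i j => by
    rw [CStarMatrix.star_apply]; exact P.star_ip _ _
  have hpos : 0 ≤ G := by
    refine matrix_nonneg G hG fun v => ?_
    refine (P.ip_nonneg (∑ i, P.ract (op (v i)) (e i))).trans_eq ?_
    rw [map_sum (P.ip), LinearMap.sum_apply]
    refine Finset.sum_congr rfl fun i _ => ?_
    rw [map_sum]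
    refine Finset.sum_congr rfl fun j _ => ?_
    rw [P.ip_ract, P.ip_ract_left]; rfl
  obtain ⟨C, hC⟩ := exists_factor hpos
  refine ⟨fun k i => C k i, fun i j => ?_⟩
  change G i j = _
  rw [hC, CStarMatrix.mul_apply]
  exact Finset.sum_congr rfl fun k _ => by rw [CStarMatrix.star_apply]

section tensor
variable (E F : PreCorr B)

noncomputable def tensorIp₁ (e : E) (f : F) : (E ⊗[ℂ] F) →ₗ[ℂ] B :=
  TensorProduct.lift ((F.lact.toLinearMap ∘ₗ E.ip e).compr₂ (F.ip f))

theorem tensorIp₁_tmul (e : E) (f : F) (e' : E) (f' : F) :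
    tensorIp₁ E F e f (e' ⊗ₜ f') = F.ip f (F.lact (E.ip e e') f') := rfl

/-- `⟨e ⊗ f, e' ⊗ f'⟩ = ⟨f, ⟨e, e'⟩ f'⟩`. -/
noncomputable def tensorIp : (E ⊗[ℂ] F) →ₗ⋆[ℂ] (E ⊗[ℂ] F) →ₗ[ℂ] B :=
  TensorProduct.lift (LinearMap.mk₂'ₛₗ (starRingEnd ℂ) (starRingEnd ℂ) (tensorIp₁ E F)
    (fun x y f => by ext; simp [tensorIp₁_tmul])
    (fun c x f => by ext; simp [tensorIp₁_tmul])
    (fun x f g => by ext; simp [tensorIp₁_tmul])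
    (fun c x f => by ext; simp [tensorIp₁_tmul]))

theorem tensorIp_tmul (e : E) (f : F) (e' : E) (f' : F) :
    tensorIp E F (e ⊗ₜ f) (e' ⊗ₜ f') = F.ip f (F.lact (E.ip e e') f') := rfl

theorem tensorIp_nonneg (x : E ⊗[ℂ] F) : 0 ≤ tensorIp E F x x := by
  classical
  obtain ⟨S, rfl⟩ := TensorProduct.exists_finset x
  obtain ⟨c, hc⟩ := E.gram_factor (fun i : S => i.1.1)
  rw [← Finset.sum_coe_sort]
  have : tensorIp E F (∑ i : S, i.1.1 ⊗ₜ i.1.2) (∑ i : S, i.1.1 ⊗ₜ i.1.2)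
      = ∑ k : S, F.ip (∑ i : S, F.lact (c k i) i.1.2) (∑ i : S, F.lact (c k i) i.1.2) := by
    simp only [map_sum, LinearMap.sum_apply, tensorIp_tmul, hc]
    simp only [map_mul, Module.End.mul_apply, F.ip_lact _ _ (F.lact _ _), star_star]
    rw [Finset.sum_comm' (t' := Finset.univ) (s' := fun _ => Finset.univ) (by simp)]
    rw [Finset.sum_comm]
    rw [eq_comm, Finset.sum_comm]
    refine Finset.sum_congr rfl fun j _ => ?_
    rw [Finset.sum_comm]
  rw [this]
  exact Finset.sum_nonneg fun k _ => F.ip_nonneg _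

/-- The algebraic tensor product with `⟨e ⊗ f, e' ⊗ f'⟩ = ⟨f, ⟨e, e'⟩ f'⟩`. It is taken over `ℂ`: the
vectors `e b ⊗ f - e ⊗ b f` have length zero, so the separation-completion below is the same as
that of the tensor product balanced over `B`. -/
noncomputable def tensorPre : PreCorr B where
  carrier := E ⊗[ℂ] F
  ip := tensorIp E F
  lact := (Module.End.rTensorAlgHom ℂ E F).comp E.lact
  ract := (Module.End.lTensorAlgHom ℂ F E).comp F.ract
  lact_ract b c x := by
    induction x with
    | zero => simp
    | tmul e f => rfl
    | add x y hx hy => simp only [map_add, hx, hy]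
  ip_ract x y b := by
    induction x with
    | zero => simp
    | add x x' hx hx' => simp only [map_add, LinearMap.add_apply, hx, hx', add_mul]
    | tmul e f =>
      induction y with
      | zero => simp
      | add y y' hy hy' => simp only [map_add, hy, hy', add_mul]
      | tmul e' f' =>
        change tensorIp E F (e ⊗ₜ f) (e' ⊗ₜ F.ract (op b) f') = _
        rw [tensorIp_tmul, tensorIp_tmul, F.lact_ract, F.ip_ract]
  star_ip x y := by
    induction x with
    | zero => simp
    | add x x' hx hx' => simp only [map_add, LinearMap.add_apply, star_add, hx, hx']
    | tmul e f =>
      induction y with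
      | zero => simp
      | add y y' hy hy' => simp only [map_add, LinearMap.add_apply, star_add, hy, hy']
      | tmul e' f' => simp [tensorIp_tmul, F.star_ip, F.ip_lact_left, E.star_ip]
  ip_nonneg := tensorIp_nonneg E F
  ip_lact b x y := by
    induction x with
    | zero => simp
    | add x x' hx hx' => simp only [map_add, LinearMap.add_apply, hx, hx']
    | tmul e f =>
      induction y with
      | zero => simp
      | add y y' hy hy' => simp only [map_add, hy, hy']
      | tmul e' f' =>
        change tensorIp E F (e ⊗ₜ f) (E.lact b e' ⊗ₜ f')
          = tensorIp E F (E.lact (star b) e ⊗ₜ f) (e' ⊗ₜ f')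
        rw [tensorIp_tmul, tensorIp_tmul, E.ip_lact]

theorem PreCorr.norm_le_of_pow {P : PreCorr B} (S : Module.End ℂ P)
    (hS : ∀ x y, P.ip (S x) y = P.ip x (S y)) (u : P) {C M : ℝ} (hM : 0 ≤ M)
    (h : ∀ m : ℕ, ‖(S ^ m) u‖ ≤ C * M ^ m) : ‖S u‖ ≤ M * ‖u‖ := by
  have hpow : ∀ (m : ℕ) x y, P.ip ((S ^ m) x) y = P.ip x ((S ^ m) y) := by
    intro m
    induction m with
    | zero => intro x y; rfl
    | succ m ih => intro x y; rw [pow_succ, Module.End.mul_apply, ih, hS, ← Module.End.mul_apply,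
        ← pow_succ', pow_succ]
  have hsq : ∀ m : ℕ, ‖(S ^ m) u‖ ^ 2 ≤ ‖u‖ * ‖(S ^ (2 * m)) u‖ := by
    intro m
    rw [P.norm_sq, hpow, ← Module.End.mul_apply, ← pow_add, ← two_mul]
    exact P.norm_ip_le _ _
  have hu : 0 ≤ ‖u‖ := norm_nonneg _
  have hind : ∀ k : ℕ, ‖S u‖ ^ (2 ^ k) * ‖u‖ ≤ ‖u‖ ^ (2 ^ k) * ‖(S ^ (2 ^ k)) u‖ := by
    intro k
    induction k with
    | zero => simp [mul_comm]
    | succ k ih =>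
      rcases hu.eq_or_lt with h0 | h0
      · rw [← h0]; simp
      · have h1 := pow_le_pow_left₀ (by positivity) ih 2
        have h2 : (‖u‖ ^ 2 ^ k * ‖(S ^ 2 ^ k) u‖) ^ 2
            ≤ (‖u‖ ^ 2 ^ k) ^ 2 * (‖u‖ * ‖(S ^ (2 * 2 ^ k)) u‖) := by
          rw [mul_pow]
          exact mul_le_mul_of_nonneg_left (hsq _) (by positivity)
        have h3 := h1.trans h2
        rw [mul_pow, ← pow_mul, ← pow_mul, ← pow_succ, ← pow_succ'] at h3
        nlinarith
  by_contra! hlt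
  rcases hu.eq_or_lt with h0 | h0
  · have := hsq 1
    rw [← h0, zero_mul, pow_one] at this
    rw [← h0, mul_zero] at hlt
    nlinarith
  · have hS1 : 0 < ‖S u‖ := lt_of_le_of_lt (by positivity) hlt
    rcases hM.eq_or_lt with hM0 | hM0
    · have := h 1
      rw [← hM0, pow_one, pow_one, mul_zero] at this
      linarith
    · have hr : 1 < ‖S u‖ / (M * ‖u‖) := by rwa [one_lt_div (by positivity)]
      obtain ⟨k, hk⟩ := pow_unbounded_of_one_lt (C / ‖u‖) hr
      have hk2 : C / ‖u‖ < (‖S u‖ / (M * ‖u‖)) ^ (2 ^ k) :=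
        hk.trans_le (pow_le_pow_right₀ hr.le (Nat.lt_two_pow_self).le)
      have h1 := (hind k).trans (mul_le_mul_of_nonneg_left (h (2 ^ k)) (by positivity))
      rw [div_pow, div_lt_div_iff₀ h0 (by positivity), mul_pow] at hk2
      nlinarith

end tensor

/-- The (interior) tensor product `E ⊗_B F` of correspondences. -/
noncomputable def tensor (E F : Corr B) : Corr B :=
  (tensorPre E.toPreCorr F.toPreCorr).completion

/-- The direct sum of a family of correspondences. -/
noncomputable def hsum {I : Type} (E : I → Corr B) : Corr B :=
  (dsumPre fun i => (E i).toPreCorr).completion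

/-- The direct sum `E ⊕ F` of two correspondences. -/
noncomputable def hprod (E F : Corr B) : Corr B :=
  (prodPre E.toPreCorr F.toPreCorr).completion

theorem tensorPre_induction {E F : PreCorr B} {p : tensorPre E F → Prop} (zero : p 0)
    (tmul : ∀ (e : E) (f : F), p (e ⊗ₜ[ℂ] f : E ⊗[ℂ] F)) (add : ∀ x y, p x → p y → p (x + y))
    (x : tensorPre E F) : p x :=
  TensorProduct.induction_on (motive := p) x zero tmul add

section tensor
variable (E F : Corr B)

/-- The elementary tensor `e ⊗ f` in `E ⊗_B F`. -/
noncomputable def tmul : E →ₗ[ℂ] F →ₗ[ℂ] tensor E F :=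
  (TensorProduct.mk ℂ E F).compr₂ (tensorPre E.toPreCorr F.toPreCorr).toCompletion

theorem ip_tmul (e e' : E) (f f' : F) :
    (tensor E F).ip (tmul E F e f) (tmul E F e' f') = F.ip f (F.lact (E.ip e e') f') :=
  PreCorr.ip_toCompletion _ _ _

theorem tmul_ract (e : E) (f : F) (b : B) :
    tmul E F (E.ract (op b) e) f = tmul E F e (F.lact b f) := by
  refine sub_eq_zero.1 ((tensor E F).definite _ ?_)
  simp only [map_sub, LinearMap.sub_apply, ip_tmul, E.ip_ract, E.ip_ract_left, map_mul,
    Module.End.mul_apply, F.ip_lact_left]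
  simp

theorem norm_tmul_le (e : E) (f : F) : ‖tmul E F e f‖ ≤ ‖e‖ * ‖f‖ := by
  refine abs_le_of_sq_le_sq' ?_ (by positivity) |>.2
  rw [PreCorr.norm_sq, ip_tmul, mul_pow, PreCorr.norm_sq E.toPreCorr e]
  calc _ ≤ ‖f‖ * (‖E.ip e e‖ * ‖f‖) :=
        (F.norm_ip_le _ _).trans (mul_le_mul_of_nonneg_left (F.norm_lact_le _ _) (norm_nonneg _))
    _ = _ := by ring

theorem continuous_tmul_right (e : E) : Continuous (tmul E F e) :=
  AddMonoidHomClass.continuous_of_bound (tmul E F e) ‖e‖ fun f => norm_tmul_le E F e f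

theorem Corr.exists_adjoint {E : Corr B} (T : E.adj) :
    ∃ S : E.adj, ∀ x y, E.ip (T.1 x) y = E.ip x (S.1 y) := by
  obtain ⟨S, hS⟩ := T.2.2
  have hb : ∀ y, ‖S y‖ ≤ ‖T.1‖ * ‖y‖ := by
    intro y
    have h1 : ‖S y‖ ^ 2 ≤ (‖T.1‖ * ‖S y‖) * ‖y‖ := by
      rw [PreCorr.norm_sq, ← hS]
      exact (E.norm_ip_le _ _).trans
        (mul_le_mul_of_nonneg_right (T.1.le_opNorm _) (norm_nonneg _))
    rcases (norm_nonneg (S y)).eq_or_lt with h0 | h0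
    · rw [← h0]; positivity
    · nlinarith
  let S' : E →L[ℂ] E := LinearMap.mkContinuous
    { toFun := S
      map_add' := fun x y => E.ext_ip' fun z => by rw [map_add, ← hS, ← hS, ← hS, map_add]
      map_smul' := fun c x => E.ext_ip' fun z => by
        rw [map_smul, ← hS, ← hS, map_smul, RingHom.id_apply] } ‖T.1‖ hb
  refine ⟨⟨S', Corr.mem_adj_of (S := T.1) fun x y => ?_⟩, hS⟩
  rw [← E.star_ip]
  exact (congrArg star (hS y x).symm).trans (E.star_ip _ _)

noncomputable def amplAlg {E : Corr B} (T : E →L[ℂ] E) (F : Corr B) :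
    Module.End ℂ (tensorPre E.toPreCorr F.toPreCorr) :=
  LinearMap.rTensor F T.toLinearMap

theorem amplAlg_adj {E : Corr B} {T S : E →L[ℂ] E} (h : ∀ x y, E.ip (T x) y = E.ip x (S y))
    (x y : tensorPre E.toPreCorr F.toPreCorr) :
    (tensorPre E.toPreCorr F.toPreCorr).ip (amplAlg T F x) y
      = (tensorPre E.toPreCorr F.toPreCorr).ip x (amplAlg S F y) := by
  induction x using tensorPre_induction with
  | zero => simp
  | add x x' hx hx' => simp only [map_add, LinearMap.add_apply, hx, hx']
  | tmul e f =>
    induction y using tensorPre_induction with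
    | zero => simp
    | add y y' hy hy' => simp only [map_add, hy, hy']
    | tmul e' f' =>
      change F.ip f (F.lact (E.ip (T e) e') f') = F.ip f (F.lact (E.ip e (S e')) f')
      rw [h]

theorem amplAlg_mul {E : Corr B} (T S : E →L[ℂ] E) : amplAlg (T * S) F = amplAlg T F * amplAlg S F :=
  LinearMap.rTensor_mul _ _ _

theorem amplAlg_pow {E : Corr B} (T : E →L[ℂ] E) (m : ℕ) : amplAlg (T ^ m) F = amplAlg T F ^ m := by
  induction m with
  | zero => exact LinearMap.rTensor_id _ _
  | succ m ih => rw [pow_succ, pow_succ, amplAlg_mul, ih]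

theorem amplAlg_crude (u : tensorPre E.toPreCorr F.toPreCorr) :
    ∃ C, 0 ≤ C ∧ ∀ T : E →L[ℂ] E, ‖amplAlg T F u‖ ≤ C * ‖T‖ := by
  induction u using tensorPre_induction with
  | zero => exact ⟨0, le_rfl, fun T => by simp⟩
  | add x y hx hy =>
    obtain ⟨C, hC0, hC⟩ := hx
    obtain ⟨D, hD0, hD⟩ := hy
    refine ⟨C + D, by positivity, fun T => ?_⟩
    rw [map_add, add_mul]
    exact (norm_add_le _ _).trans (add_le_add (hC T) (hD T))
  | tmul e f =>
    refine ⟨‖e‖ * ‖f‖, by positivity, fun T => ?_⟩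
    rw [← PreCorr.norm_toCompletion]
    refine (norm_tmul_le E F (T e) f).trans ?_
    calc _ ≤ (‖T‖ * ‖e‖) * ‖f‖ := mul_le_mul_of_nonneg_right (T.le_opNorm e) (norm_nonneg _)
      _ = _ := by ring

theorem amplAlg_bound {E : Corr B} (T : E.adj) :
    ∃ C, ∀ x, ‖amplAlg T.1 F x‖ ≤ C * ‖x‖ := by
  obtain ⟨S, hS⟩ := Corr.exists_adjoint T
  refine ⟨√‖S.1 * T.1‖, fun u => ?_⟩
  have hS' : ∀ x y, E.ip ((S.1 * T.1) x) y = E.ip x ((S.1 * T.1) y) := by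
    intro x y
    rw [← E.star_ip, mul_apply_eq_comp, mul_apply_eq_comp, ← hS, ← hS, E.star_ip]
  have h1 : ‖amplAlg (S.1 * T.1) F u‖ ≤ ‖S.1 * T.1‖ * ‖u‖ := by
    obtain ⟨C, hC0, hC⟩ := amplAlg_crude E F u
    refine PreCorr.norm_le_of_pow _ (amplAlg_adj F hS') u (C := C) (norm_nonneg _) fun m => ?_
    rw [← amplAlg_pow]
    refine (hC _).trans (mul_le_mul_of_nonneg_left ?_ hC0)
    rcases m.eq_zero_or_pos with rfl | hm
    · rw [pow_zero, pow_zero]; exact ContinuousLinearMap.norm_id_le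
    · exact norm_pow_le' _ hm
  refine abs_le_of_sq_le_sq' ?_ (by positivity) |>.2
  rw [PreCorr.norm_sq, amplAlg_adj F hS, ← Module.End.mul_apply, ← amplAlg_mul, mul_pow,
    Real.sq_sqrt (norm_nonneg _)]
  refine (PreCorr.norm_ip_le _ _ _).trans ?_
  calc _ ≤ ‖u‖ * (‖S.1 * T.1‖ * ‖u‖) := mul_le_mul_of_nonneg_left h1 (norm_nonneg _)
    _ = _ := by ring

end tensor

noncomputable def PreCorr.extendOp (P : PreCorr B) (f : Module.End ℂ P) :
    P.completion →L[ℂ] P.completion := PreCorr.extend (P.toCompletion ∘ₗ f)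

theorem PreCorr.extendOp_apply (P : PreCorr B) {f : Module.End ℂ P}
    (hf : ∃ C, ∀ x, ‖f x‖ ≤ C * ‖x‖) (x : P) :
    P.extendOp f (P.toCompletion x) = P.toCompletion (f x) :=
  PreCorr.extend_apply (P.toCompletion ∘ₗ f) (hf.imp fun C h x => by
    rw [LinearMap.comp_apply, P.norm_toCompletion]; exact h x) x

theorem PreCorr.extendOp_adj (P : PreCorr B) {f g : Module.End ℂ P}
    (hf : ∃ C, ∀ x, ‖f x‖ ≤ C * ‖x‖) (hg : ∃ C, ∀ x, ‖g x‖ ≤ C * ‖x‖)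
    (h : ∀ x y, P.ip (f x) y = P.ip x (g y)) (x y : P.completion) :
    P.completion.ip (P.extendOp f x) y = P.completion.ip x (P.extendOp g y) := by
  refine P.dense_toCompletion.induction_on₂ (p := fun x y =>
    P.completion.ip (P.extendOp f x) y = P.completion.ip x (P.extendOp g y))
    (isClosed_eq ?_ ?_) (fun x y => ?_) x y
  · exact P.completion.continuous_ip.comp
      (((P.extendOp f).continuous.comp continuous_fst).prodMk continuous_snd)
  · exact P.completion.continuous_ip.comp
      (continuous_fst.prodMk ((P.extendOp g).continuous.comp continuous_snd))
  · rw [P.extendOp_apply hf, P.extendOp_apply hg, ip_toCompletion, ip_toCompletion, h]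

/-- The operator `T ⊗ id` on `E ⊗_B F`. -/
noncomputable def ampl {E : Corr B} (T : E.adj) (F : Corr B) : (tensor E F).adj :=
  ⟨PreCorr.extendOp _ (amplAlg T.1 F), by
    obtain ⟨S, hS⟩ := Corr.exists_adjoint T
    exact Corr.mem_adj_of (PreCorr.extendOp_adj _ (amplAlg_bound F T) (amplAlg_bound F S)
      (amplAlg_adj F hS))⟩

theorem ampl_tmul {E : Corr B} (T : E.adj) (F : Corr B) (e : E) (f : F) :
    (ampl T F).1 (tmul E F e f) = tmul E F (T.1 e) f :=
  PreCorr.extendOp_apply _ (amplAlg_bound F T) (e ⊗ₜ[ℂ] f)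

noncomputable def oplusZeroAlg {E : Corr B} (T : E →L[ℂ] E) (F : Corr B) :
    Module.End ℂ (prodPre E.toPreCorr F.toPreCorr) :=
  (T.toLinearMap.prodMap 0 : (E × F) →ₗ[ℂ] (E × F))

theorem oplusZeroAlg_bound {E : Corr B} (T : E →L[ℂ] E) (F : Corr B) :
    ∃ C, ∀ x, ‖oplusZeroAlg T F x‖ ≤ C * ‖x‖ := by
  refine ⟨‖T‖, fun x => ?_⟩
  have h1 : ‖oplusZeroAlg T F x‖ = ‖T x.1‖ := by
    refine PreCorr.norm_eq_of_ip (P := prodPre E.toPreCorr F.toPreCorr) (Q := E.toPreCorr) ?_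
    change E.ip (T x.1) (T x.1) + F.ip 0 0 = _
    simp
  have h2 : ‖x.1‖ ≤ ‖x‖ := by
    rw [PreCorr.norm_def, PreCorr.norm_def]
    refine Real.sqrt_le_sqrt (CStarAlgebra.norm_le_norm_of_nonneg_of_le (E.ip_nonneg _) ?_)
    exact le_add_of_nonneg_right (F.ip_nonneg x.2)
  refine h1.trans_le ((T.le_opNorm _).trans ?_)
  exact mul_le_mul_of_nonneg_left h2 (norm_nonneg _)

noncomputable def oplusZero {E : Corr B} (T : E.adj) (F : Corr B) : (hprod E F).adj :=
  ⟨PreCorr.extendOp _ (oplusZeroAlg T.1 F), by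
    obtain ⟨S, hS⟩ := Corr.exists_adjoint T
    refine Corr.mem_adj_of (PreCorr.extendOp_adj _ (oplusZeroAlg_bound T.1 F)
      (oplusZeroAlg_bound S.1 F) ?_)
    intro x y
    change E.ip (T.1 x.1) y.1 + F.ip 0 y.2 = E.ip x.1 (S.1 y.1) + F.ip x.2 0
    rw [hS]; simp⟩

noncomputable def tensorMapAlg {E F E' F' : Corr B} (f : E →ₗ[ℂ] E') (g : F →ₗ[ℂ] F') :
    tensorPre E.toPreCorr F.toPreCorr →ₗ[ℂ] tensorPre E'.toPreCorr F'.toPreCorr :=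
  (TensorProduct.map f g : E ⊗[ℂ] F →ₗ[ℂ] E' ⊗[ℂ] F')

theorem tensorMapAlg_ip {E F E' F' : Corr B} {f : E →ₗ[ℂ] E'} {g : F →ₗ[ℂ] F'}
    (hf : ∀ x y, E'.ip (f x) (f y) = E.ip x y) (hg : ∀ x y, F'.ip (g x) (g y) = F.ip x y)
    (hg' : ∀ b x, g (F.lact b x) = F'.lact b (g x))
    (x y : tensorPre E.toPreCorr F.toPreCorr) :
    (tensorPre E'.toPreCorr F'.toPreCorr).ip (tensorMapAlg f g x) (tensorMapAlg f g y)
      = (tensorPre E.toPreCorr F.toPreCorr).ip x y := by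
  induction x using tensorPre_induction with
  | zero => simp only [map_zero, LinearMap.zero_apply]
  | add x x' hx hx' => simp only [map_add, LinearMap.add_apply, hx, hx']
  | tmul e f' =>
    induction y using tensorPre_induction with
    | zero => simp only [map_zero]
    | add y y' hy hy' => simp only [map_add, hy, hy']
    | tmul e₂ f₂ =>
      change F'.ip (g f') (F'.lact (E'.ip (f e) (f e₂)) (g f₂)) = F.ip f' (F.lact (E.ip e e₂) f₂)
      rw [hf, ← hg', hg]

/-- The map `f ⊗ g` on tensor products, for isometric `f` and `g` (`g` commuting with the left
action). -/
noncomputable def tensorMap {E F E' F' : Corr B} (f : E →ₗ[ℂ] E') (g : F →ₗ[ℂ] F') :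
    tensor E F →L[ℂ] tensor E' F' :=
  PreCorr.extend (P := tensorPre E.toPreCorr F.toPreCorr) (Q := tensor E' F')
    ((tensorPre E'.toPreCorr F'.toPreCorr).toCompletion ∘ₗ tensorMapAlg f g)

theorem tensorMap_ip {E F E' F' : Corr B} {f : E →ₗ[ℂ] E'} {g : F →ₗ[ℂ] F'}
    (hf : ∀ x y, E'.ip (f x) (f y) = E.ip x y) (hg : ∀ x y, F'.ip (g x) (g y) = F.ip x y)
    (hg' : ∀ b x, g (F.lact b x) = F'.lact b (g x)) (x y : tensor E F) :
    (tensor E' F').ip (tensorMap f g x) (tensorMap f g y) = (tensor E F).ip x y :=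
  PreCorr.extend_ip (fun x y => (PreCorr.ip_toCompletion (tensorPre E'.toPreCorr F'.toPreCorr)
    (tensorMapAlg f g x) (tensorMapAlg f g y)).trans (tensorMapAlg_ip hf hg hg' x y)) x y

theorem tensorMap_tmul {E F E' F' : Corr B} {f : E →ₗ[ℂ] E'} {g : F →ₗ[ℂ] F'}
    (hf : ∀ x y, E'.ip (f x) (f y) = E.ip x y) (hg : ∀ x y, F'.ip (g x) (g y) = F.ip x y)
    (hg' : ∀ b x, g (F.lact b x) = F'.lact b (g x)) (x : E) (y : F) :
    tensorMap f g (tmul E F x y) = tmul E' F' (f x) (g y) :=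
  PreCorr.extend_apply (P := tensorPre E.toPreCorr F.toPreCorr) (Q := tensor E' F') _
    (PreCorr.bound_of_ip fun x y => (PreCorr.ip_toCompletion (tensorPre E'.toPreCorr F'.toPreCorr)
    (tensorMapAlg f g x) (tensorMapAlg f g y)).trans (tensorMapAlg_ip hf hg hg' x y)) (x ⊗ₜ[ℂ] y : E ⊗[ℂ] F)

/-- The inclusion of a summand in a direct sum. -/
noncomputable def hsumIncl {I : Type} (E : I → Corr B) (i : I) : E i →ₗ[ℂ] hsum E :=
  (dsumPre fun i => (E i).toPreCorr).toCompletion ∘ₗ dsumSingle (fun i => (E i).toPreCorr) i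

theorem hsumIncl_ip {I : Type} (E : I → Corr B) (i : I) (x y : E i) :
    (hsum E).ip (hsumIncl E i x) (hsumIncl E i y) = (E i).ip x y := by
  classical
  refine (PreCorr.ip_toCompletion _ _ _).trans ((dsumIp_single _ _ _ _).trans ?_)
  change (E i).ip ((DFinsupp.single i x : Π₀ i, E i) i) y = _
  rw [DFinsupp.single_eq_same]

theorem hsumIncl_ip_ne {I : Type} (E : I → Corr B) {i j : I} (h : i ≠ j) (x : E i) (y : E j) :
    (hsum E).ip (hsumIncl E i x) (hsumIncl E j y) = 0 := by
  classical
  refine (PreCorr.ip_toCompletion _ _ _).trans ((dsumIp_single _ _ _ _).trans ?_)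
  change (E j).ip ((DFinsupp.single i x : Π₀ i, E i) j) y = _
  rw [DFinsupp.single_eq_of_ne h.symm, map_zero, LinearMap.zero_apply]

theorem hsumIncl_lact {I : Type} (E : I → Corr B) (i : I) (b : B) (x : E i) :
    hsumIncl E i ((E i).lact b x) = (hsum E).lact b (hsumIncl E i x) := by
  classical
  refine Eq.trans (congrArg (dsumPre fun i => (E i).toPreCorr).toCompletion ?_)
    (PreCorr.lact_toCompletion _ _ _).symm
  refine DFinsupp.ext fun j => ?_
  change (DFinsupp.single i ((E i).lact b x) : Π₀ i, E i) j =
    dsumMap (fun i => (E i).toPreCorr) (fun i => (E i).lact) b (DFinsupp.single i x : Π₀ i, E i) j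
  rw [dsumMap_apply]
  by_cases h : j = i
  · subst h; simp
  · rw [DFinsupp.single_eq_of_ne h, DFinsupp.single_eq_of_ne h, map_zero]

/-- The inclusion of the first summand in `E ⊕ F`. -/
noncomputable def hprodInl (E F : Corr B) : E →ₗ[ℂ] hprod E F :=
  (prodPre E.toPreCorr F.toPreCorr).toCompletion ∘ₗ (LinearMap.inl ℂ E F)

/-- The inclusion of the second summand in `E ⊕ F`. -/
noncomputable def hprodInr (E F : Corr B) : F →ₗ[ℂ] hprod E F :=
  (prodPre E.toPreCorr F.toPreCorr).toCompletion ∘ₗ (LinearMap.inr ℂ E F)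

theorem hprodInl_ip (E F : Corr B) (x y : E) :
    (hprod E F).ip (hprodInl E F x) (hprodInl E F y) = E.ip x y := by
  refine (PreCorr.ip_toCompletion _ _ _).trans ?_
  change E.ip x y + F.ip 0 0 = _
  simp

theorem hprodInr_ip (E F : Corr B) (x y : F) :
    (hprod E F).ip (hprodInr E F x) (hprodInr E F y) = F.ip x y := by
  refine (PreCorr.ip_toCompletion _ _ _).trans ?_
  change E.ip 0 0 + F.ip x y = _
  simp

theorem hprodInl_inr (E F : Corr B) (x : E) (y : F) :
    (hprod E F).ip (hprodInl E F x) (hprodInr E F y) = 0 := by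
  refine (PreCorr.ip_toCompletion _ _ _).trans ?_
  change E.ip x 0 + F.ip 0 y = _
  simp

theorem continuous_of_ip {E F : Corr B} {f : E →ₗ[ℂ] F}
    (hf : ∀ x y, F.ip (f x) (f y) = E.ip x y) : Continuous f :=
  AddMonoidHomClass.continuous_of_bound f 1 fun x => by
    rw [one_mul]; exact (PreCorr.norm_eq_of_ip (hf x x)).le

variable {N : ℕ}

/-- Alternating strings on the alphabet `Fin N`: consecutive letters are different. -/
abbrev AltString (N : ℕ) : Type := {s : List (Fin N) // s.IsChain (· ≠ ·)}

/-- The empty string. -/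
def AltString.root (N : ℕ) : AltString N := ⟨[], List.isChain_nil⟩

/-- The `N`-regular tree of alternating strings: `s` is adjacent to `j s` for every letter `j` and
every `s` not beginning with `j`. -/
def freeTree (N : ℕ) : SimpleGraph (AltString N) where
  Adj s t := ∃ j : Fin N, t.1 = j :: s.1 ∨ s.1 = j :: t.1
  symm := ⟨fun s t ⟨j, h⟩ => ⟨j, h.symm⟩⟩
  loopless := ⟨fun s ⟨j, h⟩ => by simp at h⟩

/-- A rooted subtree: a connected subgraph of the tree of alternating strings that contains the empty
string. -/
structure RootedSubtree (N : ℕ) where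
  graph : (freeTree N).Subgraph
  connected : graph.Connected
  root_mem : AltString.root N ∈ graph.verts

namespace RootedSubtree
variable (T : RootedSubtree N)

/-- The vertices of the subtree, as strings. -/
def strings : Set (List (Fin N)) := Subtype.val '' T.graph.verts

theorem nil_mem : [] ∈ T.strings := ⟨_, T.root_mem, rfl⟩

theorem alternating {s : List (Fin N)} (h : s ∈ T.strings) : s.IsChain (· ≠ ·) := by
  obtain ⟨s, _, rfl⟩ := h
  exact s.2

theorem tail_mem {j : Fin N} {s : List (Fin N)} (h : j :: s ∈ T.strings) : s ∈ T.strings := by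
  by_contra hs
  obtain ⟨v, hv, hvs⟩ := h
  have key : ∀ a b : T.graph.verts, T.graph.coe.Reachable a b →
      (j :: s) <:+ a.1.1 → (j :: s) <:+ b.1.1 := by
    intro a b ⟨p⟩
    induction p with
    | nil => exact id
    | @cons a c b hac p ih =>
      intro ha
      refine ih ?_
      have h2 : (freeTree N).Adj a.1 c.1 := T.graph.adj_sub hac
      obtain ⟨i, h3 | h3⟩ := h2
      · rw [h3]; exact ha.trans (List.suffix_cons _ _)
      · rw [h3] at ha
        rcases List.suffix_cons_iff.1 ha with h4 | h4
        · obtain ⟨-, rfl⟩ := List.cons.inj h4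
          exact absurd ⟨c.1, c.2, rfl⟩ hs
        · exact h4
  have := key ⟨v, hv⟩ ⟨_, T.root_mem⟩ (T.connected.coe.preconnected _ _) (by rw [hvs])
  simp [AltString.root] at this

/-- `S_j`, the strings `s ∈ T` not beginning with `j` for which `j s ∈ T`. -/
def left (j : Fin N) : Set (List (Fin N)) :=
  {s | s ∈ T.strings ∧ s.head? ≠ some j ∧ j :: s ∈ T.strings}

/-- `S'_j`, the strings `s ∈ T` not beginning with `j` for which `j s ∉ T`. -/
def right (j : Fin N) : Set (List (Fin N)) :=
  {s | s ∈ T.strings ∧ s.head? ≠ some j ∧ j :: s ∉ T.strings}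

/-- Every vertex of `T` is, in exactly one way, an `s ∈ S_j`, a `j s` with `s ∈ S_j`, or an `s ∈ S'_j`. -/
def splitFun (j : Fin N) : T.left j ⊕ T.left j ⊕ T.right j → T.strings
  | .inl s => ⟨s, s.2.1⟩
  | .inr (.inl s) => ⟨j :: s, s.2.2.2⟩
  | .inr (.inr s) => ⟨s, s.2.1⟩

theorem splitFun_injective (j : Fin N) : Function.Injective (T.splitFun j) := by
  rintro (⟨s, hs⟩ | ⟨s, hs⟩ | ⟨s, hs⟩) (⟨t, ht⟩ | ⟨t, ht⟩ | ⟨t, ht⟩) h <;>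
    simp only [splitFun, Subtype.mk.injEq] at h
  · subst h; rfl
  · subst h; exact absurd rfl hs.2.1
  · subst h; exact absurd hs.2.2 ht.2.2
  · subst h; exact absurd rfl ht.2.1
  · obtain ⟨-, rfl⟩ := List.cons.inj h; rfl
  · subst h; exact absurd rfl ht.2.1
  · subst h; exact absurd ht.2.2 hs.2.2
  · subst h; exact absurd rfl hs.2.1
  · subst h; rfl

theorem splitFun_surjective (j : Fin N) : Function.Surjective (T.splitFun j) := by
  rintro ⟨s, hs⟩
  by_cases h : s.head? = some j
  · obtain ⟨t, rfl⟩ := List.head?_eq_some_iff.1 h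
    refine ⟨.inr (.inl ⟨t, T.tail_mem hs, fun h => ?_, hs⟩), rfl⟩
    obtain ⟨r, rfl⟩ := List.head?_eq_some_iff.1 h
    have := T.alternating hs
    simp at this
  · by_cases h' : j :: s ∈ T.strings
    · exact ⟨.inl ⟨s, hs, h, h'⟩, rfl⟩
    · exact ⟨.inr (.inr ⟨s, hs, h, h'⟩), rfl⟩

end RootedSubtree

/-- The correspondence `H_s°`: `B` for the empty string, and `H_{j₁}° ⊗_B … ⊗_B H_{jₗ}°` for a string
`s = j₁ … jₗ`, formed from right to left and ending in the factor `B` (recall `E ⊗_B B = E`). -/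
noncomputable def stringSpace (H : Fin N → PointedCorr B) : List (Fin N) → Corr B
  | [] => selfCorr B
  | j :: s => tensor (H j).compl (stringSpace H s)

theorem hsumIncl_ract {I : Type} (E : I → Corr B) (i : I) (b : B) (x : E i) :
    hsumIncl E i ((E i).ract (op b) x) = (hsum E).ract (op b) (hsumIncl E i x) := by
  refine (hsum E).ext_ip' fun z => ?_
  rw [(hsum E).ip_ract]
  have h1 : Continuous fun z => (hsum E).ip z (hsumIncl E i ((E i).ract (op b) x)) :=
    (hsum E).continuous_ip.comp (continuous_id.prodMk continuous_const)
  have h2 : Continuous fun z => (hsum E).ip z (hsumIncl E i x) * b :=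
    ((hsum E).continuous_ip.comp (continuous_id.prodMk continuous_const)).mul continuous_const
  refine (dsumPre fun i => (E i).toPreCorr).dense_toCompletion.induction_on
    (p := fun z => (hsum E).ip z (hsumIncl E i ((E i).ract (op b) x))
      = (hsum E).ip z (hsumIncl E i x) * b) z (isClosed_eq h1 h2) fun z => ?_
  refine (PreCorr.ip_toCompletion _ _ _).trans ((dsumIp_single _ _ _ _).trans ?_)
  rw [(E i).ip_ract]
  exact congrArg (· * b)
    ((PreCorr.ip_toCompletion _ _ _).trans (dsumIp_single _ _ _ _)).symm

/-- The `T`-free product `(H, ξ)` of `(H_1, ξ_1), …, (H_N, ξ_N)`: `H` is the direct sum of `H_s°` over the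
vertices `s` of `T`, and `ξ` is the unit of `B = H_∅°`. -/
noncomputable def product (T : RootedSubtree N) (H : Fin N → PointedCorr B) : PointedCorr B where
  toCorr := hsum fun s : T.strings => stringSpace H s
  vec := hsumIncl (fun s : T.strings => stringSpace H s) ⟨[], T.nil_mem⟩ (1 : B)
  ip_vec := by
    refine (hsumIncl_ip _ _ _ _).trans ?_
    change star (1 : B) * 1 = 1
    simp
  central b := by
    refine (hsumIncl_lact _ _ _ _).symm.trans (Eq.trans ?_ (hsumIncl_ract _ _ _ _))
    refine congrArg (hsumIncl (fun s : T.strings => stringSpace H s) ⟨[], T.nil_mem⟩) ?_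
    change b * 1 = 1 * b
    rw [mul_one, one_mul]

section
variable (T : RootedSubtree N) (H : Fin N → PointedCorr B) (j : Fin N)

/-- The direct sum of `H_s°` over `s ∈ S_j`. -/
noncomputable abbrev leftSpace : Corr B := hsum fun s : T.left j => stringSpace H s
/-- The direct sum of `H_s°` over `s ∈ S'_j`. -/
noncomputable abbrev rightSpace : Corr B := hsum fun s : T.right j => stringSpace H s
/-- `[H_j ⊗_B (⊕_{s ∈ S_j} H_s°)] ⊕ (⊕_{s ∈ S'_j} H_s°)`. -/
noncomputable abbrev splitSpace : Corr B :=
  hprod (tensor (H j).toCorr (leftSpace T H j)) (rightSpace T H j)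

/-- The unitary `U_j` on the summands of the product: for `s ∈ S_j`, `v ∈ H_s°` goes to `ξ_j ⊗ v`, and
`H_{js}° = H_j° ⊗_B H_s°` is included in `H_j ⊗_B H_s°`; for `s ∈ S'_j`, `H_s°` goes to the second part. -/
noncomputable def splitComponent :
    (x : T.left j ⊕ T.left j ⊕ T.right j) → stringSpace H (T.splitFun j x) →ₗ[ℂ] splitSpace T H j
  | .inl s => hprodInl _ _ ∘ₗ tmul (H j).toCorr (leftSpace T H j) (H j).vec ∘ₗ
      hsumIncl (fun s : T.left j => stringSpace H s) s
  | .inr (.inl s) => hprodInl _ _ ∘ₗ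
      (tensorMap (F := stringSpace H s) (H j).complIncl
        (hsumIncl (fun s : T.left j => stringSpace H s) s)).toLinearMap
  | .inr (.inr s) => hprodInr _ _ ∘ₗ hsumIncl (fun s : T.right j => stringSpace H s) s

/-- `U_j` on the algebraic direct sum. -/
noncomputable def splitAlg :
    dsumPre (fun s : T.strings => (stringSpace H s).toPreCorr) →ₗ[ℂ] splitSpace T H j :=
  (DFinsupp.lsum ℂ (M := fun x => stringSpace H (T.splitFun j x)) (splitComponent T H j)) ∘ₗ
    { toFun := DFinsupp.comapDomain (T.splitFun j) (T.splitFun_injective j)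
      map_add' := DFinsupp.comapDomain_add _ _
      map_smul' := DFinsupp.comapDomain_smul _ _ }

/-- `U_j` as a continuous linear map. -/
noncomputable def split : (product T H).toCorr →L[ℂ] splitSpace T H j := PreCorr.extend (splitAlg T H j)

end

theorem isClosedMap_of_ip {E F : Corr B} {f : E →L[ℂ] F}
    (hf : ∀ x y, F.ip (f x) (f y) = E.ip x y) : Isometry f :=
  AddMonoidHomClass.isometry_of_norm f fun x => PreCorr.norm_eq_of_ip (hf x x)

theorem tensor_closed_induction {E F : Corr B} {p : tensor E F → Prop}
    (hc : IsClosed {z | p z}) (h0 : p 0) (ht : ∀ e f, p (tmul E F e f))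
    (ha : ∀ x y, p x → p y → p (x + y)) (z : tensor E F) : p z := by
  refine (tensorPre E.toPreCorr F.toPreCorr).dense_toCompletion.induction_on (p := p) z hc
    fun w => ?_
  induction w using tensorPre_induction with
  | zero => rw [map_zero]; exact h0
  | add x y hx hy => rw [map_add]; exact ha _ _ hx hy
  | tmul x y => exact ht x y

theorem tensorMap_ip_zero {E F E' F' : Corr B} {f : E →ₗ[ℂ] E'} {g : F →ₗ[ℂ] F'}
    (hf : ∀ x y, E'.ip (f x) (f y) = E.ip x y) (hg : ∀ x y, F'.ip (g x) (g y) = F.ip x y)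
    (hg' : ∀ b x, g (F.lact b x) = F'.lact b (g x)) {z : tensor E' F'}
    (hz : ∀ x y, (tensor E' F').ip z (tmul E' F' (f x) (g y)) = 0) (w : tensor E F) :
    (tensor E' F').ip z (tensorMap f g w) = 0 := by
  have h1 : Continuous fun w => (tensor E' F').ip z (tensorMap f g w) :=
    (tensor E' F').continuous_ip.comp (continuous_const.prodMk (tensorMap f g).continuous)
  refine tensor_closed_induction (p := fun w => (tensor E' F').ip z (tensorMap f g w) = 0)
    (isClosed_eq h1 continuous_const) ?_ (fun x y => ?_) (fun x y hx hy => ?_) w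
  · simp only [map_zero]
  · rw [tensorMap_tmul hf hg hg', hz]
  · simp only [map_add, hx, hy, add_zero]

theorem dsumSingle_eq {I : Type} [inst : DecidableEq I] (E : I → PreCorr B) (i : I) (x : E i) :
    dsumSingle E i x = (DFinsupp.single i x : Π₀ i, E i) := by
  obtain rfl : inst = fun a b => Classical.propDecidable (a = b) := Subsingleton.elim _ _
  rfl

theorem dsumPre_induction {I : Type} {E : I → PreCorr B} {p : dsumPre E → Prop} (h0 : p 0)
    (hs : ∀ i x, p (dsumSingle E i x)) (ha : ∀ x y, p x → p y → p (x + y)) (x : dsumPre E) :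
    p x := by
  classical
  refine DFinsupp.induction (p := p) x h0 fun i b f _ _ hf => ha _ _ ?_ hf
  rw [← dsumSingle_eq]
  exact hs i b

theorem hsum_closed_induction {I : Type} {E : I → Corr B} {p : hsum E → Prop}
    (hc : IsClosed {z | p z}) (h0 : p 0) (hs : ∀ i x, p (hsumIncl E i x))
    (ha : ∀ x y, p x → p y → p (x + y)) (z : hsum E) : p z := by
  refine (dsumPre fun i => (E i).toPreCorr).dense_toCompletion.induction_on (p := p) z hc
    fun w => ?_
  induction w using dsumPre_induction with
  | h0 => rw [map_zero]; exact h0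
  | ha x y hx hy => rw [map_add]; exact ha _ _ hx hy
  | hs i x => exact hs i x

theorem hprod_closed_induction {E F : Corr B} {p : hprod E F → Prop}
    (hc : IsClosed {z | p z}) (hl : ∀ x, p (hprodInl E F x)) (hr : ∀ x, p (hprodInr E F x))
    (ha : ∀ x y, p x → p y → p (x + y)) (z : hprod E F) : p z := by
  refine (prodPre E.toPreCorr F.toPreCorr).dense_toCompletion.induction_on (p := p) z hc
    fun w => ?_
  have h := ha _ _ (hl w.1) (hr w.2)
  have h2 : (prodPre E.toPreCorr F.toPreCorr).toCompletion w
      = hprodInl E F w.1 + hprodInr E F w.2 := by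
    refine Eq.trans (congrArg _ ?_)
      ((prodPre E.toPreCorr F.toPreCorr).toCompletion.map_add
        (LinearMap.inl ℂ E F w.1) (LinearMap.inr ℂ E F w.2))
    change w = (w.1 + 0, 0 + w.2)
    rw [add_zero, zero_add]
    rfl
  rwa [h2]

section
variable {N : ℕ} (T : RootedSubtree N) (H : Fin N → PointedCorr B) (j : Fin N)

theorem splitComponent_ip (x : T.left j ⊕ T.left j ⊕ T.right j)
    (v w : stringSpace H (T.splitFun j x)) :
    (splitSpace T H j).ip (splitComponent T H j x v) (splitComponent T H j x w)
      = (stringSpace H (T.splitFun j x)).ip v w := by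
  rcases x with s | s | s
  · refine (hprodInl_ip _ _ _ _).trans ((ip_tmul _ _ _ _ _ _).trans ?_)
    rw [(H j).ip_vec, map_one, Module.End.one_apply]
    exact hsumIncl_ip _ _ _ _
  · refine (hprodInl_ip _ _ _ _).trans ?_
    exact tensorMap_ip (H j).ip_complIncl (hsumIncl_ip _ _) (hsumIncl_lact _ _) _ _
  · exact (hprodInr_ip _ _ _ _).trans (hsumIncl_ip _ _ _ _)

theorem splitComponent_ip_ne {x y : T.left j ⊕ T.left j ⊕ T.right j} (h : x ≠ y)
    (v : stringSpace H (T.splitFun j x)) (w : stringSpace H (T.splitFun j y)) :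
    (splitSpace T H j).ip (splitComponent T H j x v) (splitComponent T H j y w) = 0 := by
  have hA : ∀ (s t : T.left j) (v : stringSpace H s) (w : stringSpace H (j :: t.1)),
      (splitSpace T H j).ip (splitComponent T H j (.inl s) v)
        (splitComponent T H j (.inr (.inl t)) w) = 0 := by
    intro s t v w
    refine (hprodInl_ip _ _ _ _).trans ?_
    refine tensorMap_ip_zero (H j).ip_complIncl (hsumIncl_ip (fun s : T.left j => stringSpace H s) t)
      (hsumIncl_lact (fun s : T.left j => stringSpace H s) t) (fun k y => ?_) w
    refine (ip_tmul _ _ _ _ _ _).trans ?_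
    have : (H j).ip (H j).vec ((H j).complIncl k) = 0 :=
      (H j).mem_complSubmodule'.1 (Subtype.prop (p := (· ∈ (H j).complSubmodule)) k)
    rw [this, map_zero, LinearMap.zero_apply, map_zero]
  have hB : ∀ (x : T.left j ⊕ T.left j) (t : T.right j) v w,
      (splitSpace T H j).ip (splitComponent T H j (x.elim .inl (.inr ∘ .inl)) v)
        (splitComponent T H j (.inr (.inr t)) w) = 0 := by
    rintro (s | s) t v w <;> exact hprodInl_inr _ _ _ _
  rcases x with s | s | s <;> rcases y with t | t | t
  · refine (hprodInl_ip _ _ _ _).trans ((ip_tmul _ _ _ _ _ _).trans ?_)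
    rw [(H j).ip_vec, map_one, Module.End.one_apply]
    exact hsumIncl_ip_ne _ (fun h' => h (by rw [h'])) _ _
  · exact hA s t v w
  · exact hB (.inl s) t v w
  · rw [← PreCorr.star_ip, star_eq_zero]; exact hA t s w v
  · refine (hprodInl_ip _ _ _ _).trans ?_
    refine tensorMap_ip_zero (H j).ip_complIncl (hsumIncl_ip (fun s : T.left j => stringSpace H s) t)
      (hsumIncl_lact (fun s : T.left j => stringSpace H s) t) (fun k y => ?_) w
    rw [← PreCorr.star_ip, star_eq_zero]
    refine tensorMap_ip_zero (H j).ip_complIncl (hsumIncl_ip (fun s : T.left j => stringSpace H s) s)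
      (hsumIncl_lact (fun s : T.left j => stringSpace H s) s) (fun k' y' => ?_) v
    refine (ip_tmul _ _ _ _ _ _).trans ?_
    rw [← hsumIncl_lact]
    exact hsumIncl_ip_ne _ (fun h' => h (by rw [h'])) _ _
  · exact hB (.inr s) t v w
  · rw [← PreCorr.star_ip, star_eq_zero]; exact hB (.inl t) s w v
  · rw [← PreCorr.star_ip, star_eq_zero]; exact hB (.inr t) s w v
  · exact (hprodInr_ip _ _ _ _).trans (hsumIncl_ip_ne _ (fun h' => h (by rw [h'])) _ _)

theorem splitAlg_single (x : T.left j ⊕ T.left j ⊕ T.right j)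
    (v : stringSpace H (T.splitFun j x)) :
    splitAlg T H j (dsumSingle (fun s : T.strings => (stringSpace H s).toPreCorr)
      (T.splitFun j x) v) = splitComponent T H j x v := by
  classical
  have h : DFinsupp.comapDomain (T.splitFun j) (T.splitFun_injective j)
      (DFinsupp.single (β := fun s : T.strings => stringSpace H s) (T.splitFun j x) v)
      = DFinsupp.single x v := DFinsupp.comapDomain_single _ _ _ _
  have h2 : DFinsupp.lsum ℂ (M := fun x => stringSpace H (T.splitFun j x)) (splitComponent T H j)
      (DFinsupp.single x v) = splitComponent T H j x v := DFinsupp.lsum_single _ _ _ _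
  rw [dsumSingle_eq]
  exact (congrArg _ h).trans h2

theorem splitAlg_ip (x y : dsumPre (fun s : T.strings => (stringSpace H s).toPreCorr)) :
    (splitSpace T H j).ip (splitAlg T H j x) (splitAlg T H j y)
      = (dsumPre (fun s : T.strings => (stringSpace H s).toPreCorr)).ip x y := by
  classical
  induction x using dsumPre_induction with
  | h0 => simp only [map_zero, LinearMap.zero_apply]
  | ha x x' hx hx' => simp only [map_add, LinearMap.add_apply, hx, hx']
  | hs i v =>
    induction y using dsumPre_induction with
    | h0 => simp only [map_zero]
    | ha y y' hy hy' => simp only [map_add, hy, hy']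
    | hs k w =>
      obtain ⟨x, rfl⟩ := T.splitFun_surjective j i
      obtain ⟨y, rfl⟩ := T.splitFun_surjective j k
      rw [splitAlg_single, splitAlg_single,
        ← PreCorr.ip_toCompletion (dsumPre (fun s : T.strings => (stringSpace H s).toPreCorr))]
      by_cases h : x = y
      · subst h
        rw [splitComponent_ip]
        exact (hsumIncl_ip (fun s : T.strings => stringSpace H s) _ _ _).symm
      · rw [splitComponent_ip_ne T H j h]
        exact (hsumIncl_ip_ne (fun s : T.strings => stringSpace H s)
          ((T.splitFun_injective j).ne h) _ _).symm

theorem split_ip (x y : (product T H).toCorr) :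
    (splitSpace T H j).ip (split T H j x) (split T H j y) = (product T H).ip x y :=
  PreCorr.extend_ip (splitAlg_ip T H j) x y

theorem split_hsumIncl (x : T.left j ⊕ T.left j ⊕ T.right j)
    (v : stringSpace H (T.splitFun j x)) :
    split T H j (hsumIncl (fun s : T.strings => stringSpace H s) (T.splitFun j x) v)
      = splitComponent T H j x v :=
  (PreCorr.extend_apply (splitAlg T H j) (PreCorr.bound_of_ip (splitAlg_ip T H j)) _).trans
    (splitAlg_single T H j x v)

theorem split_surjective : Function.Surjective (split T H j) := by
  let R := (split T H j).toLinearMap.range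
  have hRc : IsClosed {z | z ∈ R} := (isClosedMap_of_ip (split_ip T H j)).isClosedEmbedding.isClosed_range
  have hc : ∀ x v, splitComponent T H j x v ∈ R := fun x v => ⟨_, split_hsumIncl T H j x v⟩
  have h1 : ∀ (h : H j) (s : T.left j) (w : stringSpace H s),
      hprodInl _ (rightSpace T H j) (tmul (H j).toCorr (leftSpace T H j) h
        (hsumIncl (fun s : T.left j => stringSpace H s) s w)) ∈ R := by
    intro h s w
    rw [(H j).decomp h, map_add, LinearMap.add_apply, map_add, tmul_ract, ← hsumIncl_lact]
    refine R.add_mem (hc (.inl s) _) ?_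
    have := hc (.inr (.inl s)) (tmul _ (stringSpace H s) ((H j).complProj h) w)
    have h2 := tensorMap_tmul (H j).ip_complIncl
      (hsumIncl_ip (fun s : T.left j => stringSpace H s) s)
      (hsumIncl_lact (fun s : T.left j => stringSpace H s) s) ((H j).complProj h) w
    rw [← h2]
    exact this
  have hcl : Continuous (hprodInl (tensor (H j).toCorr (leftSpace T H j)) (rightSpace T H j)) :=
    continuous_of_ip (hprodInl_ip _ _)
  have hcr : Continuous (hprodInr (tensor (H j).toCorr (leftSpace T H j)) (rightSpace T H j)) :=
    continuous_of_ip (hprodInr_ip _ _)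
  have h2 : ∀ (h : H j) (y : leftSpace T H j),
      hprodInl _ (rightSpace T H j) (tmul (H j).toCorr (leftSpace T H j) h y) ∈ R := by
    intro h y
    refine hsum_closed_induction (p := fun y => hprodInl _ (rightSpace T H j)
      (tmul (H j).toCorr (leftSpace T H j) h y) ∈ R)
      (hRc.preimage (hcl.comp (continuous_tmul_right _ _ h))) ?_ (h1 h) ?_ y
    · simp only [map_zero]; exact R.zero_mem
    · intro x y hx hy; simp only [map_add]; exact R.add_mem hx hy
  intro z
  change z ∈ R
  refine hprod_closed_induction (p := fun z => z ∈ R) hRc (fun x => ?_) (fun x => ?_)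
    (fun x y => R.add_mem) z
  · refine tensor_closed_induction (p := fun x => hprodInl _ (rightSpace T H j) x ∈ R)
      (hRc.preimage hcl) ?_ h2 ?_ x
    · simp only [map_zero]; exact R.zero_mem
    · intro x y hx hy; simp only [map_add]; exact R.add_mem hx hy
  · refine hsum_closed_induction (p := fun x => hprodInr (tensor (H j).toCorr (leftSpace T H j))
      (rightSpace T H j) x ∈ R) (hRc.preimage hcr) ?_ (fun s v => hc (.inr (.inr s)) v) ?_ x
    · simp only [map_zero]; exact R.zero_mem
    · intro x y hx hy; simp only [map_add]; exact R.add_mem hx hy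

/-- The unitary `U_j` from the product onto `[H_j ⊗_B (⊕_{s ∈ S_j} H_s°)] ⊕ (⊕_{s ∈ S'_j} H_s°)`. -/
noncomputable def splitEquiv : (product T H).toCorr ≃ₗᵢ[ℂ] splitSpace T H j :=
  LinearIsometryEquiv.ofSurjective
    { (split T H j).toLinearMap with
      norm_map' := fun x => PreCorr.norm_eq_of_ip (split_ip T H j x x) }
    (split_surjective T H j)

theorem ip_symm (x : (product T H).toCorr) (z : splitSpace T H j) :
    (product T H).ip x ((splitEquiv T H j).symm z) = (splitSpace T H j).ip (split T H j x) z := by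
  rw [← split_ip]
  exact congrArg _ ((splitEquiv T H j).apply_symm_apply z)

/-- `λ_j(x) = U_j* ([x ⊗ id] ⊕ 0) U_j`, for `x ∈ L(H_j)`. -/
noncomputable def lam (x : (H j).toCorr.adj) : (product T H).toCorr.adj :=
  ⟨(splitEquiv T H j).symm.toContinuousLinearEquiv.toContinuousLinearMap ∘L
      (oplusZero (ampl x (leftSpace T H j)) (rightSpace T H j)).1 ∘L split T H j, by
    obtain ⟨S, hS⟩ := Corr.exists_adjoint
      (oplusZero (ampl x (leftSpace T H j)) (rightSpace T H j))
    refine Corr.mem_adj_of (S := fun y => (splitEquiv T H j).symm (S.1 (split T H j y)))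
      fun y z => ?_
    refine Eq.trans ?_ (ip_symm T H j y _).symm
    rw [← hS, ← PreCorr.star_ip, ← PreCorr.star_ip (splitSpace T H j).toPreCorr]
    exact congrArg star (ip_symm T H j z _)⟩

theorem lam_apply (x : (H j).toCorr.adj) (h : (product T H).toCorr) :
    split T H j ((lam T H j x).1 h)
      = (oplusZero (ampl x (leftSpace T H j)) (rightSpace T H j)).1 (split T H j h) :=
  (splitEquiv T H j).apply_symm_apply _
end

/-- `E_ξ[a] = ⟨ξ, a ξ⟩`, for `a ∈ L(H)`. -/
noncomputable def PointedCorr.expect (E : PointedCorr B) (a : E.toCorr.adj) : B :=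
  E.ip E.vec (a.1 E.vec)

theorem length_lt_of_mem_split {α : Type*} {a b : List α} {c : Composition a.length}
    (hc : 1 < c.length) (hb : b ∈ a.splitWrtComposition c) : b.length < a.length := by
  have h1 : b.length ∈ c.blocks := by
    rw [← a.map_length_splitWrtComposition c]
    exact List.mem_map_of_mem hb
  obtain ⟨i, hi⟩ := List.mem_iff_get.1 h1
  have hn : 0 < a.length := (c.length_le).trans_lt' (by omega)
  have h2 : c ≠ Composition.single a.length hn := by
    rw [Ne, Composition.eq_single_iff_length]; omega
  have h3 := (Composition.ne_single_iff hn).1 h2 i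
  rw [← hi]
  exact h3

/-- The Boolean cumulants of `L(H)` with respect to `ξ`. An interval partition of `{1, …, n}` is a
composition of `n`, and its term is the product of the cumulants of its blocks, from left to right;
the defining relation `E[a_1 ⋯ a_n] = ∑ K_π[a_1, …, a_n]` over all interval partitions is
`expect_prod_eq_sum` below. It is solved here for the term of the partition with one block. -/
noncomputable def boolCumulant (E : PointedCorr B) (a : List E.toCorr.adj) : B :=
  E.expect a.prod - ∑ c : Composition a.length,
    if 1 < c.length then
      ((a.splitWrtComposition c).attach.map fun b => boolCumulant E b.1).prod
    else 0
termination_by a.length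
decreasing_by exact length_lt_of_mem_split (by assumption) b.2

/-- The defining relation of the Boolean cumulants. -/
theorem expect_prod_eq_sum (E : PointedCorr B) (a : List E.toCorr.adj) :
    E.expect a.prod = ∑ c : Composition a.length,
      ((a.splitWrtComposition c).map (boolCumulant E)).prod := by
  rcases a.eq_nil_or_concat with rfl | h
  · have h1 : Subsingleton (Composition ([] : List E.toCorr.adj).length) :=
      Fintype.card_le_one_iff_subsingleton.1 (composition_card 0).le
    refine Eq.trans ?_ (Fintype.sum_eq_single (Composition.ones ([] : List E.toCorr.adj).length)
      fun c h => absurd (h1.elim c _) h).symm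
    exact E.ip_vec
  · have hn : 0 < a.length := by obtain ⟨l, b, rfl⟩ := h; simp
    have hs : a.splitWrtComposition (Composition.single a.length hn) = [a] := by
      simp [List.splitWrtComposition, List.splitWrtCompositionAux]
    rw [Fintype.sum_eq_add_sum_compl (Composition.single a.length hn), hs, List.map_singleton,
      List.prod_singleton]
    conv_rhs => rw [boolCumulant]
    rw [Fintype.sum_eq_add_sum_compl (Composition.single a.length hn), if_neg (by simp), zero_add,
      eq_comm, sub_add_eq_add_sub, add_sub_assoc, add_eq_left, sub_eq_zero]
    refine Finset.sum_congr rfl fun c hc => ?_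
    have h1 : c.length ≠ 1 := by
      rw [Ne, ← Composition.eq_single_iff_length hn]; simpa using hc
    have h2 : c.length ≠ 0 := fun h => by
      rw [Composition.length_eq_zero] at h; omega
    rw [if_pos (by omega), List.attach_map_val (f := boolCumulant E)]

section partitions
variable {ℓ N : ℕ}

/-- A partition, given by its set of blocks, is non-crossing: there are no `i₁ < j₁ < i₂ < j₂` with
`i₁, i₂` in one block and `j₁, j₂` in another. -/
def NonCrossing (P : Finset (Finset (Fin ℓ))) : Prop :=
  ∀ V ∈ P, ∀ W ∈ P, ∀ i₁ ∈ V, ∀ i₂ ∈ V, ∀ j₁ ∈ W, ∀ j₂ ∈ W,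
    i₁ < j₁ → j₁ < i₂ → i₂ < j₂ → V = W

/-- `V` is nested inside `W` (`V ≻ W`): there are `j, k ∈ W` with `V` strictly between `j` and `k`. -/
def Nested (V W : Finset (Fin ℓ)) : Prop :=
  ∃ j ∈ W, ∃ k ∈ W, ∀ i ∈ V, j < i ∧ i < k

/-- `C = (V, V₂, …, V_d)` is the chain of `V`: `V` and all blocks around it, each one nested inside the
later ones. -/
def IsNestingChain (P : Finset (Finset (Fin ℓ))) (V : Finset (Fin ℓ)) (C : List (Finset (Fin ℓ))) :
    Prop :=
  C.Pairwise Nested ∧ ∀ W, W ∈ C ↔ W ∈ P ∧ (W = V ∨ Nested V W)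

/-- The coloring is constant on each block. -/
def ColorCompatible (χ : Fin ℓ → Fin N) (P : Finset (Finset (Fin ℓ))) : Prop :=
  ∀ V ∈ P, ∀ i ∈ V, ∀ k ∈ V, χ i = χ k

/-- For every block `V`, the string of the colors of the blocks in the chain of `V` is a vertex of `T`. -/
def TreeCompatible (T : RootedSubtree N) (χ : Fin ℓ → Fin N) (P : Finset (Finset (Fin ℓ))) :
    Prop :=
  ∀ V ∈ P, ∃ C, IsNestingChain P V C ∧ ∃ s ∈ T.strings, C.Forall₂ (fun W c => ∀ i ∈ W, χ i = c) s

open Classical in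
/-- `NC(χ, T)`: the non-crossing partitions of `{1, …, ℓ}` that are compatible with `χ` and with `T`. -/
noncomputable def NC (T : RootedSubtree N) (χ : Fin ℓ → Fin N) :
    Finset (Finpartition (Finset.univ : Finset (Fin ℓ))) :=
  Finset.univ.filter fun π =>
    NonCrossing π.parts ∧ ColorCompatible χ π.parts ∧ TreeCompatible T χ π.parts

/-- `V` is an interval block of the partition `P` (within the set `S = ⋃ P` that `P` partitions). -/
def IsIntervalBlock (P : Finset (Finset (Fin ℓ))) (V : Finset (Fin ℓ)) : Prop :=
  V ∈ P ∧ ∀ i ∈ V, ∀ k ∈ V, ∀ x ∈ P.sup id, i ≤ x → x ≤ k → x ∈ V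

/-- The elements of `S = ⋃ P` after all elements of `V`. -/
def laterElements (P : Finset (Finset (Fin ℓ))) (V : Finset (Fin ℓ)) : Finset (Fin ℓ) :=
  {x ∈ P.sup id | ∀ i ∈ V, i < x}

variable (H : Fin N → PointedCorr B)

/-- `a i`, as an element of `L(H_c)` when `c = χ i` (and `0` for a wrong color `c`). -/
noncomputable def asColor (χ : Fin ℓ → Fin N) (a : ∀ i, (H (χ i)).toCorr.adj) (c : Fin N) (i : Fin ℓ) :
    (H c).toCorr.adj :=
  if h : χ i = c then h ▸ a i else 0

/-- The Boolean cumulant `K[a_i : i ∈ V]` of a block `V` of one color `c`, computed in `L(H_c)`, with the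
arguments in increasing order. (The color is that of the least element of `V`.) -/
noncomputable def blockCumulant (χ : Fin ℓ → Fin N) (a : ∀ i, (H (χ i)).toCorr.adj)
    (V : Finset (Fin ℓ)) : B :=
  if h : V.Nonempty then
    boolCumulant (H (χ (V.min' h))) (V.sort.map (asColor H χ a (χ (V.min' h))))
  else 1

open Classical in
/-- `Λ_{χ,P}`, by recursion: remove an interval block `V`; if there is a next element `n` after `V`,
replace `a_n` by `K[a_i : i ∈ V] a_n` and continue with the other blocks; if there is none, multiply
the value for the other blocks on the right by `K[a_i : i ∈ V]`. The empty partition has value `1`.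
Some interval block is chosen at each step. -/
noncomputable def Lam (χ : Fin ℓ → Fin N) (P : Finset (Finset (Fin ℓ)))
    (a : ∀ i, (H (χ i)).toCorr.adj) : B :=
  if hP : ∃ V, IsIntervalBlock P V then
    if h : (laterElements P hP.choose).Nonempty then
      Lam χ (P.erase hP.choose) (Function.update a ((laterElements P hP.choose).min' h)
        ((H (χ ((laterElements P hP.choose).min' h))).toCorr.leftOp (blockCumulant H χ a hP.choose)
          * a ((laterElements P hP.choose).min' h)))
    else
      Lam χ (P.erase hP.choose) a * blockCumulant H χ a hP.choose
  else 1
termination_by P.card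
decreasing_by
  all_goals exact Finset.card_erase_lt_of_mem hP.choose_spec.1

end partitions

end TFree

/-!
# The moment formula for the `T`-free product

The vector `λ(a_1) ⋯ λ(a_ℓ) ξ` is expanded from right to left. Let `s` be a string of the tree. If
`j s ∈ T`, then `λ_j(x)` maps `v ∈ H_s°` to `⟨ξ_j, x ξ_j⟩ v + Q x ξ_j ⊗ v`, and
`h ⊗ v ∈ H_{js}° = H_j° ⊗ H_s°` to `⟨ξ_j, x h⟩ v + Q x h ⊗ v`, where `Q` is the projection of `H_j` onto
`H_j°`; on the other summands `λ_j(x)` vanishes. So the terms of the expansion correspond to choices that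
build a non-crossing partition: the element `k` is a block of its own, or the last element of a block that
is open to the left, or it is added to the innermost open block, which then stays open or is closed. The
open blocks form a stack, and the string of their colors is the summand `H_s°` that contains the term. A
new block with color `j` is allowed exactly if `j s ∈ T`, and `j s` is the string of the colors of its
chain; this is the condition that defines `NC(χ, T)`. Only the terms without open blocks contribute to the
vacuum expectation.

An open block `{v₁ < ⋯ < vₘ}` contributes the tensor factor `Q a_{v₁} Q ⋯ Q a_{vₘ} ξ`, and closing it
produces `⟨ξ, a_{v₁} Q a_{v₂} ⋯ Q a_{vₘ} ξ⟩`, which is the Boolean cumulant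
(`PointedCorr.boolCumulant_cons`). This element of `B` acts from the left on the remaining tensor and is
absorbed by the first operator of the next open block, or by the coefficient in `B` if there is none. At
that moment the closed block is an interval block of what remains of the partition, and this is the
recursion for `Λ`. Hence the coefficient of a term without open blocks is the value of `Λ`
(`State.Valid.closeBlock`), as soon as the recursion is known to hold for the removal of any interval block
(`IsColoredNC.Lam_eq`). The latter is a confluence argument: the removals of two interval blocks commute
(`IsColoredNC.removal_comm`), because Boolean cumulants are left `B`-linear in the first argument.

It remains to see that each partition in `NC(χ, T)` occurs in exactly one term. It occurs, since its
traces on the final segments of the index set do (`exists_trace_mem_run`); and it occurs only once, since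
each step can be undone (`State.nodup_map_run`).
-/

namespace TFree

open MulOpposite

variable {B : Type u} [CStarAlgebra B] [PartialOrder B] [StarOrderedRing B]

/-! ### Boolean cumulants -/

/-- The sum over all interval partitions of a nonempty list, organized by the first block. -/
theorem sum_composition_cons {α R : Type*} [Semiring R] (K : List α → R) (x : α) (l : List α) :
    ∑ c : Composition (x :: l).length, (((x :: l).splitWrtComposition c).map K).prod
      = ∑ i : Fin (l.length + 1), K (x :: l.take i) *
          ∑ c : Composition (l.drop i).length, (((l.drop i).splitWrtComposition c).map K).prod := by
  simp_rw [Finset.mul_sum]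
  rw [Finset.sum_sigma', eq_comm]
  refine Finset.sum_bij (fun p _ => (⟨(p.1 + 1) :: p.2.blocks, ?_, ?_⟩ :
    Composition (x :: l).length)) (fun _ _ => Finset.mem_univ _) ?_ ?_ ?_
  · intro i hi
    rcases List.mem_cons.1 hi with h | h
    · omega
    · exact p.2.blocks_pos h
  · have h1 := p.2.blocks_sum
    have h2 := p.1.2
    have h3 : (l.drop p.1).length = l.length - p.1 := List.length_drop
    rw [List.sum_cons, List.length_cons]
    omega
  · rintro ⟨i, c⟩ - ⟨i', c'⟩ - h
    have h1 := List.cons.inj (Composition.ext_iff.1 h)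
    obtain rfl : i = i' := Fin.ext (Nat.succ_injective h1.1)
    obtain rfl : c = c' := Composition.ext h1.2
    rfl
  · intro c _
    rcases hb : c.blocks with - | ⟨b, bs⟩
    · have := c.blocks_sum
      rw [hb] at this
      simp at this
    · have h0 : 0 < b := c.blocks_pos (by rw [hb]; exact List.mem_cons_self)
      have h1 := c.blocks_sum
      rw [hb, List.sum_cons, List.length_cons] at h1
      refine ⟨⟨⟨b - 1, by omega⟩, ⟨bs, fun h => c.blocks_pos (by
        rw [hb]; exact List.mem_cons_of_mem _ h), ?_⟩⟩, Finset.mem_univ _, ?_⟩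
      · rw [List.length_drop]
        simp only
        omega
      · refine Composition.ext ?_
        refine Eq.trans ?_ hb.symm
        simp only [Nat.sub_add_cancel h0]
  · rintro ⟨i, c⟩ -
    simp [List.splitWrtComposition, List.splitWrtCompositionAux_cons]

namespace PointedCorr
variable (E : PointedCorr B)

/-- The vector `Q a₁ Q a₂ ⋯ Q aₙ ξ`, where `Q` is the projection of `H` onto `H°`; it is `ξ` for the
empty list. -/
noncomputable def reducedVec : List E.toCorr.adj → E
  | [] => E.vec
  | a :: l => E.complIncl (E.complProj (a.1 (reducedVec l)))

theorem adj_ract (a : E.toCorr.adj) (x : E) (b : B) :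
    a.1 (E.ract (op b) x) = E.ract (op b) (a.1 x) := a.2.1 x (op b)

theorem expect_prod_cons (x : E.toCorr.adj) (l : List E.toCorr.adj)
    (h : l.prod.1 E.vec = ∑ i : Fin (l.length + 1),
      E.ract (op (E.expect (l.drop i).prod)) (E.reducedVec (l.take i))) :
    E.expect (x :: l).prod = ∑ i : Fin (l.length + 1),
      E.ip E.vec (x.1 (E.reducedVec (l.take i))) * E.expect (l.drop i).prod := by
  have h1 : E.expect (x :: l).prod = E.ip E.vec (x.1 (l.prod.1 E.vec)) := by
    rw [List.prod_cons]; rfl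
  rw [h1, h, map_sum, map_sum]
  exact Finset.sum_congr rfl fun i _ => by rw [adj_ract, E.ip_ract]

/-- The vector `a₁ ⋯ aₙ ξ` in terms of reduced vectors: insert `1 = Q + |ξ⟩⟨ξ|` between the operators. -/
theorem prod_apply_vec (l : List E.toCorr.adj) :
    l.prod.1 E.vec = ∑ i : Fin (l.length + 1),
      E.ract (op (E.expect (l.drop i).prod)) (E.reducedVec (l.take i)) := by
  induction l with
  | nil =>
    have h1 : E.expect (1 : E.toCorr.adj) = 1 := E.ip_vec
    simp [reducedVec, h1]
  | cons x l ih =>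
    have h2 := E.expect_prod_cons x l ih
    have h1 : (x :: l).prod.1 E.vec = x.1 (l.prod.1 E.vec) := by
      rw [List.prod_cons]; rfl
    have h3 : ∑ i : Fin ((x :: l).length + 1),
        E.ract (op (E.expect ((x :: l).drop i).prod)) (E.reducedVec ((x :: l).take i))
        = E.ract (op (E.expect (x :: l).prod)) E.vec + ∑ i : Fin (l.length + 1),
          E.ract (op (E.expect (l.drop i).prod)) (E.reducedVec (x :: l.take i)) :=
      Fin.sum_univ_succ _
    rw [h1, ih, map_sum, h3, h2, Finset.op_sum, map_sum, LinearMap.sum_apply, ← Finset.sum_add_distrib]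
    refine Finset.sum_congr rfl fun i _ => ?_
    rw [adj_ract, op_mul, map_mul, Module.End.mul_apply, reducedVec, ← map_add]
    exact congrArg _ (E.decomp _)

/-- A Boolean cumulant is a moment with the projection `Q` onto `H°` between consecutive operators:
`K[a₁, …, aₙ] = ⟨ξ, a₁ Q a₂ Q ⋯ Q aₙ ξ⟩`. -/
theorem boolCumulant_cons (x : E.toCorr.adj) (l : List E.toCorr.adj) :
    boolCumulant E (x :: l) = E.ip E.vec (x.1 (E.reducedVec l)) := by
  induction h : l.length using Nat.strong_induction_on generalizing x l with
  | _ n ih =>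
    have h1 := E.expect_prod_cons x l (E.prod_apply_vec l)
    rw [expect_prod_eq_sum, sum_composition_cons] at h1
    simp_rw [← expect_prod_eq_sum] at h1
    rw [Fin.sum_univ_castSucc, Fin.sum_univ_castSucc] at h1
    have h2 : ∀ i : Fin l.length, boolCumulant E (x :: l.take i.castSucc)
        = E.ip E.vec (x.1 (E.reducedVec (l.take i.castSucc))) := fun i => by
      refine ih _ ?_ x _ rfl
      rw [List.length_take, Fin.val_castSucc]
      have := i.2
      omega
    simp_rw [h2] at h1
    have h3 : E.expect (1 : E.toCorr.adj) = 1 := E.ip_vec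
    simpa [h3] using h1

theorem expect_leftOp (b : B) (y : E) : E.ip E.vec (E.lact b y) = b * E.ip E.vec y := by
  rw [E.ip_lact, E.central, E.ip_ract_left, star_star]

theorem leftOp_mul (b c : B) : E.toCorr.leftOp (b * c) = E.toCorr.leftOp b * E.toCorr.leftOp c := by
  refine Subtype.ext (ContinuousLinearMap.ext fun y => ?_)
  change E.lact (b * c) y = E.lact b (E.lact c y)
  rw [map_mul]; rfl

/-- Boolean cumulants are left `B`-linear in the first argument. -/
theorem boolCumulant_leftOp (b : B) (x : E.toCorr.adj) (l : List E.toCorr.adj) :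
    boolCumulant E (E.toCorr.leftOp b * x :: l) = b * boolCumulant E (x :: l) := by
  rw [boolCumulant_cons, boolCumulant_cons, ← expect_leftOp]
  rfl

end PointedCorr

/-! ### Removing interval blocks in any order -/

section removal
variable {ℓ N : ℕ} {χ : Fin ℓ → Fin N} {P : Finset (Finset (Fin ℓ))} {V W : Finset (Fin ℓ)}

/-- The blocks in `P` form a non-crossing partition of their union, with `χ` constant on each block. -/
structure IsColoredNC (χ : Fin ℓ → Fin N) (P : Finset (Finset (Fin ℓ))) : Prop where
  nonempty : ∀ V ∈ P, V.Nonempty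
  eq_of_mem : ∀ V ∈ P, ∀ W ∈ P, ∀ x ∈ V, x ∈ W → V = W
  nonCrossing : NonCrossing P
  color : ColorCompatible χ P

theorem IsColoredNC.mono (hP : IsColoredNC χ P) {Q : Finset (Finset (Fin ℓ))} (h : Q ⊆ P) :
    IsColoredNC χ Q where
  nonempty V hV := hP.nonempty V (h hV)
  eq_of_mem V hV W hW := hP.eq_of_mem V (h hV) W (h hW)
  nonCrossing V hV W hW := hP.nonCrossing V (h hV) W (h hW)
  color V hV := hP.color V (h hV)

theorem _root_.Finpartition.isColoredNC {S : Finset (Fin ℓ)} (π : Finpartition S)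
    (h : NonCrossing π.parts) (h' : ColorCompatible χ π.parts) : IsColoredNC χ π.parts where
  nonempty V hV := π.nonempty_of_mem_parts hV
  eq_of_mem V hV W hW x hx hx' := by
    by_contra hne
    exact Finset.disjoint_left.1 (π.disjoint hV hW hne) hx hx'
  nonCrossing := h
  color := h'

theorem mem_sup_id {x : Fin ℓ} : x ∈ P.sup id ↔ ∃ U ∈ P, x ∈ U := by
  simp [Finset.mem_sup]

theorem mem_laterElements {x : Fin ℓ} :
    x ∈ laterElements P V ↔ (∃ U ∈ P, x ∈ U) ∧ ∀ i ∈ V, i < x := by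
  rw [laterElements, Finset.mem_filter, mem_sup_id]

theorem IsIntervalBlock.erase (hV : IsIntervalBlock P V) (h : V ≠ W) :
    IsIntervalBlock (P.erase W) V := by
  refine ⟨Finset.mem_erase.2 ⟨h, hV.1⟩, fun i hi k hk x hx => hV.2 i hi k hk x ?_⟩
  obtain ⟨U, hU, hxU⟩ := mem_sup_id.1 hx
  exact mem_sup_id.2 ⟨U, Finset.mem_of_mem_erase hU, hxU⟩

/-- Of two interval blocks, one lies entirely before the other. -/
theorem IsColoredNC.lt_or_gt (hP : IsColoredNC χ P) (hV : IsIntervalBlock P V)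
    (hW : IsIntervalBlock P W) (h : V ≠ W) :
    (∀ v ∈ V, ∀ w ∈ W, v < w) ∨ ∀ w ∈ W, ∀ v ∈ V, w < v := by
  have key : ∀ {V W : Finset (Fin ℓ)}, IsIntervalBlock P V → IsIntervalBlock P W → V ≠ W →
      ∀ v₀ ∈ V, ∀ w₀ ∈ W, v₀ < w₀ → ∀ v ∈ V, ∀ w ∈ W, v < w := by
    intro V W hV hW h v₀ hv₀ w₀ hw₀ h0 v hv w hw
    by_contra! hwv
    have h1 : v < w₀ := by
      by_contra! h1
      exact h (hP.eq_of_mem V hV.1 W hW.1 w₀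
        (hV.2 v₀ hv₀ v hv w₀ (mem_sup_id.2 ⟨W, hW.1, hw₀⟩) h0.le h1) hw₀)
    exact h (hP.eq_of_mem V hV.1 W hW.1 v hv
      (hW.2 w hw w₀ hw₀ v (mem_sup_id.2 ⟨V, hV.1, hv⟩) hwv h1.le))
  obtain ⟨v₀, hv₀⟩ := hP.nonempty V hV.1
  obtain ⟨w₀, hw₀⟩ := hP.nonempty W hW.1
  rcases lt_trichotomy v₀ w₀ with h0 | h0 | h0
  · exact .inl (key hV hW h v₀ hv₀ w₀ hw₀ h0)
  · exact absurd (hP.eq_of_mem V hV.1 W hW.1 v₀ hv₀ (h0 ▸ hw₀)) h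
  · exact .inr (key hW hV h.symm w₀ hw₀ v₀ hv₀ h0)

variable (H : Fin N → PointedCorr B) {a a' : ∀ i, (H (χ i)).toCorr.adj}

theorem asColor_congr {i : Fin ℓ} (h : a i = a' i) (c : Fin N) :
    asColor H χ a c i = asColor H χ a' c i := by
  unfold asColor
  rw [h]

theorem asColor_leftOp {i : Fin ℓ} {b : B} (h : a' i = (H (χ i)).toCorr.leftOp b * a i) {c : Fin N}
    (hc : χ i = c) :
    asColor H χ a' c i = (H c).toCorr.leftOp b * asColor H χ a c i := by
  subst hc
  simp only [asColor, dif_pos, h]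

theorem blockCumulant_eq (hV : V.Nonempty) {c : Fin N} (hc : ∀ i ∈ V, χ i = c) :
    blockCumulant H χ a V = boolCumulant (H c) (V.sort.map (asColor H χ a c)) := by
  obtain rfl := hc _ (V.min'_mem hV)
  rw [blockCumulant, dif_pos hV]

theorem blockCumulant_congr (h : ∀ i ∈ V, a i = a' i) :
    blockCumulant H χ a V = blockCumulant H χ a' V := by
  unfold blockCumulant
  split_ifs with hV
  · refine congrArg _ (List.map_congr_left fun i hi => asColor_congr H (h i ?_) _)
    exact (Finset.mem_sort _).1 hi
  · rfl

theorem sort_eq_min_cons {n : Fin ℓ} (hn : IsLeast (V : Set (Fin ℓ)) n) :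
    V.sort = n :: (V.erase n).sort := by
  have h1 := (V.erase n).sort_insert (r := (· ≤ ·)) (a := n)
    (fun b hb => hn.2 (Finset.mem_of_mem_erase hb)) (Finset.notMem_erase _ _)
  rwa [Finset.insert_erase hn.1] at h1

/-- If `a'` arises from `a` by multiplying the first argument of the block `V` by `b` from the left, then
the cumulant of `V` is multiplied by `b`. -/
theorem blockCumulant_leftOp {n : Fin ℓ} (hn : IsLeast (V : Set (Fin ℓ)) n) {b : B}
    (hc : ∀ i ∈ V, ∀ k ∈ V, χ i = χ k) (h : a' n = (H (χ n)).toCorr.leftOp b * a n)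
    (h' : ∀ i ∈ V, i ≠ n → a' i = a i) :
    blockCumulant H χ a' V = b * blockCumulant H χ a V := by
  have hV : V.Nonempty := ⟨n, hn.1⟩
  have hcn : ∀ i ∈ V, χ i = χ n := fun i hi => hc i hi n hn.1
  rw [blockCumulant_eq H hV hcn, blockCumulant_eq H hV hcn, sort_eq_min_cons hn, List.map_cons,
    List.map_cons, asColor_leftOp H h rfl, PointedCorr.boolCumulant_leftOp]
  congr 3
  refine List.map_congr_left fun i hi => asColor_congr H ?_ _
  rw [Finset.mem_sort, Finset.mem_erase] at hi
  exact h' i hi.2 hi.1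

open Classical in
/-- One step of the recursion for `Λ`: the removal of the block `V` from `P` changes the family `a` to the
first component, and multiplies the value from the right by the second one. -/
noncomputable def removal (χ : Fin ℓ → Fin N) (P : Finset (Finset (Fin ℓ))) (V : Finset (Fin ℓ))
    (a : ∀ i, (H (χ i)).toCorr.adj) : (∀ i, (H (χ i)).toCorr.adj) × B :=
  if h : (laterElements P V).Nonempty then
    (Function.update a ((laterElements P V).min' h)
      ((H (χ ((laterElements P V).min' h))).toCorr.leftOp (blockCumulant H χ a V)
        * a ((laterElements P V).min' h)), 1)
  else (a, blockCumulant H χ a V)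

theorem removal_of_isLeast {n : Fin ℓ} (hn : IsLeast (laterElements P V : Set (Fin ℓ)) n) :
    removal H χ P V a = (Function.update a n
      ((H (χ n)).toCorr.leftOp (blockCumulant H χ a V) * a n), 1) := by
  have h : (laterElements P V).Nonempty := ⟨n, hn.1⟩
  obtain rfl : (laterElements P V).min' h = n := ((laterElements P V).isLeast_min' h).unique hn
  rw [removal, dif_pos h]

theorem removal_of_empty (hn : laterElements P V = ∅) :
    removal H χ P V a = (a, blockCumulant H χ a V) := by
  rw [removal, dif_neg (by simp [hn])]

theorem exists_isLeast_or_empty (S : Finset (Fin ℓ)) :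
    (∃ n, IsLeast (S : Set (Fin ℓ)) n) ∨ S = ∅ := by
  rcases S.eq_empty_or_nonempty with h | h
  · exact .inr h
  · exact .inl ⟨_, S.isLeast_min' h⟩

theorem Lam_choose (hP : ∃ V, IsIntervalBlock P V) :
    Lam H χ P a = Lam H χ (P.erase hP.choose) (removal H χ P hP.choose a).1
      * (removal H χ P hP.choose a).2 := by
  rw [Lam, dif_pos hP, removal]
  split_ifs <;> simp

theorem Lam_empty : Lam H χ ∅ a = 1 := by
  rw [Lam, dif_neg]
  rintro ⟨V, hV, -⟩
  simp at hV

theorem removal_congr (h : ∀ i ∈ V, a i = a' i) :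
    (removal H χ P V a).2 = (removal H χ P V a').2 ∧
      ∀ i, a i = a' i → (removal H χ P V a).1 i = (removal H χ P V a').1 i := by
  rcases exists_isLeast_or_empty (laterElements P V) with ⟨n, hn⟩ | hn
  · rw [removal_of_isLeast H hn, removal_of_isLeast H hn, blockCumulant_congr H h]
    refine ⟨rfl, fun i hi => ?_⟩
    by_cases hin : i = n
    · subst hin; simp [hi]
    · simp [hin, hi]
  · rw [removal_of_empty H hn, removal_of_empty H hn]
    exact ⟨blockCumulant_congr H h, fun i hi => hi⟩

/-- `Λ_{χ,P}` depends only on the operators `a i` with `i` in a block of `P`. -/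
theorem Lam_congr (h : ∀ V ∈ P, ∀ i ∈ V, a i = a' i) : Lam H χ P a = Lam H χ P a' := by
  induction hn : P.card using Nat.strong_induction_on generalizing P a a' with
  | _ n ih =>
    by_cases hP : ∃ V, IsIntervalBlock P V
    · have hV := hP.choose_spec.1
      have h1 := removal_congr (P := P) H (h _ hV)
      rw [Lam_choose H hP, Lam_choose H hP, h1.1]
      refine congrArg (· * _) (ih _ (hn ▸ Finset.card_erase_lt_of_mem hV) (fun U hU i hi => ?_) rfl)
      exact h1.2 i (h U (Finset.mem_of_mem_erase hU) i hi)
    · rw [Lam, Lam, dif_neg hP, dif_neg hP]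

theorem laterElements_erase_left (hVW : ∀ v ∈ V, ∀ w ∈ W, v < w) (hW : W.Nonempty) :
    laterElements (P.erase V) W = laterElements P W := by
  ext x
  rw [mem_laterElements, mem_laterElements]
  refine ⟨fun ⟨⟨U, hU, hx⟩, h⟩ => ⟨⟨U, Finset.mem_of_mem_erase hU, hx⟩, h⟩,
    fun ⟨⟨U, hU, hx⟩, h⟩ => ⟨⟨U, Finset.mem_erase.2 ⟨?_, hU⟩, hx⟩, h⟩⟩
  rintro rfl
  obtain ⟨w, hw⟩ := hW
  exact lt_asymm (hVW x hx w hw) (h w hw)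

/-- The removals of two interval blocks commute, up to values that no longer matter. -/
theorem IsColoredNC.removal_comm (hP : IsColoredNC χ P) (hV : IsIntervalBlock P V)
    (hW : IsIntervalBlock P W) (hVW : ∀ v ∈ V, ∀ w ∈ W, v < w) :
    (removal H χ (P.erase V) W (removal H χ P V a).1).2 * (removal H χ P V a).2
      = (removal H χ (P.erase W) V (removal H χ P W a).1).2 * (removal H χ P W a).2 ∧
    ∀ i, i ∉ W → (removal H χ (P.erase V) W (removal H χ P V a).1).1 i
      = (removal H χ (P.erase W) V (removal H χ P W a).1).1 i := by
  have hWne := hP.nonempty W hW.1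
  have hVne := hP.nonempty V hV.1
  have hmem : ∀ w ∈ W, w ∈ laterElements P V := fun w hw =>
    mem_laterElements.2 ⟨⟨W, hW.1, hw⟩, fun v hv => hVW v hv w hw⟩
  obtain ⟨n, hn⟩ : ∃ n, IsLeast (laterElements P V : Set (Fin ℓ)) n := by
    obtain ⟨w, hw⟩ := hWne
    exact ⟨_, (laterElements P V).isLeast_min' ⟨w, hmem w hw⟩⟩
  have hnV : ∀ i ∈ V, i < n := (mem_laterElements.1 hn.1).2
  have hsub : laterElements (P.erase W) V ⊆ laterElements P V := fun x hx => by
    obtain ⟨⟨U, hU, hxU⟩, h⟩ := mem_laterElements.1 hx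
    exact mem_laterElements.2 ⟨⟨U, Finset.mem_of_mem_erase hU, hxU⟩, h⟩
  have hVn' : ∀ n' ∈ laterElements P W, n' ∉ V := fun n' hn' h => by
    obtain ⟨w, hw⟩ := hWne
    exact lt_asymm (hVW n' h w hw) ((mem_laterElements.1 hn').2 w hw)
  have hK : ∀ {n' : Fin ℓ} {z}, n' ∈ laterElements P W →
      blockCumulant H χ (Function.update a n' z) V = blockCumulant H χ a V := fun hn' =>
    blockCumulant_congr H fun i hi => Function.update_of_ne (ne_of_mem_of_not_mem hi (hVn' _ hn')) _ _
  rw [removal_of_isLeast H hn]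
  by_cases hnW : n ∈ W
  · -- `n` is the first element of `W`: the cumulant of `V` enters the cumulant of `W`.
    have hnW' : IsLeast (W : Set (Fin ℓ)) n := ⟨hnW, fun w hw => hn.2 (hmem w hw)⟩
    have hKW : blockCumulant H χ (Function.update a n
        ((H (χ n)).toCorr.leftOp (blockCumulant H χ a V) * a n)) W
        = blockCumulant H χ a V * blockCumulant H χ a W :=
      blockCumulant_leftOp H hnW' (hP.color W hW.1) (Function.update_self _ _ _)
        fun i _ h => Function.update_of_ne h _ _
    have hlater : laterElements (P.erase W) V = laterElements P W := by
      ext x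
      refine ⟨fun hx => ?_, fun hx => ?_⟩
      · obtain ⟨⟨U, hU, hxU⟩, -⟩ := mem_laterElements.1 hx
        obtain ⟨hUW, hU⟩ := Finset.mem_erase.1 hU
        refine mem_laterElements.2 ⟨⟨U, hU, hxU⟩, fun w hw => ?_⟩
        by_contra! hxw
        exact hUW (hP.eq_of_mem U hU W hW.1 x hxU (hW.2 n hnW w hw x
          (mem_sup_id.2 ⟨U, hU, hxU⟩) (hn.2 (hsub hx)) hxw))
      · obtain ⟨⟨U, hU, hxU⟩, h⟩ := mem_laterElements.1 hx
        refine mem_laterElements.2 ⟨⟨U, Finset.mem_erase.2 ⟨?_, hU⟩, hxU⟩,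
          fun v hv => (hnV v hv).trans (h n hnW)⟩
        rintro rfl
        exact lt_irrefl _ (h x hxU)
    rcases exists_isLeast_or_empty (laterElements P W) with ⟨n', hn'⟩ | h0
    · have hne : n' ≠ n := ((mem_laterElements.1 hn'.1).2 n hnW).ne'
      rw [removal_of_isLeast H hn', removal_of_isLeast H (n := n') (by
        rwa [laterElements_erase_left hVW hWne]), removal_of_isLeast H (n := n') (by rwa [hlater]),
        hKW]
      simp only [hK hn'.1]
      refine ⟨trivial, fun i hi => ?_⟩
      have hin : i ≠ n := fun h => hi (h ▸ hnW)
      by_cases hin' : i = n'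
      · subst hin'
        simp [Function.update_of_ne hne, PointedCorr.leftOp_mul, mul_assoc]
      · simp [hin, hin']
    · rw [removal_of_empty H h0, removal_of_empty H (by
        rwa [laterElements_erase_left hVW hWne]), removal_of_empty H (by rwa [hlater]), hKW]
      refine ⟨mul_one _, fun i hi => Function.update_of_ne (ne_of_mem_of_not_mem hnW hi).symm _ _⟩
  · have hKW : ∀ {z}, blockCumulant H χ (Function.update a n z) W = blockCumulant H χ a W :=
      blockCumulant_congr H fun i hi => Function.update_of_ne (ne_of_mem_of_not_mem hi hnW) _ _
    have hlater : IsLeast (laterElements (P.erase W) V : Set (Fin ℓ)) n := by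
      refine ⟨?_, fun x hx => hn.2 (hsub hx)⟩
      obtain ⟨⟨U, hU, hxU⟩, h⟩ := mem_laterElements.1 hn.1
      exact mem_laterElements.2 ⟨⟨U, Finset.mem_erase.2 ⟨ne_of_mem_of_not_mem' hxU hnW, hU⟩, hxU⟩, h⟩
    rcases exists_isLeast_or_empty (laterElements P W) with ⟨n', hn'⟩ | h0
    · have hne : n' ≠ n := by
        obtain ⟨w, hw⟩ := hWne
        exact ((hn.2 (hmem w hw)).trans_lt ((mem_laterElements.1 hn'.1).2 w hw)).ne'
      rw [removal_of_isLeast H hn', removal_of_isLeast H (n := n') (by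
        rwa [laterElements_erase_left hVW hWne]), removal_of_isLeast H hlater, hKW]
      simp only [hK hn'.1]
      refine ⟨trivial, fun i hi => ?_⟩
      by_cases hin : i = n
      · subst hin; simp [Function.update_of_ne hne.symm]
      · by_cases hin' : i = n'
        · subst hin'; simp [hin]
        · simp [hin, hin']
    · rw [removal_of_empty H h0, removal_of_empty H (by
        rwa [laterElements_erase_left hVW hWne]), removal_of_isLeast H hlater, hKW]
      exact ⟨by simp, fun i hi => rfl⟩

/-- The recursion for `Λ` holds for the removal of any interval block. -/
theorem IsColoredNC.Lam_eq (hP : IsColoredNC χ P) (hV : IsIntervalBlock P V) :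
    Lam H χ P a = Lam H χ (P.erase V) (removal H χ P V a).1 * (removal H χ P V a).2 := by
  induction hn : P.card using Nat.strong_induction_on generalizing P V a with
  | _ n ih =>
    have hex : ∃ V, IsIntervalBlock P V := ⟨V, hV⟩
    rw [Lam_choose H hex]
    have hW := hex.choose_spec
    generalize hex.choose = W at hW
    by_cases hVW : V = W
    · rw [hVW]
    · rw [ih _ (hn ▸ Finset.card_erase_lt_of_mem hW.1) (hP.mono (Finset.erase_subset _ _))
          (hV.erase hVW) rfl,
        ih _ (hn ▸ Finset.card_erase_lt_of_mem hV.1) (hP.mono (Finset.erase_subset _ _))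
          (hW.erase (Ne.symm hVW)) rfl, Finset.erase_right_comm, mul_assoc, mul_assoc]
      have hmem : ∀ U ∈ (P.erase V).erase W, ∀ i ∈ U, i ∉ V ∧ i ∉ W := by
        intro U hU i hi
        obtain ⟨h1, h2⟩ := Finset.mem_erase.1 hU
        obtain ⟨h2, h3⟩ := Finset.mem_erase.1 h2
        exact ⟨fun h => h2 (hP.eq_of_mem U h3 V hV.1 i hi h),
          fun h => h1 (hP.eq_of_mem U h3 W hW.1 i hi h)⟩
      rcases hP.lt_or_gt hV hW hVW with h | h
      · have h1 := hP.removal_comm H (a := a) hV hW h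
        rw [h1.1]
        exact congrArg (· * _) (Lam_congr H fun U hU i hi => (h1.2 i (hmem U hU i hi).2).symm)
      · have h1 := hP.removal_comm H (a := a) hW hV h
        rw [h1.1]
        exact congrArg (· * _) (Lam_congr H fun U hU i hi => h1.2 i (hmem U hU i hi).1)

end removal

/-! ### The operators `λ_j(x)` on elementary vectors -/

theorem oplusZero_inl {E : Corr B} (x : E.adj) (F : Corr B) (y : E) :
    (oplusZero x F).1 (hprodInl E F y) = hprodInl E F (x.1 y) := by
  refine (PreCorr.extendOp_apply _ (oplusZeroAlg_bound x.1 F) (LinearMap.inl ℂ E F y)).trans ?_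
  exact congrArg _ (Prod.ext rfl rfl)

theorem oplusZero_inr {E : Corr B} (x : E.adj) (F : Corr B) (y : F) :
    (oplusZero x F).1 (hprodInr E F y) = 0 := by
  refine (PreCorr.extendOp_apply _ (oplusZeroAlg_bound x.1 F) (LinearMap.inr ℂ E F y)).trans ?_
  refine (congrArg _ (Prod.ext (map_zero x.1) rfl :
    oplusZeroAlg x.1 F (LinearMap.inr ℂ E F y) = 0)).trans (map_zero _)

section
variable {N : ℕ} (T : RootedSubtree N) (H : Fin N → PointedCorr B)

/-- The inclusion of `H_s°` in the `T`-free product, for a vertex `s` of `T`. -/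
noncomputable def stringIncl {s : List (Fin N)} (hs : s ∈ T.strings) :
    stringSpace H s →ₗ[ℂ] (product T H).toCorr :=
  hsumIncl (fun s : T.strings => stringSpace H s) ⟨s, hs⟩

theorem ip_vec_stringIncl_nil (b : B) :
    (product T H).ip (product T H).vec (stringIncl T H T.nil_mem b) = b := by
  refine (hsumIncl_ip (fun s : T.strings => stringSpace H s) ⟨[], T.nil_mem⟩ (1 : B) b).trans ?_
  change star (1 : B) * b = b
  rw [star_one, one_mul]

theorem ip_vec_stringIncl_of_ne {s : List (Fin N)} (hs : s ∈ T.strings) (h : s ≠ [])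
    (v : stringSpace H s) :
    (product T H).ip (product T H).vec (stringIncl T H hs v) = 0 :=
  hsumIncl_ip_ne (fun s : T.strings => stringSpace H s) (i := ⟨[], T.nil_mem⟩) (j := ⟨s, hs⟩)
    (fun h' => h (congrArg Subtype.val h').symm) (1 : B) v

variable {H} {j : Fin N} {s : List (Fin N)}

theorem mem_left (hj : j :: s ∈ T.strings) : s ∈ T.left j := by
  refine ⟨T.tail_mem hj, fun h => ?_, hj⟩
  obtain ⟨r, rfl⟩ := List.head?_eq_some_iff.1 h
  have := T.alternating hj
  simp at this

theorem split_nil_right (hj : j :: s ∈ T.strings) (v : stringSpace H s) :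
    split T H j (stringIncl T H (T.tail_mem hj) v)
      = hprodInl _ (rightSpace T H j) (tmul (H j).toCorr (leftSpace T H j) (H j).vec
        (hsumIncl (fun s : T.left j => stringSpace H s) ⟨s, mem_left T hj⟩ v)) :=
  split_hsumIncl T H j (.inl ⟨s, mem_left T hj⟩) v

theorem split_tmul (hj : j :: s ∈ T.strings) (h : (H j).compl) (v : stringSpace H s) :
    split T H j (stringIncl T H hj (tmul (H j).compl (stringSpace H s) h v))
      = hprodInl _ (rightSpace T H j) (tmul (H j).toCorr (leftSpace T H j) ((H j).complIncl h)
        (hsumIncl (fun s : T.left j => stringSpace H s) ⟨s, mem_left T hj⟩ v)) := by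
  refine (split_hsumIncl T H j (.inr (.inl ⟨s, mem_left T hj⟩))
    (tmul (H j).compl (stringSpace H s) h v)).trans ?_
  exact congrArg (hprodInl (tensor (H j).toCorr (leftSpace T H j)) (rightSpace T H j))
    (tensorMap_tmul (H j).ip_complIncl
    (hsumIncl_ip (fun s : T.left j => stringSpace H s) ⟨s, mem_left T hj⟩)
    (hsumIncl_lact (fun s : T.left j => stringSpace H s) ⟨s, mem_left T hj⟩) h v)

/-- `H_j = ξ_j B ⊕ H_j°` in the first tensor factor. -/
theorem split_decomp (hj : j :: s ∈ T.strings) (h : H j) (v : stringSpace H s) :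
    hprodInl _ (rightSpace T H j) (tmul (H j).toCorr (leftSpace T H j) h
        (hsumIncl (fun s : T.left j => stringSpace H s) ⟨s, mem_left T hj⟩ v))
      = split T H j (stringIncl T H (T.tail_mem hj)
          ((stringSpace H s).lact ((H j).ip (H j).vec h) v)
        + stringIncl T H hj (tmul (H j).compl (stringSpace H s) ((H j).complProj h) v)) := by
  rw [map_add, split_nil_right T hj, split_tmul T hj, hsumIncl_lact]
  conv_lhs => rw [(H j).decomp h]
  rw [map_add, LinearMap.add_apply, map_add, tmul_ract]

theorem lam_eq_of_split (x : (H j).toCorr.adj) {y z : (product T H).toCorr}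
    (h : (oplusZero (ampl x (leftSpace T H j)) (rightSpace T H j)).1 (split T H j y)
      = split T H j z) : (lam T H j x).1 y = z :=
  (splitEquiv T H j).injective ((lam_apply T H j x y).trans h)

/-- `λ_j(x)` on `H_s°`, for `j s ∈ T`. -/
theorem lam_apply_stringIncl (hj : j :: s ∈ T.strings) (x : (H j).toCorr.adj)
    (v : stringSpace H s) :
    (lam T H j x).1 (stringIncl T H (T.tail_mem hj) v)
      = stringIncl T H (T.tail_mem hj)
          ((stringSpace H s).lact ((H j).ip (H j).vec (x.1 (H j).vec)) v)
        + stringIncl T H hj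
          (tmul (H j).compl (stringSpace H s) ((H j).complProj (x.1 (H j).vec)) v) := by
  refine lam_eq_of_split T x ?_
  rw [split_nil_right T hj, oplusZero_inl, ampl_tmul, split_decomp T hj]

/-- `λ_j(x)` on `H_{js}° = H_j° ⊗ H_s°`. -/
theorem lam_apply_stringIncl_tmul (hj : j :: s ∈ T.strings) (x : (H j).toCorr.adj)
    (h : (H j).compl) (v : stringSpace H s) :
    (lam T H j x).1 (stringIncl T H hj (tmul (H j).compl (stringSpace H s) h v))
      = stringIncl T H (T.tail_mem hj)
          ((stringSpace H s).lact ((H j).ip (H j).vec (x.1 ((H j).complIncl h))) v)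
        + stringIncl T H hj
          (tmul (H j).compl (stringSpace H s) ((H j).complProj (x.1 ((H j).complIncl h))) v) := by
  refine lam_eq_of_split T x ?_
  rw [split_tmul T hj, oplusZero_inl, ampl_tmul, split_decomp T hj]

/-- `λ_j(x)` vanishes on `H_s°` if `s ∈ T` does not begin with `j` and `j s ∉ T`. -/
theorem lam_apply_stringIncl_eq_zero (hs : s ∈ T.strings) (hj : s.head? ≠ some j)
    (hjs : j :: s ∉ T.strings) (x : (H j).toCorr.adj) (v : stringSpace H s) :
    (lam T H j x).1 (stringIncl T H hs v) = 0 := by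
  refine lam_eq_of_split T x ?_
  have h1 : split T H j (stringIncl T H hs v) = hprodInr _ _
      (hsumIncl (fun s : T.right j => stringSpace H s) ⟨s, hs, hj, hjs⟩ v) :=
    split_hsumIncl T H j (.inr (.inr ⟨s, hs, hj, hjs⟩)) v
  rw [h1, oplusZero_inr, map_zero]

end

/-! ### Expansion of the vector `λ(a_1) ⋯ λ(a_ℓ) ξ` -/

section states
variable {ℓ N : ℕ}

theorem PointedCorr.complProj_complIncl (E : PointedCorr B) (h : E.compl) :
    E.complProj (E.complIncl h) = h := by
  have h1 : E.ip E.vec (E.complIncl h) = 0 :=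
    E.mem_complSubmodule'.1 (Subtype.prop (p := (· ∈ E.complSubmodule)) h)
  refine Subtype.ext ?_
  change E.complIncl h - E.ract (op (E.ip E.vec (E.complIncl h))) E.vec = E.complIncl h
  rw [h1, op_zero, map_zero, LinearMap.zero_apply, sub_zero]

theorem tensor_lact_tmul (E F : Corr B) (b : B) (e : E) (f : F) :
    (tensor E F).lact b (tmul E F e f) = tmul E F (E.lact b e) f :=
  PreCorr.lact_toCompletion _ _ _

/-- A stack of open blocks with their colors: the blocks are nonempty and lie one after the other, the
top of the stack, which is the first entry of the list, being the leftmost block. -/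
structure IsStack (χ : Fin ℓ → Fin N) (O : List (Finset (Fin ℓ) × Fin N)) : Prop where
  nonempty : ∀ p ∈ O, p.1.Nonempty
  color : ∀ p ∈ O, ∀ i ∈ p.1, χ i = p.2
  lt : O.Pairwise fun p q => ∀ i ∈ p.1, ∀ k ∈ q.1, i < k

theorem IsStack.tail {χ : Fin ℓ → Fin N} {p : Finset (Fin ℓ) × Fin N}
    {O : List (Finset (Fin ℓ) × Fin N)} (h : IsStack χ (p :: O)) : IsStack χ O :=
  ⟨fun q hq => h.nonempty q (List.mem_cons_of_mem _ hq),
    fun q hq => h.color q (List.mem_cons_of_mem _ hq), (List.pairwise_cons.1 h.lt).2⟩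

theorem IsStack.notMem {χ : Fin ℓ → Fin N} {p : Finset (Fin ℓ) × Fin N}
    {O : List (Finset (Fin ℓ) × Fin N)} (h : IsStack χ (p :: O)) : p ∉ O := fun hp => by
  obtain ⟨i, hi⟩ := h.nonempty p List.mem_cons_self
  exact lt_irrefl i ((List.pairwise_cons.1 h.lt).1 p hp i hi i hi)

variable (H : Fin N → PointedCorr B) {χ : Fin ℓ → Fin N}

/-- The vector in `H_c°` of an open block `{v₁ < ⋯ < vₘ}` of color `c`, namely `Q a_{v₁} Q ⋯ Q a_{vₘ} ξ`
with the projection `Q` of `H_c` onto `H_c°`. -/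
noncomputable def blockVec (a : ∀ i, (H (χ i)).toCorr.adj) (c : Fin N) (V : Finset (Fin ℓ)) :
    (H c).compl :=
  (H c).complProj ((H c).reducedVec (V.sort.map (asColor H χ a c)))

/-- The elementary tensor of the vectors of the open blocks and of a last factor `b` in `B`. -/
noncomputable def stackVec (a : ∀ i, (H (χ i)).toCorr.adj) (b : B) :
    (O : List (Finset (Fin ℓ) × Fin N)) → stringSpace H (O.map Prod.snd)
  | [] => b
  | p :: O => tmul (H p.2).compl (stringSpace H (O.map Prod.snd)) (blockVec H a p.2 p.1)
      (stackVec a b O)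

/-- How a coefficient `K ∈ B` to the left of a stack is absorbed: by the first operator of the top block,
or, if there are no open blocks, by the coefficient `b`. -/
noncomputable def absorb (K : B) (a : ∀ i, (H (χ i)).toCorr.adj) (b : B) :
    List (Finset (Fin ℓ) × Fin N) → (∀ i, (H (χ i)).toCorr.adj) × B
  | [] => (a, K * b)
  | p :: _ => if h : p.1.Nonempty then
      (Function.update a (p.1.min' h) ((H (χ (p.1.min' h))).toCorr.leftOp K * a (p.1.min' h)), b)
    else (a, b)

variable {H} {a a' : ∀ i, (H (χ i)).toCorr.adj}

theorem blockVec_congr {c : Fin N} {V : Finset (Fin ℓ)} (h : ∀ i ∈ V, a i = a' i) :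
    blockVec H a c V = blockVec H a' c V := by
  unfold blockVec
  rw [List.map_congr_left fun i hi => asColor_congr H (h i ((Finset.mem_sort _).1 hi)) c]

theorem complIncl_blockVec {c : Fin N} {V : Finset (Fin ℓ)} (hV : V.Nonempty) :
    (H c).complIncl (blockVec H a c V)
      = (H c).reducedVec (V.sort.map (asColor H χ a c)) := by
  rw [blockVec, sort_eq_min_cons (V.isLeast_min' hV), List.map_cons, PointedCorr.reducedVec,
    PointedCorr.complProj_complIncl]

theorem lact_complProj (E : PointedCorr B) (b : B) (x : E) :
    E.compl.lact b (E.complProj x) = E.complProj (E.lact b x) := by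
  refine Subtype.ext ?_
  change E.lact b (x - E.ract (op (E.ip E.vec x)) E.vec)
    = E.lact b x - E.ract (op (E.ip E.vec (E.lact b x))) E.vec
  rw [map_sub, E.lact_ract, E.central, E.expect_leftOp, op_mul, map_mul, Module.End.mul_apply]

theorem lact_blockVec {V : Finset (Fin ℓ)} {n : Fin ℓ} (hn : IsLeast (V : Set (Fin ℓ)) n)
    {c : Fin N} (hc : ∀ i ∈ V, χ i = c) {K : B} (h : a' n = (H (χ n)).toCorr.leftOp K * a n)
    (h' : ∀ i ∈ V, i ≠ n → a' i = a i) :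
    (H c).compl.lact K (blockVec H a c V) = blockVec H a' c V := by
  rw [blockVec, blockVec, sort_eq_min_cons hn, List.map_cons, List.map_cons,
    asColor_leftOp H h (hc n hn.1), PointedCorr.reducedVec, PointedCorr.reducedVec,
    PointedCorr.complProj_complIncl, PointedCorr.complProj_complIncl, lact_complProj]
  have h1 : (V.erase n).sort.map (asColor H χ a' c) = (V.erase n).sort.map (asColor H χ a c) := by
    refine List.map_congr_left fun i hi => asColor_congr H ?_ _
    rw [Finset.mem_sort, Finset.mem_erase] at hi
    exact h' i hi.2 hi.1
  rw [h1]
  rfl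

theorem stackVec_congr {b : B} {O : List (Finset (Fin ℓ) × Fin N)}
    (h : ∀ p ∈ O, ∀ i ∈ p.1, a i = a' i) : stackVec H a b O = stackVec H a' b O := by
  induction O with
  | nil => rfl
  | cons p O ih =>
    rw [stackVec, stackVec, ih fun q hq => h q (List.mem_cons_of_mem _ hq),
      blockVec_congr (h p List.mem_cons_self)]

theorem lact_stackVec {O : List (Finset (Fin ℓ) × Fin N)} (hO : IsStack χ O) (K b : B) :
    (stringSpace H (O.map Prod.snd)).lact K (stackVec H a b O)
      = stackVec H (absorb H K a b O).1 (absorb H K a b O).2 O := by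
  rcases O with - | ⟨p, O⟩
  · rfl
  · have hp := hO.nonempty p List.mem_cons_self
    have h1 : ∀ q ∈ O, ∀ i ∈ q.1, i ≠ p.1.min' hp := fun q hq i hi =>
      ((List.pairwise_cons.1 hO.lt).1 q hq _ (p.1.min'_mem hp) i hi).ne'
    refine (tensor_lact_tmul _ _ _ _ _).trans ?_
    rw [absorb, dif_pos hp, stackVec, lact_blockVec (p.1.isLeast_min' hp)
      (hO.color p List.mem_cons_self) (Function.update_self _ _ _)
      fun i _ h => Function.update_of_ne h _ _]
    exact congrArg _ (stackVec_congr fun q hq i hi => (Function.update_of_ne (h1 q hq i hi) _ _).symm)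

variable (H χ) in
/-- A term of the expansion of `λ(a_k) ⋯ λ(a_ℓ) ξ`: the closed blocks, the stack of open blocks, and the
operators and the coefficient that remain after the cumulants of the closed blocks are absorbed. -/
structure State where
  /-- The closed blocks. -/
  closed : Finset (Finset (Fin ℓ))
  /-- The open blocks with their colors. -/
  stack : List (Finset (Fin ℓ) × Fin N)
  /-- The operators, modified by the cumulants of closed blocks. -/
  ops : ∀ i, (H (χ i)).toCorr.adj
  /-- The coefficient in the last tensor factor `B`. -/
  coeff : B

namespace State

/-- The string of the colors of the open blocks. -/
def string (st : State H χ) : List (Fin N) := st.stack.map Prod.snd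

/-- The vector of a state, in the summand of the string of its open blocks. -/
noncomputable def vec (T : RootedSubtree N) (st : State H χ) (h : st.string ∈ T.strings) :
    (product T H).toCorr :=
  stringIncl T H h (stackVec H st.ops st.coeff st.stack)

/-- Add the block `V` to the closed blocks, with `O` as the remaining stack. -/
noncomputable def close (st : State H χ) (V : Finset (Fin ℓ)) (O : List (Finset (Fin ℓ) × Fin N)) :
    State H χ where
  closed := insert V st.closed
  stack := O
  ops := (absorb H (blockCumulant H χ st.ops V) st.ops st.coeff O).1
  coeff := (absorb H (blockCumulant H χ st.ops V) st.ops st.coeff O).2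

/-- Replace the stack by `O`. -/
def setStack (st : State H χ) (O : List (Finset (Fin ℓ) × Fin N)) : State H χ :=
  { st with stack := O }

/-- The states arising from `st` by the two terms of `λ(a_k)` that extend the open block on the top of the
stack, if its color is that of `k`: the new block is closed, or stays open. -/
noncomputable def extendTop (k : Fin ℓ) (st : State H χ) : List (State H χ) :=
  match st.stack with
  | [] => []
  | p :: O => if p.2 = χ k then
      [st.close (insert k p.1) O, st.setStack ((insert k p.1, p.2) :: O)] else []

open Classical in
/-- The states arising from `st` by `λ(a_k)`: the element `k` is added as a block of its own, closed or
open, if that is allowed by the tree, or it extends the block on the top of the stack. -/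
noncomputable def step (T : RootedSubtree N) (k : Fin ℓ) (st : State H χ) : List (State H χ) :=
  if χ k :: st.string ∈ T.strings then
    [st.close {k} st.stack, st.setStack (({k}, χ k) :: st.stack)]
  else st.extendTop k

open Classical in
/-- `st.vec`, with value `0` if the string of the open blocks is not a vertex of the tree. -/
noncomputable def vec' (T : RootedSubtree N) (st : State H χ) : (product T H).toCorr :=
  if h : st.string ∈ T.strings then st.vec T h else 0

theorem vec'_eq {T : RootedSubtree N} {st : State H χ} (h : st.string ∈ T.strings) :
    st.vec' T = st.vec T h := dif_pos h

theorem asColor_self (k : Fin ℓ) : asColor H χ a (χ k) k = a k := by simp [asColor]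

theorem lam_vec {T : RootedSubtree N} {k : Fin ℓ} {st : State H χ} (hT : st.string ∈ T.strings)
    (hO : IsStack χ st.stack) (hk : ∀ p ∈ st.stack, ∀ i ∈ p.1, k < i) :
    (lam T H (χ k) (st.ops k)).1 (st.vec' T) = ((st.step T k).map (vec' T)).sum := by
  rcases st with ⟨P, O, a, b⟩
  rw [vec'_eq hT, step]
  split_ifs with hks
  · have h1 : blockCumulant H χ a {k} = (H (χ k)).ip (H (χ k)).vec ((a k).1 (H (χ k)).vec) := by
      rw [blockCumulant_eq H (Finset.singleton_nonempty k) (c := χ k) (by simp), Finset.sort_singleton,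
        List.map_singleton, asColor_self, PointedCorr.boolCumulant_cons]
      rfl
    have h2 : blockVec H a (χ k) {k} = (H (χ k)).complProj ((a k).1 (H (χ k)).vec) := by
      rw [blockVec, Finset.sort_singleton, List.map_singleton, asColor_self,
        PointedCorr.reducedVec, PointedCorr.complProj_complIncl]
      rfl
    rw [List.map_cons, List.map_singleton, List.sum_cons, List.sum_singleton]
    refine (lam_apply_stringIncl T hks (a k) (stackVec H a b O)).trans ?_
    refine congrArg₂ (· + ·) ?_ ?_
    · refine Eq.trans ?_ (vec'_eq (T := T) (st := close ⟨P, O, a, b⟩ {k} O) hT).symm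
      refine congrArg (stringIncl T H hT) ?_
      rw [← h1]
      exact lact_stackVec hO _ b
    · refine Eq.trans ?_ (vec'_eq (T := T)
        (st := setStack ⟨P, O, a, b⟩ (({k}, χ k) :: O)) hks).symm
      refine congrArg (stringIncl T H hks) ?_
      rw [← h2]
      rfl
  · rcases O with - | ⟨⟨V, c⟩, O⟩
    · exact lam_apply_stringIncl_eq_zero T hT (by simp [string]) hks (a k) _
    · simp only [extendTop]
      split_ifs with hc
      · subst hc
        have hV : V.Nonempty := hO.nonempty _ List.mem_cons_self
        have hkV : ∀ i ∈ V, k < i := hk _ List.mem_cons_self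
        have hsort : (insert k V).sort = k :: V.sort :=
          V.sort_insert (r := (· ≤ ·)) (fun i hi => (hkV i hi).le) fun h => lt_irrefl _ (hkV k h)
        have h1 : blockCumulant H χ a (insert k V) = (H (χ k)).ip (H (χ k)).vec
            ((a k).1 ((H (χ k)).complIncl (blockVec H a (χ k) V))) := by
          rw [complIncl_blockVec hV, blockCumulant_eq H (Finset.insert_nonempty k V) (c := χ k) (by
            rintro i hi
            rcases Finset.mem_insert.1 hi with rfl | hi
            · rfl
            · exact hO.color _ List.mem_cons_self i hi), hsort, List.map_cons, asColor_self,
            PointedCorr.boolCumulant_cons]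
        have h2 : blockVec H a (χ k) (insert k V) = (H (χ k)).complProj
            ((a k).1 ((H (χ k)).complIncl (blockVec H a (χ k) V))) := by
          rw [complIncl_blockVec hV, blockVec, hsort, List.map_cons, asColor_self,
            PointedCorr.reducedVec, PointedCorr.complProj_complIncl]
        rw [List.map_cons, List.map_singleton, List.sum_cons, List.sum_singleton]
        refine (lam_apply_stringIncl_tmul T hT (a k) (blockVec H a (χ k) V)
          (stackVec H a b O)).trans ?_
        refine congrArg₂ (· + ·) ?_ ?_
        · refine Eq.trans ?_ (vec'_eq (T := T) (st := close ⟨P, (V, χ k) :: O, a, b⟩ (insert k V) O)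
            (T.tail_mem hT)).symm
          refine congrArg (stringIncl T H (T.tail_mem hT)) ?_
          rw [← h1]
          exact lact_stackVec hO.tail _ b
        · refine Eq.trans ?_ (vec'_eq (T := T)
            (st := setStack ⟨P, (V, χ k) :: O, a, b⟩ ((insert k V, χ k) :: O)) hT).symm
          refine congrArg (stringIncl T H hT) ?_
          rw [← h2]
          rfl
      · exact lam_apply_stringIncl_eq_zero T hT (by simpa [string] using hc) hks (a k) _

end State
end states

/-! ### The closed blocks of a state -/

section invariants
variable {ℓ N : ℕ} {H : Fin N → PointedCorr B} {χ : Fin ℓ → Fin N}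
  {a : ∀ i, (H (χ i)).toCorr.adj}

/-- The chain of a closed block `V`, with the open blocks that will surround it once they are closed:
`D` consists of `V` and of the closed blocks around it, and `E` of the open blocks with an element after
`V`; their colors form a vertex of the tree. -/
def HasChain (T : RootedSubtree N) (χ : Fin ℓ → Fin N) (P : Finset (Finset (Fin ℓ)))
    (O : List (Finset (Fin ℓ) × Fin N)) (V : Finset (Fin ℓ)) : Prop :=
  ∃ D E : List (Finset (Fin ℓ) × Fin N), IsNestingChain P V (D.map Prod.fst) ∧
    (∀ p ∈ D, ∀ i ∈ p.1, χ i = p.2) ∧ E <:+ O ∧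
    (∀ p ∈ O, p ∈ E ↔ ∃ w ∈ p.1, ∀ v ∈ V, v < w) ∧ (D ++ E).map Prod.snd ∈ T.strings

/-- The properties of the states in the expansion of `λ(a_i)_{i ∈ l} ξ`, for a final segment `l` of the
index set. The open blocks still grow to the left, so that a closed block may not reach across any of
their elements. The last property says that the modified operators and the coefficient carry exactly the
effect on `Λ` of the removal of the closed blocks, for all partitions that extend the state. -/
structure State.Valid (T : RootedSubtree N) (a : ∀ i, (H (χ i)).toCorr.adj) (l : List (Fin ℓ))
    (st : State H χ) : Prop where
  isStack : IsStack χ st.stack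
  string_mem : st.string ∈ T.strings
  isColoredNC : IsColoredNC χ st.closed
  mem_iff : ∀ i, i ∈ l ↔ (∃ V ∈ st.closed, i ∈ V) ∨ ∃ p ∈ st.stack, i ∈ p.1
  disjoint : ∀ V ∈ st.closed, ∀ p ∈ st.stack, ∀ x ∈ V, x ∉ p.1
  not_between : ∀ W ∈ st.closed, ∀ p ∈ st.stack, ∀ v ∈ p.1, ∀ w₁ ∈ W, ∀ w₂ ∈ W, w₁ < v → ¬ v < w₂
  ops : ∀ i, i ∉ l → st.ops i = a i
  chain : ∀ V ∈ st.closed, HasChain T χ st.closed st.stack V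
  Lam_eq : ∀ Q : Finset (Finset (Fin ℓ)), IsColoredNC χ Q → (∀ i, ∃ V ∈ Q, i ∈ V) → st.closed ⊆ Q →
    Lam H χ Q a = Lam H χ (Q \ st.closed) st.ops * st.coeff

namespace State
variable {T : RootedSubtree N} {l : List (Fin ℓ)} {st : State H χ} {k : Fin ℓ}

theorem Valid.mem_of_closed (h : st.Valid T a l) {V : Finset (Fin ℓ)} (hV : V ∈ st.closed)
    {i : Fin ℓ} (hi : i ∈ V) : i ∈ l := (h.mem_iff i).2 (.inl ⟨V, hV, hi⟩)

theorem Valid.mem_of_stack (h : st.Valid T a l) {p : Finset (Fin ℓ) × Fin N} (hp : p ∈ st.stack)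
    {i : Fin ℓ} (hi : i ∈ p.1) : i ∈ l := (h.mem_iff i).2 (.inr ⟨p, hp, hi⟩)

/-- Opening a new block preserves validity. -/
theorem Valid.openBlock (h : st.Valid T a l) (hk : ∀ i ∈ l, k < i)
    (hT : χ k :: st.string ∈ T.strings) :
    (st.setStack (({k}, χ k) :: st.stack)).Valid T a (k :: l) where
  isStack := by
    refine ⟨fun p hp => ?_, fun p hp i hi => ?_,
      List.pairwise_cons.2 ⟨fun p hp i hi m hm => ?_, h.isStack.lt⟩⟩
    · rcases List.mem_cons.1 hp with rfl | hp
      · exact Finset.singleton_nonempty k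
      · exact h.isStack.nonempty p hp
    · rcases List.mem_cons.1 hp with rfl | hp
      · rw [Finset.mem_singleton.1 hi]
      · exact h.isStack.color p hp i hi
    · rw [Finset.mem_singleton.1 hi]
      exact hk m (h.mem_of_stack hp hm)
  string_mem := hT
  isColoredNC := h.isColoredNC
  mem_iff i := by
    rw [List.mem_cons, h.mem_iff]
    simp only [setStack, List.exists_mem_cons_iff, Finset.mem_singleton, or_left_comm]
  disjoint V hV p hp x hx hxp := by
    rcases List.mem_cons.1 hp with rfl | hp
    · rw [Finset.mem_singleton.1 hxp] at hx
      exact lt_irrefl k (hk k (h.mem_of_closed hV hx))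
    · exact h.disjoint V hV p hp x hx hxp
  not_between W hW p hp v hv w₁ hw₁ w₂ hw₂ h₁ := by
    rcases List.mem_cons.1 hp with rfl | hp
    · rw [Finset.mem_singleton.1 hv] at h₁
      exact absurd (hk w₁ (h.mem_of_closed hW hw₁)) h₁.asymm
    · exact h.not_between W hW p hp v hv w₁ hw₁ w₂ hw₂ h₁
  ops i hi := h.ops i fun h => hi (List.mem_cons_of_mem _ h)
  chain V hV := by
    obtain ⟨D, E, h1, h2, h3, h4, h5⟩ := h.chain V hV
    refine ⟨D, E, h1, h2, h3.trans (List.suffix_cons _ _), fun p hp => ?_, h5⟩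
    rcases List.mem_cons.1 hp with rfl | hp
    · refine iff_of_false (fun hE => ?_) ?_
      · exact lt_irrefl k (hk k (h.mem_of_stack (h3.subset hE) (Finset.mem_singleton_self k)))
      · rintro ⟨w, hw, hVw⟩
        obtain ⟨v, hv⟩ := h.isColoredNC.nonempty V hV
        rw [Finset.mem_singleton.1 hw] at hVw
        exact lt_asymm (hVw v hv) (hk v (h.mem_of_closed hV hv))
    · exact h4 p hp
  Lam_eq := h.Lam_eq

/-- Adding a new element to the open block on the top of the stack preserves validity. -/
theorem Valid.extendBlock {V : Finset (Fin ℓ)} {c : Fin N} {O : List (Finset (Fin ℓ) × Fin N)}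
    (h : st.Valid T a l) (hst : st.stack = (V, c) :: O) (hk : ∀ i ∈ l, k < i) (hc : c = χ k) :
    (st.setStack ((insert k V, c) :: O)).Valid T a (k :: l) := by
  rcases st with ⟨P, O', a', b⟩
  obtain rfl : O' = (V, c) :: O := hst
  have hsub : ∀ p ∈ O, p ∈ (V, c) :: O := fun p => List.mem_cons_of_mem _
  refine ⟨⟨fun p hp => ?_, fun p hp i hi => ?_, List.pairwise_cons.2 ⟨fun p hp i hi m hm => ?_,
    h.isStack.tail.lt⟩⟩, h.string_mem, h.isColoredNC, fun i => ?_, fun W hW p hp x hx hxp => ?_,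
    fun W hW p hp v hv w₁ hw₁ w₂ hw₂ h₁ => ?_, fun i hi => h.ops i fun h => hi (List.mem_cons_of_mem _ h),
    fun W hW => ?_, h.Lam_eq⟩
  · rcases List.mem_cons.1 hp with rfl | hp
    · exact Finset.insert_nonempty k V
    · exact h.isStack.nonempty p (hsub p hp)
  · rcases List.mem_cons.1 hp with rfl | hp
    · rcases Finset.mem_insert.1 hi with rfl | hi
      · exact hc.symm
      · exact h.isStack.color _ List.mem_cons_self i hi
    · exact h.isStack.color p (hsub p hp) i hi
  · rcases Finset.mem_insert.1 hi with rfl | hi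
    · exact hk m (h.mem_of_stack (hsub p hp) hm)
    · exact (List.pairwise_cons.1 h.isStack.lt).1 p hp i hi m hm
  · rw [List.mem_cons, h.mem_iff]
    simp only [setStack, List.exists_mem_cons_iff, Finset.mem_insert, or_left_comm, or_assoc]
  · rcases List.mem_cons.1 hp with rfl | hp
    · rcases Finset.mem_insert.1 hxp with rfl | hxp
      · exact lt_irrefl _ (hk _ (h.mem_of_closed hW hx))
      · exact h.disjoint W hW _ List.mem_cons_self x hx hxp
    · exact h.disjoint W hW p (hsub p hp) x hx hxp
  · rcases List.mem_cons.1 hp with rfl | hp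
    · rcases Finset.mem_insert.1 hv with rfl | hv
      · exact absurd (hk w₁ (h.mem_of_closed hW hw₁)) h₁.asymm
      · exact h.not_between W hW _ List.mem_cons_self v hv w₁ hw₁ w₂ hw₂ h₁
    · exact h.not_between W hW p (hsub p hp) v hv w₁ hw₁ w₂ hw₂ h₁
  · obtain ⟨D, E, h1, h2, h3, h4, h5⟩ := h.chain W hW
    rcases List.suffix_cons_iff.1 h3 with rfl | h3
    · refine ⟨D, (insert k V, c) :: O, h1, h2, List.suffix_rfl, fun p hp => iff_of_true hp ?_, by
        simpa using h5⟩
      rcases List.mem_cons.1 hp with rfl | hp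
      · obtain ⟨w, hw, h6⟩ := (h4 _ List.mem_cons_self).1 List.mem_cons_self
        exact ⟨w, Finset.mem_insert_of_mem hw, h6⟩
      · exact (h4 p (hsub p hp)).1 (hsub p hp)
    · refine ⟨D, E, h1, h2, h3.trans (List.suffix_cons _ _), fun p hp => ?_, h5⟩
      rcases List.mem_cons.1 hp with rfl | hp
      · refine iff_of_false (fun hE => ?_) ?_
        · exact lt_irrefl k (hk k (h.mem_of_stack (hsub _ (h3.subset hE)) (Finset.mem_insert_self k V)))
        · rintro ⟨w, hw, hVw⟩
          rcases Finset.mem_insert.1 hw with rfl | hw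
          · obtain ⟨v, hv⟩ := h.isColoredNC.nonempty W hW
            exact lt_asymm (hVw v hv) (hk v (h.mem_of_closed hW hv))
          · exact h.isStack.notMem (h3.subset ((h4 _ List.mem_cons_self).2 ⟨w, hw, hVw⟩))
      · exact h4 p (hsub p hp)

/-- Closing the block on the top of the stack preserves validity, if it contains the first element. -/
theorem Valid.closeBlock {V : Finset (Fin ℓ)} {c : Fin N} {O : List (Finset (Fin ℓ) × Fin N)}
    (h : st.Valid T a l) (hst : st.stack = (V, c) :: O) (hl : ∀ i, i ∈ l ↔ k ≤ i) (hkV : k ∈ V) :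
    (st.close V O).Valid T a l := by
  rcases st with ⟨P, O', a', b⟩
  obtain rfl : O' = (V, c) :: O := hst
  have hsub : ∀ p ∈ O, p ∈ (V, c) :: O := fun p => List.mem_cons_of_mem _
  have hdisj : ∀ W ∈ P, ∀ x ∈ W, x ∉ V := fun W hW => h.disjoint W hW _ List.mem_cons_self
  have hVO : ∀ p ∈ O, ∀ i ∈ V, ∀ m ∈ p.1, i < m := (List.pairwise_cons.1 h.isStack.lt).1
  have hVP : V ∉ P := fun hV => hdisj V hV k hkV hkV
  have hkP : ∀ W ∈ P, ∀ w ∈ W, k < w := fun W hW w hw =>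
    lt_of_le_of_ne ((hl w).1 (h.mem_of_closed hW hw)) fun hkw => hdisj W hW w hw (hkw ▸ hkV)
  have hkl : ∀ i ∈ V, k ≤ i := fun i hi => (hl i).1 (h.mem_of_stack List.mem_cons_self hi)
  have hVc : ∀ i ∈ V, χ i = c := h.isStack.color _ List.mem_cons_self
  refine ⟨h.isStack.tail, T.tail_mem h.string_mem, ⟨fun W hW => ?_, fun W hW W' hW' x hx hx' => ?_,
    fun W hW W' hW' i₁ hi₁ i₂ hi₂ j₁ hj₁ j₂ hj₂ h₁ h₂ h₃ => ?_, fun W hW i hi m hm => ?_⟩,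
    fun i => ?_, fun W hW p hp x hx hxp => ?_, fun W hW p hp v hv w₁ hw₁ w₂ hw₂ h₁ h₂ => ?_,
    fun i hi => ?_, fun W hW => ?_, fun Q hQ hcov hsubQ => ?_⟩
  · rcases Finset.mem_insert.1 hW with rfl | hW
    · exact ⟨k, hkV⟩
    · exact h.isColoredNC.nonempty W hW
  · rcases Finset.mem_insert.1 hW with rfl | hW <;> rcases Finset.mem_insert.1 hW' with rfl | hW'
    · rfl
    · exact absurd hx (hdisj W' hW' x hx')
    · exact absurd hx' (hdisj W hW x hx)
    · exact h.isColoredNC.eq_of_mem W hW W' hW' x hx hx'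
  · rcases Finset.mem_insert.1 hW with rfl | hW <;> rcases Finset.mem_insert.1 hW' with rfl | hW'
    · rfl
    · exact absurd h₃ (h.not_between W' hW' _ List.mem_cons_self i₂ hi₂ j₁ hj₁ j₂ hj₂ h₂)
    · exact absurd h₂ (h.not_between W hW _ List.mem_cons_self j₁ hj₁ i₁ hi₁ i₂ hi₂ h₁)
    · exact h.isColoredNC.nonCrossing W hW W' hW' i₁ hi₁ i₂ hi₂ j₁ hj₁ j₂ hj₂ h₁ h₂ h₃
  · rcases Finset.mem_insert.1 hW with rfl | hW
    · rw [hVc i hi, hVc m hm]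
    · exact h.isColoredNC.color W hW i hi m hm
  · simp only [h.mem_iff i, State.close, Finset.exists_mem_insert, List.exists_mem_cons_iff,
      or_left_comm, or_assoc]
  · rcases Finset.mem_insert.1 hW with rfl | hW
    · exact lt_irrefl x (hVO p hp x hx x hxp)
    · exact h.disjoint W hW p (hsub p hp) x hx hxp
  · rcases Finset.mem_insert.1 hW with rfl | hW
    · exact lt_asymm h₂ (hVO p hp w₂ hw₂ v hv)
    · exact h.not_between W hW p (hsub p hp) v hv w₁ hw₁ w₂ hw₂ h₁ h₂
  · refine Eq.trans ?_ (h.ops i hi)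
    rcases O with - | ⟨p, O⟩
    · rfl
    · have hp := h.isStack.nonempty p (hsub p List.mem_cons_self)
      simp only [State.close, absorb, dif_pos hp]
      refine Function.update_of_ne (fun hip => hi ?_) _ _
      rw [hip]
      exact h.mem_of_stack (hsub p List.mem_cons_self) (p.1.min'_mem hp)
  · rcases Finset.mem_insert.1 hW with rfl | hW
    · -- Nothing lies before `k`, so that the new block is not nested inside a closed one.
      refine ⟨[(W, c)], O, ⟨by simp, fun W' => ?_⟩, by simpa using hVc, List.suffix_rfl,
        fun p hp => iff_of_true hp ?_, h.string_mem⟩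
      · simp only [List.map_cons, List.map_nil, List.mem_singleton, State.close]
        refine ⟨fun h => ⟨by rw [h]; exact Finset.mem_insert_self _ _, .inl h⟩, ?_⟩
        rintro ⟨hW', h | ⟨j, hj, _, _, h'⟩⟩
        · exact h
        · rcases Finset.mem_insert.1 hW' with rfl | hW'
          · rfl
          · exact absurd (hkP W' hW' j hj) (h' k hkV).1.asymm
      · obtain ⟨w, hw⟩ := h.isStack.nonempty p (hsub p hp)
        exact ⟨w, hw, fun v hv => hVO p hp v hv w hw⟩
    · obtain ⟨D, E, ⟨h1, h1'⟩, h2, h3, h4, h5⟩ := h.chain W hW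
      obtain ⟨w₀, hw₀⟩ := h.isColoredNC.nonempty W hW
      rcases List.suffix_cons_iff.1 h3 with rfl | h3
      · -- The new block surrounds `W`: it moves from the open to the closed part of the chain.
        obtain ⟨v, hv, hWv⟩ := (h4 _ List.mem_cons_self).1 List.mem_cons_self
        refine ⟨D ++ [(V, c)], O, ⟨?_, fun W' => ?_⟩, fun p hp => ?_, List.suffix_rfl,
          fun p hp => iff_of_true hp ((h4 p (hsub p hp)).1 (hsub p hp)), by simpa using h5⟩
        · rw [List.map_append, List.pairwise_append]
          refine ⟨h1, by simp, fun W' hW' V' hV' => ?_⟩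
          obtain rfl : V' = V := by simpa using hV'
          obtain ⟨hW'P, h6⟩ := (h1' W').1 hW'
          refine ⟨k, hkV, v, hv, fun i hi => ⟨hkP W' hW'P i hi, ?_⟩⟩
          rcases h6 with rfl | ⟨j, hj, _, _, h6⟩
          · exact hWv i hi
          · refine lt_of_le_of_ne (not_lt.1 (h.not_between W' hW'P _ List.mem_cons_self v hv j hj i hi
              ((h6 w₀ hw₀).1.trans (hWv w₀ hw₀)))) ?_
            rintro rfl
            exact hdisj W' hW'P _ hi hv
        · simp only [List.map_append, List.mem_append, h1', List.map_cons, List.map_nil,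
            List.mem_singleton, State.close, Finset.mem_insert]
          refine ⟨?_, ?_⟩
          · rintro (⟨h6, h7⟩ | rfl)
            · exact ⟨.inr h6, h7⟩
            · exact ⟨.inl rfl, .inr ⟨k, hkV, v, hv, fun i hi => ⟨hkP W hW i hi, hWv i hi⟩⟩⟩
          · rintro ⟨rfl | h6, h7⟩
            · exact .inr rfl
            · exact .inl ⟨h6, h7⟩
        · rcases List.mem_append.1 hp with hp | hp
          · exact h2 p hp
          · obtain rfl := List.mem_singleton.1 hp
            exact hVc
      · have hnot : ¬ ∃ w ∈ V, ∀ v ∈ W, v < w := fun hw =>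
          h.isStack.notMem (h3.subset ((h4 _ List.mem_cons_self).2 hw))
        refine ⟨D, E, ⟨h1, fun W' => (h1' W').trans ?_⟩, h2, h3, fun p hp => h4 p (hsub p hp), h5⟩
        refine ⟨fun ⟨h6, h7⟩ => ⟨Finset.mem_insert_of_mem h6, h7⟩, fun ⟨h6, h7⟩ => ⟨?_, h7⟩⟩
        rcases Finset.mem_insert.1 h6 with rfl | h6
        · rcases h7 with rfl | ⟨_, _, m, hm, h7⟩
          · exact hW
          · exact absurd ⟨m, hm, fun v hv => (h7 v hv).2⟩ hnot
        · exact h6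
  · have hsubQ' : P ⊆ Q := (Finset.subset_insert _ _).trans hsubQ
    have hVQ : V ∈ Q \ P := Finset.mem_sdiff.2 ⟨hsubQ (Finset.mem_insert_self _ _), hVP⟩
    have hcases : ∀ x, k ≤ x → (∃ U ∈ Q \ P, x ∈ U) → x ∈ V ∨ ∃ p ∈ O, x ∈ p.1 := by
      rintro x hx ⟨U, hU, hxU⟩
      rcases (h.mem_iff x).1 ((hl x).2 hx) with ⟨U', hU', hxU'⟩ | ⟨p, hp, hxp⟩
      · obtain ⟨hU1, hU2⟩ := Finset.mem_sdiff.1 hU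
        exact absurd (hQ.eq_of_mem U hU1 U' (hsubQ' hU') x hxU hxU' ▸ hU') hU2
      · rcases List.mem_cons.1 hp with rfl | hp
        · exact .inl hxp
        · exact .inr ⟨p, hp, hxp⟩
    have hint : IsIntervalBlock (Q \ P) V := by
      refine ⟨hVQ, fun i hi m hm x hx hix hxm => ?_⟩
      rcases hcases x ((hkl i hi).trans hix) (mem_sup_id.1 hx) with hx | ⟨p, hp, hx⟩
      · exact hx
      · exact absurd (hVO p hp m hm x hx) hxm.not_gt
    have hsd : Q \ insert V P = (Q \ P).erase V := by
      ext U
      simp only [Finset.mem_sdiff, Finset.mem_insert, Finset.mem_erase, not_or]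
      tauto
    have hlater : ∀ x ∈ laterElements (Q \ P) V, ∃ p ∈ O, x ∈ p.1 := fun x hx => by
      obtain ⟨h1, h2⟩ := mem_laterElements.1 hx
      exact (hcases x (h2 k hkV).le h1).resolve_left fun hxV => lt_irrefl x (h2 x hxV)
    rw [h.Lam_eq Q hQ hcov hsubQ', (hQ.mono Finset.sdiff_subset).Lam_eq H hint]
    simp only [State.close, hsd]
    rcases O with - | ⟨p, O⟩
    · rw [removal_of_empty H (Finset.eq_empty_of_forall_notMem fun x hx => by
        simpa using hlater x hx), absorb, mul_assoc]
    · have hp := h.isStack.nonempty p (hsub p List.mem_cons_self)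
      rw [removal_of_isLeast H (n := p.1.min' hp), mul_one, absorb, dif_pos hp]
      refine ⟨mem_laterElements.2 ⟨?_, fun i hi =>
        hVO p List.mem_cons_self i hi _ (p.1.min'_mem hp)⟩, fun x hx => ?_⟩
      · obtain ⟨U, hU, hxU⟩ := hcov (p.1.min' hp)
        exact ⟨U, Finset.mem_sdiff.2 ⟨hU, fun hUP => h.disjoint U hUP p (hsub p List.mem_cons_self)
          _ hxU (p.1.min'_mem hp)⟩, hxU⟩
      · obtain ⟨q, hq, hxq⟩ := hlater x hx
        rcases List.mem_cons.1 hq with rfl | hq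
        · exact Finset.min'_le _ _ hxq
        · exact ((List.pairwise_cons.1 h.isStack.tail.lt).1 q hq _ (p.1.min'_mem hp) x hxq).le

/-- The states in the expansion of `λ(a_i)_{i ∈ l} ξ`. -/
noncomputable def run (T : RootedSubtree N) (a : ∀ i, (H (χ i)).toCorr.adj) :
    List (Fin ℓ) → List (State H χ)
  | [] => [⟨∅, [], a, 1⟩]
  | k :: l => (run T a l).flatMap (step T k)

theorem valid_nil : (⟨∅, [], a, 1⟩ : State H χ).Valid T a [] where
  isStack := ⟨by simp, by simp, List.Pairwise.nil⟩
  string_mem := T.nil_mem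
  isColoredNC := ⟨by simp, by simp, by simp [NonCrossing], by simp [ColorCompatible]⟩
  mem_iff := by simp
  disjoint := by simp
  not_between := by simp
  ops _ _ := rfl
  chain := by simp
  Lam_eq Q _ _ _ := by simp

theorem mem_step_iff {st' : State H χ} :
    st' ∈ st.step T k ↔
      (χ k :: st.string ∈ T.strings ∧
        (st' = st.close {k} st.stack ∨ st' = st.setStack (({k}, χ k) :: st.stack))) ∨
      ∃ V O, st.stack = (V, χ k) :: O ∧ (st' = st.close (insert k V) O ∨
        st' = st.setStack ((insert k V, χ k) :: O)) := by
  rw [step]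
  split_ifs with hk
  · simp only [List.mem_cons, List.not_mem_nil, or_false, hk, true_and]
    refine ⟨.inl, fun h' => h'.resolve_right ?_⟩
    rintro ⟨V, O, hst, -⟩
    have := T.alternating hk
    rw [string, hst] at this
    simp at this
  · simp only [hk, false_and, false_or, extendTop]
    rcases hO : st.stack with - | ⟨⟨V, c⟩, O⟩
    · simp
    · by_cases hc : c = χ k
      · subst hc
        simp
      · simp [hc]

theorem Valid.step {st' : State H χ} (h : st.Valid T a l) (hk : ∀ i, i ∈ l ↔ k < i)
    (h' : st' ∈ st.step T k) : st'.Valid T a (k :: l) := by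
  have hk' : ∀ i, i ∈ k :: l ↔ k ≤ i := fun i => by
    rw [List.mem_cons, hk, le_iff_eq_or_lt, eq_comm]
  rcases mem_step_iff.1 h' with ⟨hT, rfl | rfl⟩ | ⟨V, O, hst, rfl | rfl⟩
  · exact (h.openBlock (fun i => (hk i).1) hT).closeBlock rfl hk' (Finset.mem_singleton_self k)
  · exact h.openBlock (fun i => (hk i).1) hT
  · exact (h.extendBlock hst (fun i => (hk i).1) rfl).closeBlock rfl hk' (Finset.mem_insert_self k V)
  · exact h.extendBlock hst (fun i => (hk i).1) rfl

end State
end invariants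

/-! ### Every partition in `NC(χ, T)` is reached exactly once -/

section bijection
variable {ℓ N : ℕ} {H : Fin N → PointedCorr B} {χ : Fin ℓ → Fin N}
  {a : ∀ i, (H (χ i)).toCorr.adj} {T : RootedSubtree N} {l : List (Fin ℓ)} {k : Fin ℓ}

/-- `l` lists a final segment of the index set in increasing order. -/
def IsFinalSegment (l : List (Fin ℓ)) : Prop :=
  l.Pairwise (· < ·) ∧ ∀ x ∈ l, ∀ y, x < y → y ∈ l

theorem isFinalSegment_finRange : IsFinalSegment (List.finRange ℓ) :=
  ⟨List.pairwise_lt_finRange ℓ, fun _ _ y _ => List.mem_finRange y⟩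

theorem IsFinalSegment.mem_iff (h : IsFinalSegment (k :: l)) (i : Fin ℓ) : i ∈ l ↔ k < i := by
  refine ⟨(List.pairwise_cons.1 h.1).1 i, fun hki => ?_⟩
  rcases List.mem_cons.1 (h.2 k List.mem_cons_self i hki) with rfl | hi
  · exact absurd hki (lt_irrefl _)
  · exact hi

theorem IsFinalSegment.tail (h : IsFinalSegment (k :: l)) : IsFinalSegment l :=
  ⟨(List.pairwise_cons.1 h.1).2, fun x hx y hxy =>
    (h.mem_iff y).2 (((h.mem_iff x).1 hx).trans hxy)⟩

theorem IsFinalSegment.notMem (h : IsFinalSegment (k :: l)) : k ∉ l := fun hk =>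
  lt_irrefl k ((h.mem_iff k).1 hk)

theorem State.valid_of_mem_run (hl : IsFinalSegment l) {st : State H χ} (h : st ∈ State.run T a l) :
    st.Valid T a l := by
  induction l generalizing st with
  | nil =>
    rw [run, List.mem_singleton] at h
    rw [h]
    exact valid_nil
  | cons k l ih =>
    obtain ⟨st₀, h0, h1⟩ := List.mem_flatMap.1 h
    exact (ih hl.tail h0).step hl.mem_iff h1

namespace State

/-- The closed blocks and the stack of the state from which a state with closed blocks `P` and stack `O`
arises by the addition of `k`: remove `k` from its block, which returns to the stack if it was closed. -/
noncomputable def undo (χ : Fin ℓ → Fin N) (k : Fin ℓ)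
    (x : Finset (Finset (Fin ℓ)) × List (Finset (Fin ℓ) × Fin N)) :
    Finset (Finset (Fin ℓ)) × List (Finset (Fin ℓ) × Fin N) :=
  (x.1.filter (k ∉ ·),
    if (x.1.filter (k ∈ ·)).sup id = ∅ then
      match x.2 with
      | [] => []
      | p :: O => if p.1 = {k} then O else (p.1.erase k, p.2) :: O
    else if (x.1.filter (k ∈ ·)).sup id = {k} then x.2
    else (((x.1.filter (k ∈ ·)).sup id).erase k, χ k) :: x.2)

theorem Valid.undo_step {st st' : State H χ} (h : st.Valid T a l) (hk : k ∉ l)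
    (h' : st' ∈ st.step T k) :
    undo χ k (st'.closed, st'.stack) = (st.closed, st.stack) := by
  have hkP : ∀ W ∈ st.closed, k ∉ W := fun W hW hkW => hk (h.mem_of_closed hW hkW)
  have h1 : st.closed.filter (k ∉ ·) = st.closed := Finset.filter_true_of_mem hkP
  have h2 : st.closed.filter (k ∈ ·) = ∅ := Finset.filter_false_of_mem hkP
  rcases mem_step_iff.1 h' with ⟨hT, rfl | rfl⟩ | ⟨V, O, hst, h3⟩
  · simp [undo, State.close, Finset.filter_insert, h1, h2]
  · simp [undo, setStack, h1, h2]
  · have hkV : k ∉ V := fun hkV =>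
      hk (h.mem_of_stack (p := (V, χ k)) (by rw [hst]; exact List.mem_cons_self) hkV)
    have hV : V.Nonempty := h.isStack.nonempty (V, χ k) (by rw [hst]; exact List.mem_cons_self)
    have hne : insert k V ≠ {k} := fun hV' => by
      obtain ⟨v, hv⟩ := hV
      have := hV' ▸ Finset.mem_insert_of_mem hv
      rw [Finset.mem_singleton] at this
      exact hkV (this ▸ hv)
    rcases h3 with rfl | rfl
    · simp [undo, State.close, Finset.filter_insert, h1, h2, hne, hst, Finset.erase_insert hkV]
    · simp [undo, setStack, h1, h2, hne, hst, Finset.erase_insert hkV]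

theorem nodup_map_step {st : State H χ} :
    ((st.step T k).map fun st => (st.closed, st.stack)).Nodup := by
  rw [step]
  split_ifs
  · simp [State.close, setStack]
  · rw [extendTop]
    rcases st.stack with - | ⟨p, O⟩
    · simp
    · dsimp only
      split_ifs
      · simp [State.close, setStack]
      · simp

/-- No family of closed and open blocks occurs twice in the expansion. -/
theorem nodup_map_run (hl : IsFinalSegment l) :
    ((run T a l).map fun st => (st.closed, st.stack)).Nodup := by
  induction l with
  | nil => simp [run]
  | cons k l ih =>
    rw [run, List.map_flatMap, List.nodup_flatMap]
    refine ⟨fun st _ => nodup_map_step, ?_⟩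
    refine (List.pairwise_map.1 (ih hl.tail)).imp_of_mem fun {st₁ st₂} h₁ h₂ hne => ?_
    refine List.disjoint_left.2 fun x hx₁ hx₂ => hne ?_
    obtain ⟨s₁, hs₁, rfl⟩ := List.mem_map.1 hx₁
    obtain ⟨s₂, hs₂, he⟩ := List.mem_map.1 hx₂
    rw [← (valid_of_mem_run hl.tail h₁).undo_step hl.notMem hs₁,
      ← (valid_of_mem_run hl.tail h₂).undo_step hl.notMem hs₂, ← he]

end State

theorem Nested.irrefl (V : Finset (Fin ℓ)) : ¬ Nested V V := fun ⟨j, hj, _, _, h⟩ =>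
  lt_irrefl j (h j hj).1

theorem Nested.asymm {V W : Finset (Fin ℓ)} (h : Nested V W) : ¬ Nested W V := by
  rintro ⟨j', hj', _, _, h'⟩
  obtain ⟨j, hj, _, _, h⟩ := h
  exact lt_asymm (h j' hj').1 (h' j hj).1

/-- A chain of blocks is determined by its set of members. -/
theorem eq_of_pairwise_nested {C C' : List (Finset (Fin ℓ))} (hC : C.Pairwise Nested)
    (hC' : C'.Pairwise Nested) (h : ∀ W, W ∈ C ↔ W ∈ C') : C = C' := by
  have hne : ∀ {V W : Finset (Fin ℓ)}, Nested V W → V ≠ W := fun h h' =>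
    Nested.irrefl _ (h' ▸ h)
  refine ((List.perm_ext_iff_of_nodup (hC.imp hne) (hC'.imp hne)).2 h).eq_of_pairwise
    (fun V W _ _ h h' => absurd h' h.asymm) hC hC'

/-- `W` has elements in `l` and elements outside of `l`. -/
def Straddles (l : List (Fin ℓ)) (W : Finset (Fin ℓ)) : Prop := (∃ x ∈ W, x ∈ l) ∧ ∃ x ∈ W, x ∉ l

/-- The state `st` is the trace on `l` of the partition with the blocks `Q`: the closed blocks are the
blocks contained in `l`, and the stack consists of the intersections with `l` of the blocks that
straddle `l`, ordered by nesting. -/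
def State.IsTrace (Q : Finset (Finset (Fin ℓ))) (l : List (Fin ℓ)) (st : State H χ) : Prop :=
  (∀ V, V ∈ st.closed ↔ V ∈ Q ∧ ∀ i ∈ V, i ∈ l) ∧
  ∃ C : List (Finset (Fin ℓ)), C.Pairwise Nested ∧ (∀ W, W ∈ C ↔ W ∈ Q ∧ Straddles l W) ∧
    C.Forall₂ (fun W p => (∀ i, i ∈ p.1 ↔ i ∈ W ∧ i ∈ l) ∧ ∀ i ∈ W, χ i = p.2) st.stack

theorem colors_eq_of_forall₂ {C : List (Finset (Fin ℓ))} {O : List (Finset (Fin ℓ) × Fin N)}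
    {s : List (Fin N)} (hC : ∀ W ∈ C, W.Nonempty) (hs : C.Forall₂ (fun W c => ∀ i ∈ W, χ i = c) s)
    (hO : C.Forall₂ (fun W p => (∀ i, i ∈ p.1 ↔ i ∈ W ∧ i ∈ l) ∧ ∀ i ∈ W, χ i = p.2) O) :
    s = O.map Prod.snd := by
  induction hs generalizing O with
  | nil => cases hO; rfl
  | cons h1 _ ih =>
    obtain _ | ⟨h2, h3⟩ := hO
    obtain ⟨i, hi⟩ := hC _ List.mem_cons_self
    rw [List.map_cons, ← ih (fun W hW => hC W (List.mem_cons_of_mem _ hW)) h3, ← h1 i hi, h2.2 i hi]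

/-- The trace on a final segment of a partition in `NC(χ, T)` occurs in the expansion. -/
theorem exists_trace_mem_run {Q : Finset (Finset (Fin ℓ))} (hQ : IsColoredNC χ Q)
    (hcov : ∀ i, ∃ V ∈ Q, i ∈ V) (hT : TreeCompatible T χ Q) (hl : IsFinalSegment l) :
    ∃ st ∈ State.run T a l, st.IsTrace Q l := by
  induction l with
  | nil =>
    refine ⟨_, List.mem_singleton_self _, fun V => ?_, [], List.Pairwise.nil, fun W => ?_,
      List.Forall₂.nil⟩
    · refine iff_of_false (Finset.notMem_empty V) fun ⟨hV, h⟩ => ?_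
      obtain ⟨i, hi⟩ := hQ.nonempty V hV
      exact List.not_mem_nil (h i hi)
    · simp [Straddles]
  | cons k l ih =>
    obtain ⟨st, hrun, hclosed, C, hC, hmem, hstack⟩ := ih hl.tail
    have hkl := hl.notMem
    have hle : ∀ i, i ∉ l → i ≤ k := fun i hi => not_lt.1 fun h => hi ((hl.mem_iff i).2 h)
    have hnext : ∀ st' ∈ st.step T k, st' ∈ State.run T a (k :: l) := fun st' h' =>
      List.mem_flatMap.2 ⟨st, hrun, h'⟩
    obtain ⟨V, hV, hkV⟩ := hcov k
    -- The blocks other than `V` do not notice the passage from `l` to `k :: l`.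
    have hk_notMem : ∀ W ∈ Q, W ≠ V → k ∉ W := fun W hW hne hkW =>
      hne (hQ.eq_of_mem W hW V hV k hkW hkV)
    have hmem_cons : ∀ W ∈ Q, W ≠ V → ∀ i ∈ W, i ∈ k :: l ↔ i ∈ l := fun W hW hne i hi => by
      rw [List.mem_cons, or_iff_right]
      rintro rfl
      exact hk_notMem W hW hne hi
    have hstr : ∀ W ∈ Q, W ≠ V → (Straddles (k :: l) W ↔ Straddles l W) := fun W hW hne => by
      refine and_congr ?_ ?_
      · exact exists_congr fun i => and_congr_right fun hi => hmem_cons W hW hne i hi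
      · exact exists_congr fun i => and_congr_right fun hi => not_congr (hmem_cons W hW hne i hi)
    have hstack' : V ∉ C → C.Forall₂ (fun W p => (∀ i, i ∈ p.1 ↔ i ∈ W ∧ i ∈ k :: l) ∧
        ∀ i ∈ W, χ i = p.2) st.stack := fun hVC => by
      refine (List.forall₂_iff_get.1 hstack).elim fun hlen h => List.forall₂_iff_get.2 ⟨hlen, ?_⟩
      intro i hi hi'
      obtain ⟨h1, h2⟩ := h i hi hi'
      have hWC : C.get ⟨i, hi⟩ ∈ C := List.get_mem C ⟨i, hi⟩
      refine ⟨fun x => (h1 x).trans (and_congr_right fun hx => ?_), h2⟩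
      exact (hmem_cons _ ((hmem _).1 hWC).1 (fun h => hVC (h ▸ hWC)) x hx).symm
    by_cases hA : ∃ x ∈ V, x ∈ l
    · -- `k` is not the last element of `V`: this block is on the top of the stack.
      have hVC : V ∈ C := (hmem V).2 ⟨hV, hA, k, hkV, hkl⟩
      obtain ⟨C', rfl⟩ : ∃ C', C = V :: C' := by
        rcases C with - | ⟨W, C'⟩
        · simp at hVC
        · rcases List.mem_cons.1 hVC with rfl | hVC'
          · exact ⟨C', rfl⟩
          · obtain ⟨v₁, hv₁, v₂, hv₂, h⟩ := (List.pairwise_cons.1 hC).1 V hVC'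
            obtain ⟨hW, ⟨x, hx, hxl⟩, y, hy, hyl⟩ := (hmem W).1 List.mem_cons_self
            by_cases hWV : W = V
            · exact ⟨C', by rw [hWV]⟩
            · have hyk : y < k := lt_of_le_of_ne (hle y hyl) fun h =>
                hk_notMem W hW hWV (h ▸ hy)
              exact absurd (hQ.nonCrossing W hW V hV y hy x hx k hkV v₂ hv₂ hyk
                ((hl.mem_iff x).1 hxl) (h x hx).2) hWV
      have hVC' : V ∉ C' := fun h => Nested.irrefl V ((List.pairwise_cons.1 hC).1 V h)
      have hC'V : ∀ W ∈ C', W ≠ V := fun W hW h => hVC' (h ▸ hW)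
      rcases hO : st.stack with - | ⟨⟨V', c⟩, O⟩
      · rw [hO] at hstack; cases hstack
      rw [hO] at hstack
      obtain _ | ⟨⟨h1, h2⟩, h3⟩ := hstack
      obtain rfl : χ k = c := h2 k hkV
      have hins : ∀ i, i ∈ insert k V' ↔ i ∈ V ∧ i ∈ k :: l := fun i => by
        rw [Finset.mem_insert, h1, List.mem_cons]
        constructor
        · rintro (rfl | ⟨hi, hil⟩)
          · exact ⟨hkV, .inl rfl⟩
          · exact ⟨hi, .inr hil⟩
        · rintro ⟨hi, rfl | hil⟩
          · exact .inl rfl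
          · exact .inr ⟨hi, hil⟩
      have h3' : C'.Forall₂ (fun W p => (∀ i, i ∈ p.1 ↔ i ∈ W ∧ i ∈ k :: l) ∧
          ∀ i ∈ W, χ i = p.2) O := by
        refine (List.forall₂_iff_get.1 h3).elim fun hlen h => List.forall₂_iff_get.2 ⟨hlen, ?_⟩
        intro i hi hi'
        obtain ⟨h4, h5⟩ := h i hi hi'
        have hWC : C'.get ⟨i, hi⟩ ∈ C' := List.get_mem C' ⟨i, hi⟩
        refine ⟨fun x => (h4 x).trans (and_congr_right fun hx => ?_), h5⟩
        exact (hmem_cons _ ((hmem _).1 (List.mem_cons_of_mem _ hWC)).1 (hC'V _ hWC) x hx).symm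
      by_cases hB : ∃ x ∈ V, x ∉ k :: l
      · refine ⟨_, hnext _ (State.mem_step_iff.2 (.inr ⟨V', O, hO, .inr rfl⟩)), fun W => ?_, V :: C', hC,
          fun W => ?_, .cons ⟨hins, h2⟩ h3'⟩
        · refine (hclosed W).trans (and_congr_right fun hW => ?_)
          by_cases hWV : W = V
          · subst hWV
            obtain ⟨x, hx, hxl⟩ := hB
            exact iff_of_false (fun h => hkl (h k hkV)) fun h => hxl (h x hx)
          · exact forall₂_congr fun i hi => (hmem_cons W hW hWV i hi).symm
        · refine (hmem W).trans (and_congr_right fun hW => ?_)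
          by_cases hWV : W = V
          · subst hWV
            exact iff_of_true ⟨hA, k, hkV, hkl⟩ ⟨⟨k, hkV, List.mem_cons_self⟩, hB⟩
          · exact (hstr W hW hWV).symm
      · push Not at hB
        have hVeq : insert k V' = V := by
          ext i
          rw [hins]
          exact and_iff_left_of_imp (hB i)
        refine ⟨_, hnext _ (State.mem_step_iff.2 (.inr ⟨V', O, hO, .inl rfl⟩)), fun W => ?_, C',
          (List.pairwise_cons.1 hC).2, fun W => ?_, h3'⟩
        · rw [hVeq, State.close, Finset.mem_insert, hclosed]
          by_cases hWV : W = V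
          · subst hWV
            exact iff_of_true (.inl rfl) ⟨hV, hB⟩
          · rw [or_iff_right hWV]
            exact and_congr_right fun hW => forall₂_congr fun i hi => (hmem_cons W hW hWV i hi).symm
        · by_cases hWV : W = V
          · subst hWV
            exact iff_of_false hVC' fun ⟨_, _, x, hx, hxl⟩ => hxl (hB x hx)
          · have h4 := hmem W
            rw [List.mem_cons, or_iff_right hWV] at h4
            exact h4.trans (and_congr_right fun hW => (hstr W hW hWV).symm)
    · -- `k` is the last element of `V`: the chain of `V` consists of `V` and the straddling blocks.
      have hVk : ∀ i ∈ V, i ≤ k := fun i hi => hle i fun hil => hA ⟨i, hi, hil⟩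
      have hVC : V ∉ C := fun h => hA ((hmem V).1 h).2.1
      have hnest : ∀ W, W ∈ C ↔ W ∈ Q ∧ Nested V W := fun W => by
        refine (hmem W).trans (and_congr_right fun hW => ?_)
        constructor
        · rintro ⟨⟨x, hx, hxl⟩, y, hy, hyl⟩
          have hkx := (hl.mem_iff x).1 hxl
          have hWV : W ≠ V := fun h => hA ⟨x, h ▸ hx, hxl⟩
          have hyk : y < k := lt_of_le_of_ne (hle y hyl) fun h => hk_notMem W hW hWV (h ▸ hy)
          refine ⟨y, hy, x, hx, fun i hi => ⟨?_, (hVk i hi).trans_lt hkx⟩⟩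
          by_contra! hiy
          rcases hiy.eq_or_lt with h | h
          · exact hWV (hQ.eq_of_mem W hW V hV y hy (h ▸ hi))
          · exact hWV (hQ.nonCrossing V hV W hW i hi k hkV y hy x hx h hyk hkx).symm
        · rintro ⟨j, hj, m, hm, h⟩
          exact ⟨⟨m, hm, (hl.mem_iff m).2 (h k hkV).2⟩, j, hj, fun hjl =>
            lt_asymm (h k hkV).1 ((hl.mem_iff j).1 hjl)⟩
      have hpair : (V :: C).Pairwise Nested :=
        List.pairwise_cons.2 ⟨fun W hW => ((hnest W).1 hW).2, hC⟩
      have htree : χ k :: st.string ∈ T.strings := by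
        obtain ⟨C₁, ⟨hC₁, hC₁'⟩, s, hs, hs'⟩ := hT V hV
        obtain rfl : C₁ = V :: C := eq_of_pairwise_nested hC₁ hpair fun W => by
          rw [hC₁', List.mem_cons, hnest]
          constructor
          · rintro ⟨hW, rfl | h⟩
            · exact .inl rfl
            · exact .inr ⟨hW, h⟩
          · rintro (rfl | ⟨hW, h⟩)
            · exact ⟨hV, .inl rfl⟩
            · exact ⟨hW, .inr h⟩
        obtain _ | ⟨h1, h2⟩ := hs'
        rw [h1 k hkV, State.string, ← colors_eq_of_forall₂
          (fun W hW => hQ.nonempty W ((hnest W).1 hW).1) h2 hstack]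
        exact hs
      by_cases hB : ∃ x ∈ V, x ∉ k :: l
      · refine ⟨_, hnext _ (State.mem_step_iff.2 (.inl ⟨htree, .inr rfl⟩)), fun W => ?_, V :: C, hpair,
          fun W => ?_, .cons ⟨fun i => ?_, fun i hi => hQ.color V hV i hi k hkV⟩ (hstack' hVC)⟩
        · refine (hclosed W).trans (and_congr_right fun hW => ?_)
          by_cases hWV : W = V
          · subst hWV
            obtain ⟨x, hx, hxl⟩ := hB
            exact iff_of_false (fun h => hkl (h k hkV)) fun h => hxl (h x hx)
          · exact forall₂_congr fun i hi => (hmem_cons W hW hWV i hi).symm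
        · by_cases hWV : W = V
          · subst hWV
            exact iff_of_true List.mem_cons_self ⟨hV, ⟨k, hkV, List.mem_cons_self⟩, hB⟩
          · rw [List.mem_cons, or_iff_right hWV, hmem]
            exact and_congr_right fun hW => (hstr W hW hWV).symm
        · rw [Finset.mem_singleton, List.mem_cons]
          constructor
          · rintro rfl
            exact ⟨hkV, .inl rfl⟩
          · rintro ⟨hi, rfl | hil⟩
            · rfl
            · exact absurd ⟨i, hi, hil⟩ hA
      · push Not at hB
        have hVeq : V = {k} := by
          ext i
          rw [Finset.mem_singleton]
          refine ⟨fun hi => (List.mem_cons.1 (hB i hi)).resolve_right fun h => hA ⟨i, hi, h⟩, ?_⟩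
          rintro rfl
          exact hkV
        refine ⟨_, hnext _ (State.mem_step_iff.2 (.inl ⟨htree, .inl rfl⟩)), fun W => ?_, C, hC,
          fun W => ?_, hstack' hVC⟩
        · rw [← hVeq, State.close, Finset.mem_insert, hclosed]
          by_cases hWV : W = V
          · subst hWV
            exact iff_of_true (.inl rfl) ⟨hV, hB⟩
          · rw [or_iff_right hWV]
            exact and_congr_right fun hW => forall₂_congr fun i hi => (hmem_cons W hW hWV i hi).symm
        · by_cases hWV : W = V
          · subst hWV
            exact iff_of_false hVC fun ⟨_, _, x, hx, hxl⟩ => hxl (hB x hx)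
          · exact (hmem W).trans (and_congr_right fun hW => (hstr W hW hWV).symm)

end bijection

/-! ### The moment formula -/

section moments
variable {ℓ N : ℕ} {H : Fin N → PointedCorr B} {χ : Fin ℓ → Fin N}
  {a : ∀ i, (H (χ i)).toCorr.adj} {T : RootedSubtree N} {l : List (Fin ℓ)}

open State

theorem prod_lam_apply_vec (hl : IsFinalSegment l) :
    (l.map fun i => lam T H (χ i) (a i)).prod.1 (product T H).vec
      = ((run T a l).map (vec' T)).sum := by
  induction l with
  | nil =>
    rw [run, List.map_singleton, List.sum_singleton, vec'_eq T.nil_mem]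
    rfl
  | cons k l ih =>
    have h1 : ((k :: l).map fun i => lam T H (χ i) (a i)).prod.1 (product T H).vec
        = (lam T H (χ k) (a k)).1
          ((l.map fun i => lam T H (χ i) (a i)).prod.1 (product T H).vec) := by
      rw [List.map_cons, List.prod_cons]
      rfl
    have h2 : ∀ L : List (State H χ), (∀ st ∈ L, st.Valid T a l) →
        (lam T H (χ k) (a k)).1 (L.map (vec' T)).sum
          = ((L.flatMap (State.step T k)).map (vec' T)).sum := by
      intro L hL
      induction L with
      | nil => simp
      | cons st L ihL =>
        have hst := hL st List.mem_cons_self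
        rw [List.map_cons, List.sum_cons, map_add, List.flatMap_cons, List.map_append,
          List.sum_append, ihL fun st' h => hL st' (List.mem_cons_of_mem _ h),
          ← lam_vec hst.string_mem hst.isStack fun p hp i hi =>
            (hl.mem_iff i).1 (hst.mem_of_stack hp hi), hst.ops k hl.notMem]
    rw [h1, ih hl.tail, h2 _ fun st h => valid_of_mem_run hl.tail h]
    rfl

/-- The vacuum expectation of the vector of a state. -/
theorem ip_vec_vec' {st : State H χ} (h : st.string ∈ T.strings) :
    (product T H).ip (product T H).vec (st.vec' T)
      = if st.stack.isEmpty then st.coeff else 0 := by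
  rw [vec'_eq h]
  rcases st with ⟨P, O, a', b⟩
  rcases O with - | ⟨p, O⟩
  · exact ip_vec_stringIncl_nil T H b
  · exact ip_vec_stringIncl_of_ne T H h (by simp [string]) _

theorem mem_NC {π : Finpartition (Finset.univ : Finset (Fin ℓ))} :
    π ∈ NC T χ ↔
      NonCrossing π.parts ∧ ColorCompatible χ π.parts ∧ TreeCompatible T χ π.parts := by
  simp [NC]

/-- The families of closed blocks of the states without open blocks are the partitions in `NC(χ, T)`. -/
theorem mem_image_NC_iff {P : Finset (Finset (Fin ℓ))} :
    P ∈ (NC T χ).image Finpartition.parts ↔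
      ∃ st ∈ run T a (List.finRange ℓ), st.stack.isEmpty ∧ st.closed = P := by
  rw [Finset.mem_image]
  constructor
  · rintro ⟨π, hπ, rfl⟩
    obtain ⟨h1, h2, h3⟩ := mem_NC.1 hπ
    obtain ⟨st, hst, h4, C, -, h5, h6⟩ := exists_trace_mem_run (a := a) (π.isColoredNC h1 h2)
      (fun i => π.exists_mem (Finset.mem_univ i)) h3 isFinalSegment_finRange
    refine ⟨st, hst, ?_, ?_⟩
    · obtain rfl : C = [] := List.eq_nil_iff_forall_not_mem.2 fun W hW => by
        obtain ⟨-, -, x, -, hx⟩ := (h5 W).1 hW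
        exact hx (List.mem_finRange x)
      rw [List.forall₂_nil_left_iff.1 h6]
      rfl
    · ext V
      rw [h4]
      exact and_iff_left fun i _ => List.mem_finRange i
  · rintro ⟨st, hst, h0, rfl⟩
    have h := valid_of_mem_run isFinalSegment_finRange hst
    have hO : st.stack = [] := List.isEmpty_iff.1 h0
    have hcov : ∀ i, ∃ V ∈ st.closed, i ∈ V := fun i => by
      have := (h.mem_iff i).1 (List.mem_finRange i)
      simpa [hO] using this
    refine ⟨Finpartition.ofExistsUnique st.closed (fun V _ => Finset.subset_univ V) (fun i _ => ?_)
      fun h' => ?_, ?_, rfl⟩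
    · obtain ⟨V, hV, hi⟩ := hcov i
      exact ⟨V, ⟨hV, hi⟩, fun W hW => h.isColoredNC.eq_of_mem W hW.1 V hV i hW.2 hi⟩
    · exact Finset.not_nonempty_empty (h.isColoredNC.nonempty _ h')
    · refine mem_NC.2 ⟨h.isColoredNC.nonCrossing, h.isColoredNC.color, fun V hV => ?_⟩
      obtain ⟨D, E, h1, h2, h3, -, h5⟩ := h.chain V hV
      rw [hO, List.suffix_nil] at h3
      rw [h3, List.append_nil] at h5
      refine ⟨D.map Prod.fst, h1, D.map Prod.snd, h5, ?_⟩
      rw [List.forall₂_map_left_iff, List.forall₂_map_right_iff, List.forall₂_same]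
      exact h2

/-- The vacuum expectation of `λ(a_1) ⋯ λ(a_ℓ)` as a sum over non-crossing partitions. -/
theorem moment_eq_sum (a : ∀ i, (H (χ i)).toCorr.adj) :
    (product T H).ip (product T H).vec
        ((List.ofFn fun i => lam T H (χ i) (a i)).prod.1 (product T H).vec)
      = ∑ π ∈ NC T χ, Lam H χ π.parts a := by
  have hvalid : ∀ st ∈ run T a (List.finRange ℓ), st.Valid T a (List.finRange ℓ) := fun st =>
    valid_of_mem_run isFinalSegment_finRange
  have hsum : ∀ L : List (State H χ), (∀ st ∈ L, st.string ∈ T.strings) →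
      (product T H).ip (product T H).vec (L.map (vec' T)).sum
        = ((L.filter fun st => st.stack.isEmpty).map State.coeff).sum := by
    intro L hL
    induction L with
    | nil => simp
    | cons st L ih =>
      rw [List.map_cons, List.sum_cons, map_add, ih fun st' h => hL st' (List.mem_cons_of_mem _ h),
        ip_vec_vec' (hL st List.mem_cons_self), List.filter_cons]
      split_ifs <;> simp
  rw [List.ofFn_eq_map, prod_lam_apply_vec isFinalSegment_finRange,
    hsum _ fun st h => (hvalid st h).string_mem]
  set F := (run T a (List.finRange ℓ)).filter fun st => st.stack.isEmpty with hF
  have hcoeff : F.map State.coeff = (F.map State.closed).map fun P => Lam H χ P a := by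
    rw [List.map_map]
    refine List.map_congr_left fun st hst => ?_
    obtain ⟨hst, h0⟩ := List.mem_filter.1 hst
    have h := hvalid st hst
    have hO : st.stack = [] := List.isEmpty_iff.1 h0
    have h1 := h.Lam_eq st.closed h.isColoredNC (fun i => by
      have := (h.mem_iff i).1 (List.mem_finRange i)
      simpa [hO] using this) subset_rfl
    rw [sdiff_self, Finset.bot_eq_empty, Lam_empty, one_mul] at h1
    exact h1.symm
  have hnodup : (F.map State.closed).Nodup := by
    have h1 := List.pairwise_map.1 (nodup_map_run (T := T) (a := a) isFinalSegment_finRange)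
    refine List.pairwise_map.2 ((h1.filter _).imp_of_mem fun {st st'} hst hst' hne h => hne ?_)
    rw [List.isEmpty_iff.1 (List.mem_filter.1 hst).2, List.isEmpty_iff.1 (List.mem_filter.1 hst').2, h]
  have hNC : (NC T χ).image Finpartition.parts = (F.map State.closed).toFinset := by
    ext P
    rw [mem_image_NC_iff (a := a), List.mem_toFinset, List.mem_map]
    simp only [hF, List.mem_filter, and_assoc]
  rw [hcoeff, ← List.sum_toFinset _ hnodup, ← hNC,
    Finset.sum_image fun π _ π' _ h => Finpartition.ext h]

end moments
end TFree

theorem theorem4 {B : Type u} [CStarAlgebra B] [PartialOrder B] [StarOrderedRing B] {N : ℕ}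
    (T : TFree.RootedSubtree N) (H : Fin N → TFree.PointedCorr B) {ℓ : ℕ} (χ : Fin ℓ → Fin N) :
    (∀ a : (∀ i, (H (χ i)).toCorr.adj),
      (TFree.product T H).ip (TFree.product T H).vec
          ((List.ofFn fun i => TFree.lam T H (χ i) (a i)).prod.1 (TFree.product T H).vec)
        = ∑ π ∈ TFree.NC T χ, TFree.Lam H χ π.parts a) ∧
    (∀ a : (∀ i, (H (χ i)).toCorr.adj), TFree.Lam H χ ∅ a = 1) ∧
    (∀ (S : Finset (Fin ℓ)) (π : Finpartition S), TFree.NonCrossing π.parts →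
      TFree.ColorCompatible χ π.parts → ∀ V, TFree.IsIntervalBlock π.parts V →
      ∀ a : (∀ i, (H (χ i)).toCorr.adj),
        (∀ n, IsLeast (TFree.laterElements π.parts V : Set (Fin ℓ)) n →
          TFree.Lam H χ π.parts a
            = TFree.Lam H χ (π.parts.erase V) (Function.update a n
                ((H (χ n)).toCorr.leftOp (TFree.blockCumulant H χ a V) * a n))) ∧
        (TFree.laterElements π.parts V = ∅ →
          TFree.Lam H χ π.parts a
            = TFree.Lam H χ (π.parts.erase V) a * TFree.blockCumulant H χ a V)) := by
  refine ⟨TFree.moment_eq_sum, fun a => TFree.Lam_empty H, fun S π h h' V hV a => ⟨fun n hn => ?_,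
    fun h0 => ?_⟩⟩
  · rw [(π.isColoredNC h h').Lam_eq H hV, TFree.removal_of_isLeast H hn, mul_one]
  · rw [(π.isColoredNC h h').Lam_eq H hV, TFree.removal_of_empty H h0]
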